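/- **Setting.** Let $F$ be a dyadic local field of characteristic $0$ (complete with respect to a discrete valuation, with finite residue field of characteristic $2$), with ring of integers $\mathcal O$, prime ideal $\mathfrak p=\pi\mathcal O$, normalized valuation $\mathrm{ord}:F\to\mathbb Z\cup\{\infty\}$, $\dot F=F\setminus\{0\}$, and $e=\mathrm{ord}\,2$. Let $(\cdot,\cdot)_{\mathfrak p}$ be the Hilbert symbol, $\mathfrak d(a)=\bigcap_{x\in F}(a-x^2)\mathcal O$ the quadratic defect and $d(a)=\mathrm{ord}\,a^{-1}\mathfrak d(a)$ for $a\in\dot F$. Let $\Delta=1-4\rho$, with $\rho\in\mathcal O^\times$, be a unit with $\mathfrak d(\Delta)=4\mathcal O$. Let $L$ be a (nondegenerate) quadratic lattice over $\mathcal O$ with quadratic form $Q$, $V=FL$. Its norm $\mathfrak nL$ is the fractional ideal generated by $Q(L)$, and $x\in L$ is a norm generator if $Q(x)\mathcal O=\mathfrak nL$. A basis of norm generators (BONG) of $L$ is defined recursively as a sequence $x_1,\ldots,x_n$ such that $x_1$ is a norm generator of $L$, $Q(x_1)\ne0$, and $x_2,\ldots,x_n$ is a BONG of the orthogonal projection of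 $L$ on $x_1^\perp$ (the empty sequence being the BONG of $0$). The BONG is good if $\mathrm{ord}\,Q(x_i)\le\mathrm{ord}\,Q(x_{i+2})$ for $1\le i\le n-2$. We write $L\cong\prec a_1,\ldots,a_n\succ$ if $L$ has a BONG $x_1,\ldots,x_n$ with $Q(x_i)=a_i$. In the statement below all such descriptions of $L$ and $L'$ are relative to good BONGs. Let $L\cong\prec a_1,\ldots,a_n\succ$ relative to a good BONG, and let $R_i=\mathrm{ord}\,a_i$. $L$ has property A if $R_i<R_{i+2}$ for $1\le i\le n-2$. It has property B if it has property A and, for every $1\le i\le n-1$ such that either $R_{i+1}-R_i$ is odd and $\le 2e+1$, or $R_{i+1}-R_i$ is even and $d(-a_ia_{i+1})\le e-(R_{i+1}-R_i)/2$, we have $R_i-R_{i-1}>2e$ (if $i\ge2$) and $R_{i+2}-R_{i+1}>2e$ (if $i\le n-2$). Let $O^+(L)=\{\sigma\in O^+(V)\mid\sigma(L)=L\}$ and let $\theta$ be the spinor norm; $\theta(O^+(L))$ is regarded as a subgroup of $\dot F$ containing $\dot F^2$. A lattice $J$ is called maximal if there is no lattice $M\supsetneq J$ with $FM=FJ$ and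 $\mathfrak nM\subseteq\mathfrak nJ$. Finally, let $$L'=\{x\in L\mid x\text{ is not a norm generator of }L\}.$$ **Lemma.** Assume that $L$ has property B or $\theta(O^+(L))=\mathcal O^\times\dot F^2$. If $n\ge2$ and $R_2-R_1=-2e$, then: (i) If $a_1a_2\in-\Delta\dot F^2$ and $R_1<R_3$ (or $n=2$), then $L'$ is a lattice and $L'\cong\prec\pi^2a_1,\pi^2a_2,a_3,\ldots,a_n\succ$. (ii) If $a_1a_2\in-\dot F^2$, or $n\ge3$ and $R_1=R_3$, then $L'$ is not a lattice (it is not even an $\mathcal O$-module). If $n=1$, or $n\ge2$ and $R_2-R_1>-2e$, then: (iii) If $n=1$, or if $\prec a_1,a_2\succ$ is not maximal and $R_1<R_3$ (or $n=2$), then $L'$ is a lattice and $L'\cong\prec\pi^2a_1,a_2,a_3,\ldots,a_n\succ$. (iv) If $n\ge 2$ and $\prec a_1,a_2\succ$ is maximal, then there is $\eta\in\mathcal O^\times$ such that $(\pi\eta,-a_1a_2)_{\mathfrak p}=1$, and for every such $\eta$, $L'$ is a lattice and $L'\cong\prec\pi\eta a_1,\pi\eta a_2,a_3,\ldots,a_n\succ$.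 (v) If $n\ge3$, $R_1=R_3$, and $1\le k\le\frac{n-1}2$ is maximal with the property that $R_1=R_{2k+1}$, then $a_1a_2\cdots a_{2k+1}\in(-1)^k\varepsilon\pi^{R_1}\dot F^2$ for some $\varepsilon\in\mathcal O^\times$, and for every such $\varepsilon$ we have $$L\cong\prec\pi^{R_1}\varepsilon,-\pi^{R_2}\varepsilon,\pi^{R_3}\varepsilon,\ldots,-\pi^{R_{2k}}\varepsilon,\pi^{R_{2k+1}}\varepsilon,a_{2k+2},\ldots,a_n\succ,$$ and $L'$ is a lattice with $$L'\cong\prec\pi^{R_1+2}\varepsilon,-\pi^{R_2-2}\varepsilon,\pi^{R_3+2}\varepsilon,\ldots,-\pi^{R_{2k}-2}\varepsilon,\pi^{R_{2k+1}+2}\varepsilon,a_{2k+2},\ldots,a_n\succ.$$ -/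

import Mathlib

/-!
Quadratic lattices over the ring of integers `O` of a local field `F`, and their bases of norm
generators.  Throughout, `O` is a discrete valuation ring with fraction field `F`, and `V` is a
quadratic space over `F` with quadratic form `Q`; the symmetric bilinear form is
`B(x, y) = (Q(x + y) - Q(x) - Q(y)) / 2 = QuadraticMap.polar Q x y / 2`, so that `Q(x) = B(x, x)`.
-/

namespace DyadicLattice

noncomputable section Field

variable (O : Type*) {F : Type*} [CommRing O] [IsDomain O] [IsDiscreteValuationRing O]
  [Field F] [Algebra O F] [IsFractionRing O F]

open Classical in
/-- The normalized additive valuation `ord : F → ℤ ∪ {∞}`. -/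
def ord (x : F) : WithTop ℤ :=
  if x = 0 then ⊤
  else ((-(WithZero.log ((IsDiscreteValuationRing.maximalIdeal O).valuation F x)) : ℤ) :
    WithTop ℤ)

/-- The order of a fractional ideal: the least order of its elements (`∞` for the zero ideal). -/
def ordIdeal (I : Submodule O F) : WithTop ℤ := sInf (ord O '' (I : Set F))

/-- The quadratic defect of `a`: the intersection of the ideals `(a - x²)O`, `x ∈ F`. -/
def quadraticDefect (a : F) : Submodule O F :=
  ⨅ x : F, Submodule.span O {a - x ^ 2}

/-- The order `d(a)` of the relative quadratic defect, the order of the ideal `a⁻¹ 𝔡(a)`. -/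
def relDefect (a : F) : WithTop ℤ :=
  ordIdeal O (Submodule.span O {a⁻¹} * quadraticDefect O a)

/-- The subgroup `O^× (F^×)²` of `F^×`, as a subset of `F`. -/
def unitSquares : Set F :=
  {c | ∃ u t : F, ord O u = 0 ∧ t ≠ 0 ∧ c = u * t ^ 2}

open Classical in
/-- The Hilbert symbol `(a, b)` of nonzero elements `a`, `b` of the local field `F`. -/
def hilbertSymbol {K : Type*} [Field K] (a b : K) : ℤ :=
  if ∃ x y : K, a * x ^ 2 + b * y ^ 2 = 1 then 1 else -1

end Field

noncomputable section Space

variable {F V : Type*} [Field F] [AddCommGroup V] [Module F V]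

/-- The orthogonal projection `y ↦ y - (B(x, y) / Q(x)) x` of `V` onto `x^⊥`, for `Q(x) ≠ 0`. -/
def projPerp (Q : QuadraticForm F V) (x : V) : V →ₗ[F] V :=
  LinearMap.id - ((2 * Q x)⁻¹ • Q.polarBilin x).smulRight x

/-- The reflection `τ_x : y ↦ y - (2 B(x, y) / Q(x)) x`, for `Q(x) ≠ 0`. -/
def reflection (Q : QuadraticForm F V) (x : V) : V →ₗ[F] V :=
  LinearMap.id - ((Q x)⁻¹ • Q.polarBilin x).smulRight x

/-- `c` represents the spinor norm of `σ`: `σ` is a product of reflections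
`τ_{x₁} ⋯ τ_{x_r}` and `c ∈ Q(x₁) ⋯ Q(x_r) (F^×)²`. -/
def IsSpinorNorm (Q : QuadraticForm F V) (σ : V ≃ₗ[F] V) (c : F) : Prop :=
  ∃ l : List V, (∀ x ∈ l, Q x ≠ 0) ∧
    (σ : V →ₗ[F] V) = (l.map (reflection Q)).prod ∧
    ∃ t : F, t ≠ 0 ∧ c = (l.map Q).prod * t ^ 2

end Space

noncomputable section Lattice

variable {O F V : Type*} [CommRing O] [IsDomain O] [IsDiscreteValuationRing O]
  [Field F] [Algebra O F] [IsFractionRing O F]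
  [AddCommGroup V] [Module F V] [Module O V] [IsScalarTower O F V]

/-- The group `O⁺(L)` of rotations of `V` that map the lattice `L` on `V` onto itself. -/
def properOrthogonalGroup (Q : QuadraticForm F V) (L : Submodule O V) : Set (V ≃ₗ[F] V) :=
  {σ | (∀ y, Q (σ y) = Q y) ∧ LinearMap.det (σ : V →ₗ[F] V) = 1 ∧
    L.map ((σ : V →ₗ[F] V).restrictScalars O) = L}

/-- `θ(O⁺(L))`, the spinor norms of the rotations of `L`, as a union of cosets of `(F^×)²`. -/
def spinorNorms (Q : QuadraticForm F V) (L : Submodule O V) : Set F :=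
  {c | ∃ σ ∈ properOrthogonalGroup Q L, IsSpinorNorm Q σ c}

/-- The norm `𝔫L`: the fractional ideal generated by `Q(L)`. -/
def norm (Q : QuadraticForm F V) (L : Submodule O V) : Submodule O F :=
  Submodule.span O (Q '' (L : Set V))

/-- `x` is a norm generator of `L`: `x ∈ L` and `Q(x)O = 𝔫L`. -/
def IsNormGenerator (Q : QuadraticForm F V) (L : Submodule O V) (x : V) : Prop :=
  x ∈ L ∧ Submodule.span O {Q x} = norm Q L

/-- The set `L'` of the elements of `L` that are not norm generators of `L`. -/
def nonNormGenerators (Q : QuadraticForm F V) (L : Submodule O V) : Set V :=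
  {x | x ∈ L ∧ ¬ IsNormGenerator Q L x}

/-- `x₁, …, x_n` is a basis of norm generators (BONG) of `L`: `x₁` is an (anisotropic) norm
generator of `L` and `x₂, …, x_n` is a BONG of the projection of `L` to `x₁^⊥`. The empty sequence
is a BONG of the zero lattice only. -/
def IsBONG (Q : QuadraticForm F V) : (n : ℕ) → Submodule O V → (Fin n → V) → Prop
  | 0, L, _ => L = ⊥
  | n + 1, L, x =>
      IsNormGenerator Q L (x 0) ∧ Q (x 0) ≠ 0 ∧
        IsBONG Q n (L.map ((projPerp Q (x 0)).restrictScalars O)) (Fin.tail x)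

/-- `L ≅ ≺a₁, …, a_n≻` relative to some BONG. Only the values `a 1, …, a n` of `a` matter. -/
def HasBONG (Q : QuadraticForm F V) (L : Submodule O V) (n : ℕ) (a : ℕ → F) : Prop :=
  ∃ x : Fin n → V, IsBONG Q n L x ∧ ∀ i : Fin n, Q (x i) = a (i + 1)

/-- `L ≅ ≺a₁, …, a_n≻` relative to some good BONG, i.e. a BONG `x₁, …, x_n` with
`ord Q(x_i) ≤ ord Q(x_{i+2})` for `1 ≤ i ≤ n - 2`. Only `a 1, …, a n` matter. -/
def HasGoodBONG (Q : QuadraticForm F V) (L : Submodule O V) (n : ℕ) (a : ℕ → F) : Prop :=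
  ∃ x : Fin n → V, IsBONG Q n L x ∧
    (∀ i j : Fin n, (j : ℕ) = i + 2 → ord O (Q (x i)) ≤ ord O (Q (x j))) ∧
    ∀ i : Fin n, Q (x i) = a (i + 1)

/-- The subset `S` of `V` is a lattice with `S ≅ ≺b₁, …, b_n≻` relative to some good BONG. -/
def IsLatticeWithGoodBONG (O : Type*) [CommRing O] [IsDomain O] [IsDiscreteValuationRing O]
    [Algebra O F] [IsFractionRing O F] [Module O V] [IsScalarTower O F V]
    (Q : QuadraticForm F V) (S : Set V) (n : ℕ) (b : ℕ → F) : Prop :=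
  ∃ M : Submodule O V, (M : Set V) = S ∧ HasGoodBONG Q M n b

/-- `J` is `𝔫J`-maximal: it is not strictly contained in a lattice on the same quadratic space `FJ`
whose norm is contained in `𝔫J`. -/
def IsNormMaximal (Q : QuadraticForm F V) (J : Submodule O V) : Prop :=
  ∀ M : Submodule O V, M.FG →
    Submodule.span F (M : Set V) = Submodule.span F (J : Set V) →
    J ≤ M → norm Q M ≤ norm Q J → M = J

/-- The binary lattice `≺a₁, a₂≻` (realized inside `V`) is maximal. -/
def IsMaximalPair (O : Type*) [CommRing O] [IsDomain O] [IsDiscreteValuationRing O]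
    [Algebra O F] [IsFractionRing O F] [Module O V] [IsScalarTower O F V]
    (Q : QuadraticForm F V) (a : ℕ → F) : Prop :=
  ∃ J : Submodule O V, HasBONG Q J 2 a ∧ IsNormMaximal Q J

/-- Property A, in terms of `R_i = ord a_i`, where `L ≅ ≺a₁, …, a_n≻` relative to a good BONG. -/
def PropertyA (n : ℕ) (R : ℕ → ℤ) : Prop :=
  ∀ i, 1 ≤ i → i + 2 ≤ n → R i < R (i + 2)

/-- Property B, in terms of `a_i` and `R_i = ord a_i`, where `L ≅ ≺a₁, …, a_n≻` relative to a good
BONG, and of `e = ord 2`. -/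
def PropertyB (O : Type*) [CommRing O] [IsDomain O] [IsDiscreteValuationRing O]
    [Algebra O F] [IsFractionRing O F] (e : ℤ) (n : ℕ) (a : ℕ → F) (R : ℕ → ℤ) : Prop :=
  PropertyA n R ∧ ∀ i, 1 ≤ i → i + 1 ≤ n →
    ((Odd (R (i + 1) - R i) ∧ R (i + 1) - R i ≤ 2 * e + 1) ∨
      (Even (R (i + 1) - R i) ∧
        relDefect O (-(a i * a (i + 1))) ≤ ((e - (R (i + 1) - R i) / 2 : ℤ) : WithTop ℤ))) →
    (2 ≤ i → R i - R (i - 1) > 2 * e) ∧ (i + 2 ≤ n → R (i + 2) - R (i + 1) > 2 * e)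

end Lattice

end DyadicLattice

/-!
The set `L'` of vectors that are not norm generators is `{x ∈ L | ord Q(x) ≥ R₁ + 1}`. When
`R₂ - R₁ > -2e` the polar form of `Q` takes values of order at least `R₁ + 1` on `L`, so `L'` is
closed under addition. When `R₂ - R₁ = -2e` the first two vectors span a multiple of a plane with
norm form `X² + XY + ρY²`, which is anisotropic modulo `π` for `-a₁a₂ ∈ ΔḞ²`, so that `L'` is still
a lattice; a hyperbolic plane, or a third vector of order `R₁`, yields instead two vectors of `L'`
whose sum is a norm generator.

Otherwise everything depends on whether `L` represents an element of order `R₁ + 1`. If not, `L'` is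
obtained by replacing `x₁` with `π x₁`; this covers `R₁ < R₃` with `≺a₁, a₂≻` not maximal. If
`≺a₁, a₂≻` is maximal, it consists of all integral vectors of its plane, and property B makes the
rest of `L` small enough for `L'` to be read off from a similitude of that plane with factor `πη`.

The spinor norm condition is used only through reflections: a vector of `L` inducing a reflection of
`L` has a `Q`-value whose order is congruent to `R₁` modulo `2`. If `R₁ = R₃`, this makes the
ternary component on `x₁, x₂, x₃` split off a hyperbolic plane, spanned by isotropic vectors `y, g`,
and replaces `x₃` by a multiple. Splitting off such planes as long as `R₁ = R₂ₖ₊₁` and changing back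
to orthogonal vectors one plane at a time gives the alternating description of `L` and of `L'`.
-/

namespace DyadicLattice

open QuadraticMap (polar)

section Valuation

open WithZero (exp)

variable (O : Type*) {F : Type*} [CommRing O] [IsDomain O] [IsDiscreteValuationRing O]
  [Field F] [Algebra O F] [IsFractionRing O F]

/-- `ord x ≥ k`, i.e. `x` lies in the fractional ideal `𝔭 ^ k`; every `k` is allowed for `x = 0`. -/
def OrdGE (k : ℤ) (x : F) : Prop := (k : WithTop ℤ) ≤ ord O x

/-- `ord x = k`, which forces `x ≠ 0`. -/
def OrdEq (k : ℤ) (x : F) : Prop := ord O x = (k : WithTop ℤ)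

variable {O} {k l m : ℤ} {x y : F}

theorem ordGE_iff_valuation_le :
    OrdGE O k x ↔ (IsDiscreteValuationRing.maximalIdeal O).valuation F x ≤ exp (-k) := by
  rcases eq_or_ne x 0 with rfl | hx
  · simp [OrdGE, ord]
  · rw [OrdGE, ord, if_neg hx, WithTop.coe_le_coe, le_neg, WithZero.log_le_iff_le_exp (by simpa)]

theorem ordEq_iff_valuation_eq :
    OrdEq O k x ↔ (IsDiscreteValuationRing.maximalIdeal O).valuation F x = exp (-k) := by
  rcases eq_or_ne x 0 with rfl | hx
  · simpa [OrdEq, ord] using WithZero.exp_ne_zero.symm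
  · rw [OrdEq, ord, if_neg hx, WithTop.coe_inj, neg_eq_iff_eq_neg, ← WithZero.exp_inj,
      WithZero.exp_log (by simpa)]

theorem exists_ordEq (hx : x ≠ 0) : ∃ k, OrdEq O k x := ⟨_, if_neg hx⟩

theorem OrdEq.ne_zero (h : OrdEq O k x) : x ≠ 0 := by
  rintro rfl
  simp [OrdEq, ord] at h

theorem OrdGE.zero (k : ℤ) : OrdGE O k (0 : F) := by simp [ordGE_iff_valuation_le]

theorem OrdEq.ge (h : OrdEq O k x) : OrdGE O k x := Eq.ge h

theorem OrdEq.le_of_ge (h : OrdEq O k x) (h' : OrdGE O l x) : l ≤ k :=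
  WithTop.coe_le_coe.1 (h'.trans (Eq.le h))

theorem OrdEq.unique (h : OrdEq O k x) (h' : OrdEq O l x) : k = l :=
  le_antisymm (h'.le_of_ge h.ge) (h.le_of_ge h'.ge)

theorem OrdGE.mono (h : OrdGE O k x) (hl : l ≤ k) : OrdGE O l x :=
  (WithTop.coe_le_coe.2 hl).trans h

theorem exists_lt_ordEq (h : ¬ OrdGE O k x) : ∃ i < k, OrdEq O i x := by
  obtain ⟨i, hi, hik⟩ := WithTop.lt_iff_exists_coe.1 (not_le.1 h)
  exact ⟨i, WithTop.coe_lt_coe.1 hik, hi⟩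

theorem OrdGE.eq_or (h : OrdGE O k x) : OrdEq O k x ∨ OrdGE O (k + 1) x := by
  rcases eq_or_ne x 0 with rfl | hx
  · exact Or.inr (OrdGE.zero _)
  obtain ⟨l, hl⟩ := exists_ordEq (O := O) hx
  rcases (hl.le_of_ge h).eq_or_lt with rfl | hkl
  · exact Or.inl hl
  · exact Or.inr (hl.ge.mono hkl)

theorem OrdEq.of_ge (h : OrdGE O k x) (h' : ¬ OrdGE O (k + 1) x) : OrdEq O k x :=
  h.eq_or.resolve_right h'

theorem OrdEq.not_ge (h : OrdEq O k x) (hl : k < l) : ¬ OrdGE O l x :=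
  fun h' => (h.le_of_ge h').not_gt hl

theorem OrdEq.mul (hx : OrdEq O k x) (hy : OrdEq O l y) : OrdEq O (k + l) (x * y) := by
  rw [ordEq_iff_valuation_eq] at *
  rw [map_mul, hx, hy, ← WithZero.exp_add, neg_add]

theorem OrdGE.mul (hx : OrdGE O k x) (hy : OrdGE O l y) : OrdGE O (k + l) (x * y) := by
  rw [ordGE_iff_valuation_le] at *
  rw [map_mul, neg_add, WithZero.exp_add]
  exact mul_le_mul' hx hy

theorem OrdGE.add (hx : OrdGE O k x) (hy : OrdGE O k y) : OrdGE O k (x + y) := by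
  rw [ordGE_iff_valuation_le] at *
  exact Valuation.map_add_le _ hx hy

theorem OrdEq.neg (hx : OrdEq O k x) : OrdEq O k (-x) := by
  rwa [ordEq_iff_valuation_eq, Valuation.map_neg, ← ordEq_iff_valuation_eq]

theorem OrdGE.neg (hx : OrdGE O k x) : OrdGE O k (-x) := by
  rwa [ordGE_iff_valuation_le, Valuation.map_neg, ← ordGE_iff_valuation_le]

theorem OrdGE.sub (hx : OrdGE O k x) (hy : OrdGE O k y) : OrdGE O k (x - y) :=
  sub_eq_add_neg x y ▸ hx.add hy.neg

theorem ordEq_one : OrdEq O 0 (1 : F) := by simp [ordEq_iff_valuation_eq]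

theorem OrdEq.zpow (hx : OrdEq O k x) (m : ℤ) : OrdEq O (m * k) (x ^ m) := by
  rw [ordEq_iff_valuation_eq] at *
  rw [map_zpow₀, hx, ← WithZero.exp_zsmul, smul_eq_mul, mul_neg]

theorem ordEq_uniformizer_zpow {π : F} (hπ : OrdEq O 1 π) (m : ℤ) : OrdEq O m (π ^ m) := by
  simpa using hπ.zpow m

theorem OrdEq.inv (hx : OrdEq O k x) : OrdEq O (-k) x⁻¹ := by
  simpa using hx.zpow (-1)

theorem OrdEq.div (hx : OrdEq O k x) (hy : OrdEq O l y) : OrdEq O (k - l) (x / y) := by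
  rw [div_eq_mul_inv, sub_eq_add_neg]
  exact hx.mul hy.inv

theorem OrdGE.div (hx : OrdGE O k x) (hy : OrdEq O l y) : OrdGE O (k - l) (x / y) := by
  rw [div_eq_mul_inv, sub_eq_add_neg]
  exact hx.mul hy.inv.ge

theorem OrdEq.sq (hx : OrdEq O k x) : OrdEq O (2 * k) (x ^ 2) := by
  rw [pow_two, two_mul]
  exact hx.mul hx

theorem OrdGE.sq (hx : OrdGE O k x) : OrdGE O (2 * k) (x ^ 2) := by
  rw [pow_two, two_mul]
  exact hx.mul hx

theorem OrdGE.of_mul_left (h : OrdGE O k (x * y)) (hx : OrdEq O l x) (hm : m ≤ k - l) :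
    OrdGE O m y := by
  rw [← mul_div_cancel_left₀ y hx.ne_zero]
  exact (h.div hx).mono hm

theorem OrdGE.of_mul_right (h : OrdGE O k (x * y)) (hy : OrdEq O l y) (hm : m ≤ k - l) :
    OrdGE O m x :=
  OrdGE.of_mul_left (mul_comm x y ▸ h) hy hm

theorem OrdGE.of_sq (h : OrdGE O k (x ^ 2)) (hm : 2 * m ≤ k + 1) : OrdGE O m x := by
  rcases eq_or_ne x 0 with rfl | hx
  · exact OrdGE.zero _
  obtain ⟨i, hi⟩ := exists_ordEq (O := O) hx
  have := hi.sq.le_of_ge h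
  exact hi.ge.mono (by omega)

theorem OrdEq.of_sq (h : OrdEq O (2 * k) (x ^ 2)) : OrdEq O k x := by
  obtain ⟨i, hi⟩ := exists_ordEq (O := O) (pow_ne_zero_iff two_ne_zero |>.1 h.ne_zero)
  have := hi.sq.unique h
  rwa [show k = i by omega]

theorem OrdEq.add_ge (hx : OrdEq O k x) (hy : OrdGE O (k + 1) y) : OrdEq O k (x + y) :=
  .of_ge (hx.ge.add (hy.mono (by omega))) fun h =>
    hx.not_ge (by omega) (add_sub_cancel_right x y ▸ h.sub hy)

theorem OrdEq.of_add_ge (hx : OrdEq O k x) (h : OrdGE O (k + 1) (x + y)) : OrdEq O k y :=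
  neg_add_cancel_left x y ▸ hx.neg.add_ge h

theorem ordGE_zero_iff : OrdGE O 0 x ↔ ∃ o : O, algebraMap O F o = x := by
  rw [ordGE_iff_valuation_le, neg_zero, WithZero.exp_zero]
  refine ⟨fun h => IsDedekindDomain.HeightOneSpectrum.mem_integers_of_valuation_le_one F x
    fun v => ?_, ?_⟩
  · rwa [show v = IsDiscreteValuationRing.maximalIdeal O from IsDedekindDomain.HeightOneSpectrum.ext
      (IsLocalRing.eq_maximalIdeal (v.isPrime.isMaximal v.ne_bot))]
  · rintro ⟨o, rfl⟩
    exact IsDedekindDomain.HeightOneSpectrum.valuation_le_one _ o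

theorem ordGE_algebraMap (o : O) : OrdGE O 0 (algebraMap O F o) := ordGE_zero_iff.2 ⟨o, rfl⟩

theorem ordGE_zero_two : OrdGE O 0 (2 : F) := map_ofNat (algebraMap O F) 2 ▸ ordGE_algebraMap 2

theorem ordGE_one_algebraMap_iff {o : O} :
    OrdGE O 1 (algebraMap O F o) ↔ o ∈ IsLocalRing.maximalIdeal O := by
  rw [ordGE_iff_valuation_le, IsDedekindDomain.HeightOneSpectrum.valuation_of_algebraMap,
    ← pow_one (IsLocalRing.maximalIdeal O)]
  exact (IsDiscreteValuationRing.maximalIdeal O).intValuation_le_pow_iff_mem o 1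

theorem mem_span_singleton_iff (hx : OrdEq O k x) : y ∈ Submodule.span O {x} ↔ OrdGE O k y := by
  rw [Submodule.mem_span_singleton]
  refine ⟨?_, fun h => ?_⟩
  · rintro ⟨o, rfl⟩
    rw [Algebra.smul_def]
    exact ((ordGE_algebraMap o).mul hx.ge).mono (by omega)
  · obtain ⟨o, ho⟩ := ordGE_zero_iff.1 ((h.div hx).mono (by omega : 0 ≤ k - k))
    exact ⟨o, by rw [Algebra.smul_def, ho, div_mul_cancel₀ _ hx.ne_zero]⟩

theorem ordGE_zero_of_root {p q : F} (hp : OrdGE O 0 p) (hq : OrdGE O 0 q)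
    (h : x ^ 2 + p * x + q = 0) : OrdGE O 0 x := by
  by_contra hx
  obtain ⟨i, hi0, hi⟩ := exists_lt_ordEq hx
  have : OrdGE O i (-(p * x + q)) :=
    (((hp.mul hi.ge).mono (by omega)).add (hq.mono (by omega))).neg
  rw [show -(p * x + q) = x ^ 2 by linear_combination -h] at this
  exact hi.sq.not_ge (by omega) this

end Valuation

section Approximation

variable {O F : Type*} [CommRing O] [IsDomain O] [IsDiscreteValuationRing O]
  [Field F] [Algebra O F] [IsFractionRing O F] {e m : ℤ}

section Dyadic

variable [CharP (IsLocalRing.ResidueField O) 2]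

theorem ordGE_one_two : OrdGE O 1 (2 : F) := by
  rw [← map_ofNat (algebraMap O F) 2, ordGE_one_algebraMap_iff, ← IsLocalRing.residue_eq_zero_iff,
    map_ofNat]
  exact CharP.cast_eq_zero (IsLocalRing.ResidueField O) 2

theorem one_le_of_ordEq_two (he : OrdEq O e (2 : F)) : 1 ≤ e := he.le_of_ge ordGE_one_two

variable [PerfectField (IsLocalRing.ResidueField O)]

theorem exists_ordGE_one_sub_sq {u : F} (hu : OrdGE O 0 u) :
    ∃ v : F, OrdGE O 0 v ∧ OrdGE O 1 (u - v ^ 2) := by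
  obtain ⟨o, rfl⟩ := ordGE_zero_iff.1 hu
  have : ExpChar (IsLocalRing.ResidueField O) 2 := ExpChar.prime Nat.prime_two
  obtain ⟨r, hr⟩ := surjective_frobenius (IsLocalRing.ResidueField O) 2 (IsLocalRing.residue O o)
  obtain ⟨v, rfl⟩ := IsLocalRing.residue_surjective r
  refine ⟨algebraMap O F v, ordGE_algebraMap v, ?_⟩
  rw [← map_pow, ← map_sub, ordGE_one_algebraMap_iff, ← IsLocalRing.residue_eq_zero_iff, map_sub,
    map_pow, ← hr, frobenius_def, sub_self]

theorem exists_ordGE_add_sq_mul {q A π : F} {N j : ℤ} (hπ : OrdEq O 1 π)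
    (hq : OrdGE O (N + 2 * j) q) (hA : OrdEq O N A) :
    ∃ c : F, OrdGE O j c ∧ OrdGE O (N + 2 * j + 1) (q + c ^ 2 * A) := by
  have hj := ordEq_uniformizer_zpow hπ j
  have hjA := hj.sq.mul hA
  obtain ⟨v, hv, hv'⟩ := exists_ordGE_one_sub_sq (u := -(q / ((π ^ j) ^ 2 * A)))
    ((hq.div hjA).neg.mono (by omega))
  refine ⟨π ^ j * v, (hj.ge.mul hv).mono (by omega), ?_⟩
  have : q + (π ^ j * v) ^ 2 * A =
      -((-(q / ((π ^ j) ^ 2 * A)) - v ^ 2) * ((π ^ j) ^ 2 * A)) := by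
    field_simp [hj.ne_zero, hA.ne_zero]
    ring
  rw [this]
  exact (hv'.mul hjA.ge).neg.mono (by omega)

/- Successive approximation: an error of order `N + 2j` is improved by the previous lemma, and the
mixed term `2cdA` of `(c + d)²A` is harmless below the order `N + 2e`. -/
theorem exists_ordGE_add_sq_mul_of_even {q A π : F} {N : ℤ} (hπ : OrdEq O 1 π)
    (he : OrdEq O e (2 : F)) (hq : OrdGE O N q) (hA : OrdEq O N A) (hm : m < N + 2 * e)
    (heven : ∀ c k, OrdGE O 0 c → OrdEq O k (q + c ^ 2 * A) → k ≤ m → Even (k - N)) :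
    ∃ c : F, OrdGE O 0 c ∧ OrdGE O (m + 1) (q + c ^ 2 * A) := by
  have approx (i : ℕ) : N + i ≤ m + 1 → ∃ c : F, OrdGE O 0 c ∧ OrdGE O (N + i) (q + c ^ 2 * A) := by
    induction i with
    | zero => exact fun _ => ⟨0, OrdGE.zero _, by simpa using hq⟩
    | succ i ih =>
      intro hi
      push_cast at hi ⊢
      obtain ⟨c, hc, hc'⟩ := ih (by omega)
      rcases hc'.eq_or with hceq | hcge
      · obtain ⟨j, hj⟩ := heven c _ hc hceq (by omega)
        rw [show (i : ℤ) = 2 * j by omega] at hc' ⊢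
        obtain ⟨d, hd, hd'⟩ := exists_ordGE_add_sq_mul hπ hc' hA
        refine ⟨c + d, hc.add (hd.mono (by omega)), ?_⟩
        rw [show q + (c + d) ^ 2 * A = (q + c ^ 2 * A + d ^ 2 * A) + 2 * c * d * A by ring]
        exact (hd'.mono (by omega)).add ((((he.ge.mul hc).mul hd).mul hA.ge).mono (by omega))
      · exact ⟨c, hc, hcge.mono (by omega)⟩
  rcases le_or_gt N (m + 1) with h | h
  · obtain ⟨i, hi⟩ := Int.eq_ofNat_of_zero_le (sub_nonneg.2 h)
    obtain ⟨c, hc, hc'⟩ := approx i (by omega)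
    exact ⟨c, hc, hc'.mono (by omega)⟩
  · exact ⟨0, OrdGE.zero _, by simpa using hq.mono h.le⟩

end Dyadic

section Henselian

variable [HenselianRing O (IsLocalRing.maximalIdeal O)]

theorem exists_root_sq_add_self {q : F} (hq : OrdGE O 1 q) :
    ∃ t : F, OrdGE O 1 t ∧ t ^ 2 + t + q = 0 := by
  obtain ⟨o, rfl⟩ := ordGE_zero_iff.1 (hq.mono zero_le_one)
  obtain ⟨t, ht, ht'⟩ := HenselianRing.is_henselian (I := IsLocalRing.maximalIdeal O)
    (Polynomial.X ^ 2 + Polynomial.X + Polynomial.C o)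
    (by monicity!) 0 (by simpa using ordGE_one_algebraMap_iff.1 hq) (by simp)
  refine ⟨algebraMap O F t, ordGE_one_algebraMap_iff.2 (by simpa using ht'), ?_⟩
  have : t ^ 2 + t + o = 0 := by simpa [Polynomial.IsRoot] using ht
  rw [← map_pow, ← map_add, ← map_add, this, map_zero]

theorem exists_root_of_ordGE {A B C : F} (hA : OrdGE O (m + 1) A) (hB : OrdEq O m B)
    (hC : OrdGE O (m + 1) C) : ∃ t : F, OrdGE O 1 t ∧ A + B * t + C * t ^ 2 = 0 := by
  obtain ⟨t, ht, ht'⟩ := exists_root_sq_add_self (q := A * C / B ^ 2)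
    (((hA.mul hC).div hB.sq).mono (by omega))
  have hu : OrdEq O 0 (1 + t) := ordEq_one.add_ge ht
  have hB0 := hB.ne_zero
  have hu0 := hu.ne_zero
  have hAC : A * C = -(t ^ 2 + t) * B ^ 2 := by
    field_simp at ht'
    linear_combination ht'
  refine ⟨-(A / (B * (1 + t))), (hA.div (hB.mul hu)).neg.mono (by omega), ?_⟩
  field_simp
  linear_combination A * hAC

end Henselian

end Approximation

section Defect

variable {O F : Type*} [CommRing O] [IsDomain O] [IsDiscreteValuationRing O]
  [Field F] [Algebra O F] [IsFractionRing O F] {e i k l : ℤ} {c s ν : F}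

theorem relDefect_le_of_mem (hc : OrdEq O k c) (hν : OrdEq O l ν)
    (hmem : ν ∈ quadraticDefect O c) : relDefect O c ≤ ((l - k : ℤ) : WithTop ℤ) := by
  have hle : quadraticDefect O c ≤ Submodule.span O {c} :=
    (iInf_le _ (0 : F)).trans_eq (by simp)
  have hintegral : Submodule.span O {c⁻¹} * quadraticDefect O c ≤ Submodule.span O {(1 : F)} := by
    refine (mul_le_mul' le_rfl hle).trans_eq ?_
    rw [Submodule.span_mul_span, Set.singleton_mul_singleton, inv_mul_cancel₀ hc.ne_zero]
  have hord : OrdEq O (l - k) (c⁻¹ * ν) := by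
    rw [sub_eq_neg_add]
    exact hc.inv.mul hν
  refine csInf_le ⟨((0 : ℤ) : WithTop ℤ), ?_⟩
    ⟨_, Submodule.mul_mem_mul (Submodule.mem_span_singleton_self _) hmem, hord⟩
  rintro _ ⟨y, hy, rfl⟩
  exact (mem_span_singleton_iff ordEq_one).1 (hintegral hy)

theorem not_ordGE_sq_add_sub_sq (he : OrdEq O e (2 : F)) (hs : OrdEq O i s) (hν : OrdEq O l ν)
    (hl : Odd l) (hle : l < 2 * e + 2 * i) (x : F) : ¬ OrdGE O (l + 1) (s ^ 2 + ν - x ^ 2) := by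
  intro hx
  have hprod : OrdEq O l ((s - x) * (2 * s - (s - x))) := by
    rw [show (s - x) * (2 * s - (s - x)) = -ν + (s ^ 2 + ν - x ^ 2) by ring]
    exact hν.neg.add_ge hx
  obtain ⟨z, hz⟩ := exists_ordEq (O := O) (left_ne_zero_of_mul hprod.ne_zero)
  rcases lt_or_ge z (e + i) with hlt | hge
  · have : OrdEq O z (2 * s - (s - x)) :=
      neg_add_eq_sub (s - x) (2 * s) ▸ hz.neg.add_ge ((he.mul hs).ge.mono (by omega))
    have := (hz.mul this).unique hprod
    obtain ⟨j, rfl⟩ := hl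
    omega
  · have := hprod.le_of_ge (hz.ge.mul ((he.mul hs).ge.sub (hz.ge.mono hge)))
    omega

theorem relDefect_sq_add_le (he : OrdEq O e (2 : F)) (hs : OrdEq O i s) (hν : OrdEq O l ν)
    (hl : Odd l) (hi : 2 * i ≤ l) (hle : l < 2 * e + 2 * i) :
    relDefect O (s ^ 2 + ν) ≤ ((l - 2 * i : ℤ) : WithTop ℤ) := by
  have hlt : 2 * i < l := by
    obtain ⟨j, rfl⟩ := hl
    omega
  refine relDefect_le_of_mem (hs.sq.add_ge (hν.ge.mono hlt)) hν
    ((Submodule.mem_iInf _).2 fun x => ?_)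
  have hne := not_ordGE_sq_add_sub_sq he hs hν hl hle x
  obtain ⟨j, hj⟩ := exists_ordEq (O := O) (x := s ^ 2 + ν - x ^ 2) fun h0 => hne (h0 ▸ .zero _)
  refine (mem_span_singleton_iff hj).2 (hν.ge.mono (not_lt.1 fun hlj => hne (hj.ge.mono hlj)))

end Defect

section QuadraticSpace

variable {F V : Type*} [Field F] [AddCommGroup V] [Module F V] (Q : QuadraticForm F V)

theorem map_smul_sq (c : F) (x : V) : Q (c • x) = c ^ 2 * Q x := by
  rw [QuadraticMap.map_smul, smul_eq_mul, pow_two]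

theorem polar_self_mul (x : V) : polar Q x x = 2 * Q x := by
  rw [QuadraticMap.polar_self, nsmul_eq_mul, Nat.cast_ofNat]

theorem polar_smul_add_left (c : F) (x y z : V) :
    polar Q (c • x + y) z = c * polar Q x z + polar Q y z := by
  rw [QuadraticMap.polar_add_left, QuadraticMap.polar_smul_left, smul_eq_mul]

theorem map_smul_add (c : F) (x y : V) :
    Q (c • x + y) = c ^ 2 * Q x + c * polar Q x y + Q y := by
  rw [QuadraticMap.map_add Q, map_smul_sq, QuadraticMap.polar_smul_left, smul_eq_mul]
  ring

theorem map_smul_add_of_polar_eq_zero (c : F) {x y : V} (h : polar Q x y = 0) :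
    Q (c • x + y) = c ^ 2 * Q x + Q y := by
  rw [map_smul_add, h, mul_zero, add_zero]

theorem projPerp_apply (x y : V) :
    projPerp Q x y = y - ((2 * Q x)⁻¹ * polar Q x y) • x := by
  simp [projPerp]

theorem reflection_apply (x y : V) :
    reflection Q x y = y - ((Q x)⁻¹ * polar Q x y) • x := by
  simp [reflection]

variable {Q}

theorem polar_projPerp (h2 : (2 : F) ≠ 0) {x : V} (hx : Q x ≠ 0) (y : V) :
    polar Q x (projPerp Q x y) = 0 := by
  rw [projPerp_apply, QuadraticMap.polar_sub_right, QuadraticMap.polar_smul_right,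
    polar_self_mul, smul_eq_mul]
  field_simp
  ring

theorem projPerp_eq_self {x y : V} (h : polar Q x y = 0) : projPerp Q x y = y := by
  rw [projPerp_apply, h, mul_zero, zero_smul, sub_zero]

theorem projPerp_self (h2 : (2 : F) ≠ 0) {x : V} (hx : Q x ≠ 0) : projPerp Q x x = 0 := by
  rw [projPerp_apply, polar_self_mul, inv_mul_cancel₀ (mul_ne_zero h2 hx), one_smul, sub_self]

theorem projPerp_smul_add (h2 : (2 : F) ≠ 0) {x y : V} (hx : Q x ≠ 0) (h : polar Q x y = 0)
    (c : F) : projPerp Q x (c • x + y) = y := by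
  rw [map_add, map_smul, projPerp_self h2 hx, projPerp_eq_self h, smul_zero, zero_add]

theorem projPerp_smul {c : F} (hc : c ≠ 0) (x : V) :
    projPerp Q (c • x) = projPerp Q x := by
  ext y
  rw [projPerp_apply, projPerp_apply, map_smul_sq, QuadraticMap.polar_smul_left, smul_smul,
    smul_eq_mul]
  congr 2
  rcases eq_or_ne (2 * Q x) 0 with h | h
  · rw [mul_left_comm 2, h]
    simp
  · have : (2 : F) ≠ 0 := left_ne_zero_of_mul h
    have : Q x ≠ 0 := right_ne_zero_of_mul h
    field_simp

theorem exists_eq_smul_add_projPerp (x y : V) : ∃ c : F, y = c • x + projPerp Q x y :=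
  ⟨_, by rw [projPerp_apply, add_sub_cancel]⟩

theorem map_reflection {x : V} (hx : Q x ≠ 0) (y : V) : Q (reflection Q x y) = Q y := by
  rw [reflection_apply, sub_eq_add_neg, ← neg_smul, add_comm, map_smul_add]
  field_simp
  ring

theorem reflection_reflection {x : V} (hx : Q x ≠ 0) (y : V) :
    reflection Q x (reflection Q x y) = y := by
  rw [reflection_apply, reflection_apply, QuadraticMap.polar_sub_right,
    QuadraticMap.polar_smul_right, polar_self_mul, smul_eq_mul, sub_sub, ← add_smul]
  convert sub_zero y
  convert zero_smul F x
  field_simp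
  ring

theorem det_reflection [Module.Finite F V] {x : V} (hx : Q x ≠ 0) :
    LinearMap.det (reflection Q x) = -1 := by
  have : reflection Q x = LinearMap.transvection (-((Q x)⁻¹ • Q.polarBilin x)) x := by
    ext y
    simp [reflection, LinearMap.transvection, sub_eq_add_neg]
  rw [this, LinearMap.transvection.det]
  simp only [LinearMap.neg_apply, LinearMap.smul_apply, QuadraticMap.polarBilin_apply_apply,
    polar_self_mul, smul_eq_mul]
  field_simp
  ring

/-- The reflection in an anisotropic vector, as a linear automorphism. -/
def reflectionEquiv {x : V} (hx : Q x ≠ 0) : V ≃ₗ[F] V :=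
  LinearEquiv.ofLinearMap (reflection Q x) (reflection Q x)
    (LinearMap.ext (reflection_reflection hx)) (LinearMap.ext (reflection_reflection hx))

theorem coe_reflectionEquiv {x : V} (hx : Q x ≠ 0) :
    (reflectionEquiv hx : V →ₗ[F] V) = reflection Q x := rfl

end QuadraticSpace

section Submodule

variable {O F V : Type*} [CommRing O] [Field F] [Algebra O F]
  [AddCommGroup V] [Module F V] [Module O V] [IsScalarTower O F V] {Q : QuadraticForm F V}
  {L : Submodule O V}

omit [IsScalarTower O F V] in
theorem map_mem_norm {y : V} (hy : y ∈ L) : Q y ∈ norm Q L :=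
  Submodule.subset_span ⟨y, hy, rfl⟩

theorem mul_mem_spinorNorms [Module.Finite F V] {x z : V} (hx : Q x ≠ 0) (hz : Q z ≠ 0)
    (hxL : ∀ y ∈ L, reflection Q x y ∈ L) (hzL : ∀ y ∈ L, reflection Q z y ∈ L) :
    Q z * Q x ∈ spinorNorms Q L := by
  refine ⟨(reflectionEquiv hx).trans (reflectionEquiv hz), ⟨fun y => ?_, ?_, le_antisymm ?_ ?_⟩,
    [z, x], by simp [hx, hz], by ext y; simp [reflectionEquiv], 1, one_ne_zero, by simp⟩
  · exact (map_reflection hz _).trans (map_reflection hx y)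
  · rw [LinearEquiv.coe_trans, LinearMap.det_comp, coe_reflectionEquiv, coe_reflectionEquiv,
      det_reflection hx, det_reflection hz, neg_mul_neg, one_mul]
  · rintro _ ⟨y, hy, rfl⟩
    exact hzL _ (hxL _ hy)
  · intro y hy
    refine ⟨reflection Q x (reflection Q z y), hxL _ (hzL _ hy), ?_⟩
    change reflection Q z (reflection Q x (reflection Q x (reflection Q z y))) = y
    rw [reflection_reflection hx, reflection_reflection hz]

/-- The lattice of the projections of the vectors of `L` to the orthogonal complement of `x`. -/
abbrev projLattice (Q : QuadraticForm F V) (L : Submodule O V) (x : V) : Submodule O V :=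
  L.map ((projPerp Q x).restrictScalars O)

theorem mem_projLattice {x y : V} : y ∈ projLattice Q L x ↔ ∃ z ∈ L, projPerp Q x z = y :=
  Submodule.mem_map

variable {f : V →ₗ[F] V} {W : Submodule F V}

theorem map_projPerp (hf : ∀ y ∈ W, Q (f y) = Q y) {x y : V} (hx : x ∈ W) (hy : y ∈ W) :
    f (projPerp Q x y) = projPerp Q (f x) (f y) := by
  have hpolar : polar Q (f x) (f y) = polar Q x y := by
    rw [polar, polar, ← map_add, hf _ (W.add_mem hx hy), hf _ hx, hf _ hy]
  rw [projPerp_apply, projPerp_apply, map_sub, map_smul, hpolar, hf _ hx]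

theorem projLattice_map (hf : ∀ y ∈ W, Q (f y) = Q y) (hL : ∀ y ∈ L, y ∈ W) {x : V}
    (hx : x ∈ W) : projLattice Q (L.map (f.restrictScalars O)) (f x) =
      (projLattice Q L x).map (f.restrictScalars O) := by
  rw [projLattice, ← Submodule.map_comp, ← Submodule.map_comp]
  ext y
  simp only [Submodule.mem_map, LinearMap.comp_apply, LinearMap.coe_restrictScalars]
  exact exists_congr fun z => and_congr_right fun hz => by rw [map_projPerp hf hx (hL _ hz)]

theorem norm_map (hf : ∀ y ∈ W, Q (f y) = Q y) (hL : ∀ y ∈ L, y ∈ W) :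
    norm Q (L.map (f.restrictScalars O)) = norm Q L := by
  rw [norm, norm, Submodule.map_coe, Set.image_image]
  exact congrArg _ (Set.image_congr fun y hy => hf y (hL y hy))

theorem IsBONG.map (hf : ∀ y ∈ W, Q (f y) = Q y) :
    ∀ {n : ℕ} {L : Submodule O V} {x : Fin n → V}, (∀ y ∈ L, y ∈ W) → IsBONG Q n L x →
      IsBONG Q n (L.map (f.restrictScalars O)) (f ∘ x) ∧ ∀ i, Q (f (x i)) = Q (x i)
  | 0, L, _, _, (h : L = ⊥) => ⟨h ▸ Submodule.map_bot _, fun i => i.elim0⟩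
  | n + 1, L, x, hL, ⟨hgen, hne, htail⟩ => by
    have hx : x 0 ∈ W := hL _ hgen.1
    have hproj : ∀ y ∈ projLattice Q L (x 0), y ∈ W := by
      intro y hy
      obtain ⟨z, hz, rfl⟩ := mem_projLattice.1 hy
      rw [projPerp_apply]
      exact W.sub_mem (hL _ hz) (W.smul_mem _ hx)
    obtain ⟨hbong, hval⟩ := IsBONG.map hf hproj htail
    refine ⟨⟨⟨Submodule.mem_map_of_mem hgen.1, ?_⟩, ?_, ?_⟩, Fin.cases (hf _ hx) hval⟩
    · rw [Function.comp_apply, hf _ hx, hgen.2, norm_map hf hL]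
    · rwa [Function.comp_apply, hf _ hx]
    · change IsBONG Q n (projLattice Q (L.map (f.restrictScalars O)) (f (x 0))) _
      exact projLattice_map hf hL hx ▸ hbong

end Submodule

section Lattice

variable {O F V : Type*} [CommRing O] [IsDomain O] [IsDiscreteValuationRing O]
  [Field F] [Algebra O F] [IsFractionRing O F]
  [AddCommGroup V] [Module F V] [Module O V]
  {Q : QuadraticForm F V} {L : Submodule O V} {k : ℤ} {x y z : V}

theorem isNormGenerator_iff (hx : OrdEq O k (Q x)) :
    IsNormGenerator Q L x ↔ x ∈ L ∧ ∀ y ∈ L, OrdGE O k (Q y) := by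
  refine and_congr_right fun hxL => ⟨fun h y hy => ?_, fun h => le_antisymm ?_ ?_⟩
  · rw [← mem_span_singleton_iff hx, h]
    exact map_mem_norm hy
  · rw [Submodule.span_singleton_le_iff_mem]
    exact map_mem_norm hxL
  · refine Submodule.span_le.2 ?_
    rintro _ ⟨y, hy, rfl⟩
    exact (mem_span_singleton_iff hx).2 (h y hy)

theorem nonNormGenerators_eq (hx : OrdEq O k (Q x)) (h : IsNormGenerator Q L x) :
    nonNormGenerators Q L = {y | y ∈ L ∧ OrdGE O (k + 1) (Q y)} := by
  have hQ := ((isNormGenerator_iff hx).1 h).2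
  ext y
  refine and_congr_right fun hy => ⟨fun hnot => ?_, fun hge hgen => ?_⟩
  · exact (hQ y hy).eq_or.resolve_left fun heq => hnot ((isNormGenerator_iff heq).2 ⟨hy, hQ⟩)
  · have hmem : Q x ∈ Submodule.span O {Q y} := hgen.2 ▸ map_mem_norm h.1
    rcases eq_or_ne (Q y) 0 with h0 | h0
    · rw [h0, Submodule.span_zero_singleton, Submodule.mem_bot] at hmem
      exact hx.ne_zero hmem
    · obtain ⟨l, hl⟩ := exists_ordEq (O := O) h0
      have := hx.le_of_ge ((mem_span_singleton_iff hl).1 hmem)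
      have := hl.le_of_ge hge
      omega

theorem ordGE_polar (h : ∀ y ∈ L, OrdGE O k (Q y)) (hy : y ∈ L) (hz : z ∈ L) :
    OrdGE O k (polar Q y z) :=
  ((h _ (L.add_mem hy hz)).sub (h _ hy)).sub (h _ hz)

variable [IsScalarTower O F V]

theorem smul_mem_of_ordGE {c : F} (hc : OrdGE O 0 c) (hy : y ∈ L) : c • y ∈ L := by
  obtain ⟨o, rfl⟩ := ordGE_zero_iff.1 hc
  rw [algebraMap_smul]
  exact L.smul_mem o hy

/-- The vectors of a lattice whose values have order at least `k`, as a sublattice; it is closed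
under addition because the polar form has order at least `k` on the lattice. -/
def sublatticeOrdGE (Q : QuadraticForm F V) (L : Submodule O V) (k : ℤ)
    (h : ∀ x ∈ L, ∀ y ∈ L, OrdGE O k (polar Q x y)) : Submodule O V where
  carrier := {x | x ∈ L ∧ OrdGE O k (Q x)}
  zero_mem' := ⟨L.zero_mem, by rw [QuadraticMap.map_zero]; exact OrdGE.zero _⟩
  add_mem' {x y} hx hy := ⟨L.add_mem hx.1 hy.1, by
    rw [QuadraticMap.map_add Q]
    exact (hx.2.add hy.2).add (h _ hx.1 _ hy.1)⟩
  smul_mem' c x hx := ⟨L.smul_mem c hx.1, by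
    rw [← algebraMap_smul F c x, map_smul_sq]
    exact ((ordGE_algebraMap c).sq.mul hx.2).mono (by omega)⟩

theorem reflection_mem (hxL : x ∈ L) (hx : OrdEq O k (Q x))
    (h : ∀ y ∈ L, OrdGE O k (polar Q x y)) (hy : y ∈ L) : reflection Q x y ∈ L := by
  rw [reflection_apply]
  exact L.sub_mem hy (smul_mem_of_ordGE ((hx.inv.ge.mul (h y hy)).mono (by omega)) hxL)

/-- A vector of the lattice `L` whose reflection preserves `L` has a value of order congruent to
`r` modulo `2`; the condition on the polar form is the one that makes the reflection preserve
`L`. -/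
def ReflectionParity (Q : QuadraticForm F V) (L : Submodule O V) (r : ℤ) : Prop :=
  ∀ x ∈ L, ∀ k, OrdEq O k (Q x) → (∀ y ∈ L, OrdGE O k (polar Q x y)) → Even (k - r)

theorem reflectionParity_of_spinorNorms [Module.Finite F V] {r : ℤ}
    (hx : OrdEq O r (Q x)) (h : IsNormGenerator Q L x)
    (hθ : spinorNorms Q L ⊆ unitSquares O) : ReflectionParity Q L r := by
  intro z hz k hk hpol
  have hQ := ((isNormGenerator_iff hx).1 h).2
  obtain ⟨u, t, hu, ht, hut⟩ := hθ (mul_mem_spinorNorms hx.ne_zero hk.ne_zero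
    (fun y hy => reflection_mem h.1 hx (fun w hw => ordGE_polar hQ h.1 hw) hy)
    (fun y hy => reflection_mem hz hk hpol hy))
  obtain ⟨j, hj⟩ := exists_ordEq (O := O) ht
  have := (hut ▸ hk.mul hx).unique (OrdEq.mul (show OrdEq O 0 u from hu) hj.sq)
  exact ⟨j - r, by omega⟩

end Lattice

section GoodBONG

variable {O F V : Type*} [CommRing O] [IsDomain O] [IsDiscreteValuationRing O]
  [Field F] [Algebra O F] [IsFractionRing O F]
  [AddCommGroup V] [Module F V] [Module O V] [IsScalarTower O F V]
  {Q : QuadraticForm F V} {L : Submodule O V} {n : ℕ} {a b : ℕ → F}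

theorem HasGoodBONG.congr (h : HasGoodBONG Q L n a) (hab : ∀ i, 1 ≤ i → i ≤ n → a i = b i) :
    HasGoodBONG Q L n b := by
  obtain ⟨x, hx, hgood, hval⟩ := h
  exact ⟨x, hx, hgood, fun i => (hval i).trans (hab _ (by omega) (by omega))⟩

theorem HasGoodBONG.map {W : Submodule F V} {f : V →ₗ[F] V} (hf : ∀ y ∈ W, Q (f y) = Q y)
    (hL : ∀ y ∈ L, y ∈ W) (h : HasGoodBONG Q L n a) :
    HasGoodBONG Q (L.map (f.restrictScalars O)) n a := by
  obtain ⟨x, hx, hgood, hval⟩ := h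
  obtain ⟨hfx, hQ⟩ := hx.map hf hL
  refine ⟨f ∘ x, hfx, fun i j hij => ?_, fun i => (hQ i).trans (hval i)⟩
  rw [Function.comp_apply, Function.comp_apply, hQ, hQ]
  exact hgood i j hij

theorem hasGoodBONG_zero : HasGoodBONG Q L 0 a ↔ L = ⊥ :=
  ⟨fun ⟨_, h, _⟩ => h, fun h => ⟨0, h, fun i => i.elim0, fun i => i.elim0⟩⟩

theorem HasGoodBONG.exists_head (h : HasGoodBONG Q L (n + 1) a) :
    ∃ x ∈ L, IsNormGenerator Q L x ∧ Q x = a 1 ∧ Q x ≠ 0 ∧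
      HasGoodBONG Q (projLattice Q L x) n (fun i => a (i + 1)) ∧
      (2 ≤ n → ord O (a 1) ≤ ord O (a 3)) := by
  obtain ⟨x, ⟨hgen, hne, htail⟩, hgood, hval⟩ := h
  refine ⟨x 0, hgen.1, hgen, by simpa using hval 0, hne, ⟨Fin.tail x, htail, ?_, ?_⟩, ?_⟩
  · exact fun i j hij => hgood i.succ j.succ (by simp [hij])
  · exact fun i => by simpa [Fin.tail] using hval i.succ
  · intro hn
    have := hgood ⟨0, by omega⟩ ⟨2, by omega⟩ rfl
    rwa [hval, hval] at this

theorem hasGoodBONG_succ {x : V} {k : ℤ} (hxL : x ∈ L)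
    (hx : Q x = a 1) (hk : OrdEq O k (a 1)) (hQ : ∀ y ∈ L, OrdGE O k (Q y))
    (h : HasGoodBONG Q (projLattice Q L x) n (fun i => a (i + 1)))
    (hgood : 2 ≤ n → OrdGE O k (a 3)) : HasGoodBONG Q L (n + 1) a := by
  obtain ⟨z, hz, hzgood, hval⟩ := h
  refine ⟨Fin.cons x z, ⟨(isNormGenerator_iff (hx ▸ hk)).2 ⟨hxL, hQ⟩, ?_, ?_⟩, ?_, ?_⟩
  · rw [Fin.cons_zero, hx]
    exact hk.ne_zero
  · rwa [Fin.cons_zero, Fin.tail_cons]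
  · intro i j hij
    induction j using Fin.cases with
    | zero => simp at hij
    | succ j =>
      induction i using Fin.cases with
      | zero =>
        have hj : (j : ℕ) = 1 := by simpa using hij
        rw [Fin.cons_zero, Fin.cons_succ, hx, hval, hj]
        exact (le_of_eq hk).trans (hgood (by omega))
      | succ i =>
        rw [Fin.cons_succ, Fin.cons_succ]
        exact hzgood i j (by simp at hij; omega)
  · exact Fin.cases (by simpa using hx) fun i => by simp [hval]

/-- The values `a 1, …, a n` of a good BONG have the orders `R 1, …, R n`. -/
def HasOrders (O : Type*) {F : Type*} [CommRing O] [IsDomain O] [IsDiscreteValuationRing O]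
    [Field F] [Algebra O F] [IsFractionRing O F] (n : ℕ) (a : ℕ → F) (R : ℕ → ℤ) : Prop :=
  ∀ i, 1 ≤ i → i ≤ n → OrdEq O (R i) (a i)

variable {R : ℕ → ℤ}

theorem HasOrders.shift (m : ℕ) (h : HasOrders O (n + m) a R) :
    HasOrders O n (fun i => a (i + m)) (fun i => R (i + m)) :=
  fun i hi hin => h (i + m) (by omega) (by omega)

theorem HasGoodBONG.le_add_two (h : HasGoodBONG Q L n a)
    (hR : HasOrders O n a R) {i : ℕ} (hi : 1 ≤ i) (hin : i + 2 ≤ n) : R i ≤ R (i + 2) := by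
  obtain ⟨x, _, hgood, hval⟩ := h
  have hle := hgood ⟨i - 1, by omega⟩ ⟨i + 1, by omega⟩ (by simp only; omega)
  simp only [hval, Nat.sub_add_cancel hi] at hle
  exact (hR (i + 2) (by omega) hin).le_of_ge ((hR i hi (by omega)).ge.trans hle)

theorem HasGoodBONG.ordGE {r s : ℤ} (h : HasGoodBONG Q L n a)
    (hr : 1 ≤ n → OrdEq O s (a 1) ∧ r ≤ s) : ∀ y ∈ L, OrdGE O r (Q y) := by
  intro y hy
  cases n with
  | zero =>
    rw [hasGoodBONG_zero.1 h, Submodule.mem_bot] at hy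
    rw [hy, QuadraticMap.map_zero]
    exact OrdGE.zero _
  | succ n =>
    obtain ⟨x, _, hgen, hx, _⟩ := h.exists_head
    obtain ⟨hs, hrs⟩ := hr (by omega)
    exact (((isNormGenerator_iff (hx ▸ hs)).1 hgen).2 y hy).mono hrs

end GoodBONG

section HeadPair

variable {O F V : Type*} [CommRing O] [IsDomain O] [IsDiscreteValuationRing O]
  [Field F] [Algebra O F] [IsFractionRing O F]
  [AddCommGroup V] [Module F V] [Module O V] [IsScalarTower O F V]
  {Q : QuadraticForm F V} {L K L₂ : Submodule O V} {n : ℕ} {a : ℕ → F} {R : ℕ → ℤ}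
  {r s e k : ℤ} {x y x₁ x₂ : V} {b c α β : F}

/-- The first two vectors `x₁`, `x₂` of a BONG of `L`, of orders `r` and `s`, together with the
lattices `L₂` and `K` obtained from `L` by projecting along `x₁` and then along `x₂`. -/
structure HeadPair (Q : QuadraticForm F V) (L : Submodule O V) (r s : ℤ) (x₁ x₂ : V)
    (L₂ K : Submodule O V) : Prop where
  mem₁ : x₁ ∈ L
  ord₁ : OrdEq O r (Q x₁)
  norm₁ : ∀ y ∈ L, OrdGE O r (Q y)
  proj₁ : L₂ = projLattice Q L x₁
  mem₂ : x₂ ∈ L₂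
  ord₂ : OrdEq O s (Q x₂)
  norm₂ : ∀ y ∈ L₂, OrdGE O s (Q y)
  proj₂ : K = projLattice Q L₂ x₂

theorem HasGoodBONG.exists_first (h : HasGoodBONG Q L (n + 1) a) (hR : HasOrders O (n + 1) a R) :
    ∃ x ∈ L, Q x = a 1 ∧ OrdEq O (R 1) (Q x) ∧ (∀ y ∈ L, OrdGE O (R 1) (Q y)) ∧
      IsNormGenerator Q L x ∧
      HasGoodBONG Q (projLattice Q L x) n (fun i => a (i + 1)) := by
  obtain ⟨x, hxL, hgen, hx, _, hproj, _⟩ := h.exists_head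
  have hord : OrdEq O (R 1) (Q x) := hx ▸ hR 1 le_rfl (by omega)
  exact ⟨x, hxL, hx, hord, ((isNormGenerator_iff hord).1 hgen).2, hgen, hproj⟩

theorem HasGoodBONG.exists_headPair (h : HasGoodBONG Q L (n + 2) a)
    (hR : HasOrders O (n + 2) a R) :
    ∃ x₁ x₂ L₂ K, HeadPair Q L (R 1) (R 2) x₁ x₂ L₂ K ∧ Q x₁ = a 1 ∧ Q x₂ = a 2 ∧
      HasGoodBONG Q L₂ (n + 1) (fun i => a (i + 1)) ∧ HasGoodBONG Q K n (fun i => a (i + 2)) := by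
  obtain ⟨x₁, hx₁L, hx₁, hord₁, hnorm₁, _, hL₂⟩ := h.exists_first hR
  obtain ⟨x₂, hx₂L, hx₂, hord₂, hnorm₂, _, hK⟩ := hL₂.exists_first (hR.shift (n := n + 1) 1)
  exact ⟨x₁, x₂, _, _, ⟨hx₁L, hord₁, hnorm₁, rfl, hx₂L, hord₂, hnorm₂, rfl⟩, hx₁, hx₂, hL₂, hK⟩

omit [IsDomain O] [IsDiscreteValuationRing O] [IsFractionRing O F] in
theorem polar_of_mem_projLattice (h2 : (2 : F) ≠ 0) (hx : Q x ≠ 0)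
    (hy : y ∈ projLattice Q L x) : polar Q x y = 0 := by
  obtain ⟨z, _, rfl⟩ := mem_projLattice.1 hy
  exact polar_projPerp h2 hx z

omit [IsDomain O] [IsDiscreteValuationRing O] [IsFractionRing O F] in
theorem exists_decomp_of_mem (hy : y ∈ L) :
    ∃ c : F, ∃ y' ∈ projLattice Q L x, y = c • x + y' := by
  obtain ⟨c, hc⟩ := exists_eq_smul_add_projPerp (Q := Q) x y
  exact ⟨c, _, mem_projLattice.2 ⟨y, hy, rfl⟩, hc⟩

omit [IsDomain O] [IsDiscreteValuationRing O] [IsFractionRing O F] in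
theorem exists_lift_of_mem_projLattice (hy : y ∈ projLattice Q L x) : ∃ c : F, c • x + y ∈ L := by
  obtain ⟨z, hz, rfl⟩ := mem_projLattice.1 hy
  obtain ⟨c, hc⟩ := exists_eq_smul_add_projPerp (Q := Q) x z
  exact ⟨c, hc ▸ hz⟩

omit [Module O V] [IsScalarTower O F V] in
theorem ordGE_of_smul_add (h : polar Q x y = 0)
    (hx : OrdEq O r (Q x)) (hQ : OrdGE O r (Q (c • x + y))) (hy : OrdGE O r (Q y)) :
    OrdGE O 0 c := by
  have hc : OrdGE O r (c ^ 2 * Q x) := by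
    rw [← add_sub_cancel_right (c ^ 2 * Q x) (Q y), ← map_smul_add_of_polar_eq_zero Q c h]
    exact hQ.sub hy
  exact (hc.of_mul_right hx (m := 0) (by omega)).of_sq (by omega)

theorem mem_of_smul_add_mem (h : polar Q x y = 0) (hx : OrdEq O r (Q x)) (hxL : x ∈ L)
    (hyL : c • x + y ∈ L) (hQ : OrdGE O r (Q (c • x + y))) (hy : OrdGE O r (Q y)) : y ∈ L := by
  have := L.sub_mem hyL (smul_mem_of_ordGE (ordGE_of_smul_add h hx hQ hy) hxL)
  rwa [add_sub_cancel_left] at this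

namespace HeadPair

variable (H : HeadPair Q L r s x₁ x₂ L₂ K)

include H

theorem exists_lift₂ : ∃ b : F, b • x₁ + x₂ ∈ L :=
  exists_lift_of_mem_projLattice (H.proj₁ ▸ H.mem₂)

theorem exists_decomp₁ (hy : y ∈ L) : ∃ c : F, ∃ y' ∈ L₂, y = c • x₁ + y' :=
  H.proj₁ ▸ exists_decomp_of_mem hy

theorem exists_decomp₂ (hy : y ∈ L₂) : ∃ c : F, ∃ y' ∈ K, y = c • x₂ + y' :=
  H.proj₂ ▸ exists_decomp_of_mem hy

theorem exists_decomp (hy : y ∈ L) :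
    ∃ α β : F, ∃ k ∈ K, β • x₂ + k ∈ L₂ ∧ y = α • x₁ + (β • x₂ + k) := by
  obtain ⟨α, y', hy', rfl⟩ := H.exists_decomp₁ hy
  obtain ⟨β, k, hk, rfl⟩ := H.exists_decomp₂ hy'
  exact ⟨α, β, k, hk, hy', rfl⟩

theorem pair_mem (hb : b • x₁ + x₂ ∈ L) (hβ : OrdGE O 0 β)
    (hα : OrdGE O 0 (α - β * b)) : α • x₁ + β • x₂ ∈ L := by
  convert L.add_mem (smul_mem_of_ordGE hα H.mem₁) (smul_mem_of_ordGE hβ hb) using 1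
  module

variable (h2 : (2 : F) ≠ 0)

include h2

theorem polar₁ (hy : y ∈ L₂) : polar Q x₁ y = 0 :=
  polar_of_mem_projLattice h2 H.ord₁.ne_zero (H.proj₁ ▸ hy)

theorem polar₁₂ : polar Q x₁ x₂ = 0 := H.polar₁ h2 H.mem₂

theorem polarK₂ (hy : y ∈ K) : polar Q x₂ y = 0 :=
  polar_of_mem_projLattice h2 H.ord₂.ne_zero (H.proj₂ ▸ hy)

theorem polarK₁ (hy : y ∈ K) : polar Q x₁ y = 0 := by
  obtain ⟨c, hc⟩ := exists_lift_of_mem_projLattice (H.proj₂ ▸ hy)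
  have := H.polar₁ h2 hc
  rwa [QuadraticMap.polar_add_right, QuadraticMap.polar_smul_right, H.polar₁₂ h2, smul_zero,
    zero_add] at this

theorem mem₂_of_eq {y' : V} (hy : y ∈ L) (hyc : y = c • x₁ + y')
    (h : polar Q x₁ y' = 0) : y' ∈ L₂ := by
  rw [H.proj₁]
  exact mem_projLattice.2 ⟨y, hy, by rw [hyc, projPerp_smul_add h2 H.ord₁.ne_zero h]⟩

theorem le_of_norm (hn : r ≤ s) : L₂ ≤ L := by
  intro y hy
  obtain ⟨c, hc⟩ := exists_lift_of_mem_projLattice (H.proj₁ ▸ hy)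
  exact mem_of_smul_add_mem (H.polar₁ h2 hy) H.ord₁ H.mem₁ hc (H.norm₁ _ hc)
    ((H.norm₂ _ hy).mono hn)

theorem exists_integral_decomp₁ (hn : r ≤ s) (hy : y ∈ L) :
    ∃ c : F, OrdGE O 0 c ∧ ∃ y' ∈ L₂, y = c • x₁ + y' := by
  obtain ⟨c, y', hy', rfl⟩ := H.exists_decomp₁ hy
  exact ⟨c, ordGE_of_smul_add (H.polar₁ h2 hy') H.ord₁ (H.norm₁ _ hy)
    ((H.norm₂ _ hy').mono hn), y', hy', rfl⟩

theorem map_eq {k : V} (hk : k ∈ K) :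
    Q (α • x₁ + (β • x₂ + k)) = α ^ 2 * Q x₁ + (β ^ 2 * Q x₂ + Q k) := by
  rw [map_smul_add_of_polar_eq_zero, map_smul_add_of_polar_eq_zero Q _ (H.polarK₂ h2 hk)]
  rw [QuadraticMap.polar_add_right, QuadraticMap.polar_smul_right, H.polar₁₂ h2,
    H.polarK₁ h2 hk, smul_zero, zero_add]

theorem map_pair : Q (α • x₁ + β • x₂) = α ^ 2 * Q x₁ + β ^ 2 * Q x₂ := by
  simpa using H.map_eq h2 (α := α) (β := β) K.zero_mem

theorem map_lift : Q (b • x₁ + x₂) = b ^ 2 * Q x₁ + Q x₂ := by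
  simpa using H.map_pair h2 (α := b) (β := 1)

theorem le_of_norm₂ (hr : ∀ k ∈ K, OrdGE O r (Q k)) (hs : ∀ k ∈ K, OrdGE O s (Q k)) : K ≤ L := by
  intro k hk
  obtain ⟨β, hβ⟩ := exists_lift_of_mem_projLattice (H.proj₂ ▸ hk)
  have hkL₂ : k ∈ L₂ :=
    mem_of_smul_add_mem (H.polarK₂ h2 hk) H.ord₂ H.mem₂ hβ (H.norm₂ _ hβ) (hs k hk)
  obtain ⟨c, hc⟩ := exists_lift_of_mem_projLattice (H.proj₁ ▸ hkL₂)
  exact mem_of_smul_add_mem (H.polar₁ h2 hkL₂) H.ord₁ H.mem₁ hc (H.norm₁ _ hc) (hr k hk)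

theorem exists_integral_decomp (hr : ∀ k ∈ K, OrdGE O r (Q k)) (hs : ∀ k ∈ K, OrdGE O s (Q k))
    (hb : b • x₁ + x₂ ∈ L) (hy : y ∈ L) :
    ∃ u c : F, OrdGE O 0 u ∧ OrdGE O 0 c ∧ ∃ k ∈ K, y = u • x₁ + c • (b • x₁ + x₂) + k := by
  obtain ⟨α, β, k, hk, hL₂, rfl⟩ := H.exists_decomp hy
  have hβ := ordGE_of_smul_add (H.polarK₂ h2 hk) H.ord₂ (H.norm₂ _ hL₂) (hs k hk)
  have hrest : (α - β * b) • x₁ + k ∈ L := by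
    convert L.sub_mem hy (smul_mem_of_ordGE hβ hb) using 1
    module
  exact ⟨α - β * b, β, ordGE_of_smul_add (H.polarK₁ h2 hk) H.ord₁ (H.norm₁ _ hrest) (hr k hk), hβ,
    k, hk, by module⟩

omit h2 in
theorem ordGE_two_mul {y' : V} (h : polar Q x₁ y' = 0) (hy : α • x₁ + y' ∈ L) :
    OrdGE O 0 (2 * α) := by
  have hpolar : polar Q x₁ (α • x₁ + y') = 2 * α * Q x₁ := by
    rw [QuadraticMap.polar_add_right, QuadraticMap.polar_smul_right, h, polar_self_mul, add_zero,
      smul_eq_mul]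
    ring
  exact (hpolar ▸ ordGE_polar H.norm₁ H.mem₁ hy).of_mul_right H.ord₁ (by omega)

theorem lift_ordGE (hb : b • x₁ + x₂ ∈ L) :
    OrdGE O 0 (2 * b) ∧ OrdGE O r (b ^ 2 * Q x₁ + Q x₂) :=
  ⟨H.ordGE_two_mul (H.polar₁₂ h2) hb, H.map_lift h2 ▸ H.norm₁ _ hb⟩

omit h2 in
theorem le_of_ordEq_two (he : OrdEq O e (2 : F)) : r - 2 * e ≤ s := by
  obtain ⟨b, hb⟩ := H.exists_lift₂
  obtain ⟨h2b, hQb⟩ := H.lift_ordGE he.ne_zero hb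
  have hb' : OrdGE O (-e) b := h2b.of_mul_left he (by omega)
  have he0 := he.le_of_ge ordGE_zero_two
  have : OrdGE O (r - 2 * e) (b ^ 2 * Q x₁ + Q x₂ - b ^ 2 * Q x₁) :=
    (hQb.mono (by omega)).sub ((hb'.sq.mul H.ord₁.ge).mono (by omega))
  rw [add_sub_cancel_left] at this
  exact H.ord₂.le_of_ge this

theorem lt_of_odd (hodd : Odd (s - r)) : r < s := by
  obtain ⟨b, hb⟩ := H.exists_lift₂
  obtain ⟨-, hQb⟩ := H.lift_ordGE h2 hb
  obtain ⟨i, hi⟩ := hodd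
  by_contra hle
  have hcancel : OrdEq O s (b ^ 2 * Q x₁) :=
    H.ord₂.of_add_ge (add_comm (b ^ 2 * Q x₁) _ ▸ hQb.mono (by omega))
  obtain ⟨j, hj⟩ := exists_ordEq (O := O)
    (pow_ne_zero_iff two_ne_zero |>.1 (left_ne_zero_of_mul hcancel.ne_zero))
  have := hcancel.unique (hj.sq.mul H.ord₁)
  omega

omit h2 in
theorem ordGE_polar_of_le (he : OrdEq O e (2 : F)) (hrs : r ≤ s) (hk : k ≤ r + e)
    (hL₂ : ∀ y ∈ L₂, ∀ z ∈ L₂, OrdGE O k (polar Q y z)) :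
    ∀ y ∈ L, ∀ z ∈ L, OrdGE O k (polar Q y z) := by
  intro y hy z hz
  have h2 := he.ne_zero
  obtain ⟨c, hc, y', hy', rfl⟩ := H.exists_integral_decomp₁ h2 hrs hy
  obtain ⟨d, hd, z', hz', rfl⟩ := H.exists_integral_decomp₁ h2 hrs hz
  have : polar Q (c • x₁ + y') (d • x₁ + z') = c * d * (2 * Q x₁) + polar Q y' z' := by
    simp only [QuadraticMap.polar_add_left, QuadraticMap.polar_add_right,
      QuadraticMap.polar_smul_left, QuadraticMap.polar_smul_right, smul_eq_mul, H.polar₁ h2 hz',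
      QuadraticMap.polar_comm Q y' x₁, H.polar₁ h2 hy', polar_self_mul]
    ring
  rw [this]
  exact (((hc.mul hd).mul (he.ge.mul H.ord₁.ge)).mono (by omega)).add (hL₂ _ hy' _ hz')

omit h2 in
theorem ordGE_polar_of_ge (he : OrdEq O e (2 : F)) (hsr : s ≤ r) (hk : 2 * k ≤ r + s + 2 * e)
    (hr : ∀ k ∈ K, OrdGE O r (Q k)) (hK : ∀ y ∈ K, ∀ z ∈ K, OrdGE O k (polar Q y z)) :
    ∀ y ∈ L, ∀ z ∈ L, OrdGE O k (polar Q y z) := by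
  intro y hy z hz
  have h2 := he.ne_zero
  have hs : ∀ k ∈ K, OrdGE O s (Q k) := fun k hk => (hr k hk).mono hsr
  obtain ⟨b, hb⟩ := H.exists_lift₂
  obtain ⟨u, c, hu, hc, y', hy', rfl⟩ := H.exists_integral_decomp h2 hr hs hb hy
  obtain ⟨v, d, hv, hd, z', hz', rfl⟩ := H.exists_integral_decomp h2 hr hs hb hz
  have hpolar : polar Q (u • x₁ + c • (b • x₁ + x₂) + y') (v • x₁ + d • (b • x₁ + x₂) + z') =
      u * v * (2 * Q x₁) + (u * d + v * c) * (2 * b * Q x₁) + c * d * (2 * Q (b • x₁ + x₂)) +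
        polar Q y' z' := by
    rw [H.map_lift h2]
    simp only [QuadraticMap.polar_add_right, QuadraticMap.polar_add_left,
      QuadraticMap.polar_smul_left, QuadraticMap.polar_smul_right, smul_eq_mul, H.polarK₁ h2 hy',
      H.polarK₁ h2 hz', H.polarK₂ h2 hy', H.polarK₂ h2 hz', QuadraticMap.polar_comm Q y' x₁,
      QuadraticMap.polar_comm Q y' x₂, QuadraticMap.polar_comm Q x₂ x₁, H.polar₁₂ h2,
      polar_self_mul]
    ring
  have hbsq : OrdGE O (s - r) (b ^ 2) := by
    have := ((H.lift_ordGE h2 hb).2.mono hsr).sub H.ord₂.ge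
    rw [add_sub_cancel_right] at this
    exact this.of_mul_right H.ord₁ le_rfl
  have hbk : OrdGE O (k - e - r) b := hbsq.of_sq (by omega)
  rw [hpolar]
  refine (((?_ : OrdGE O k _).add ?_).add ?_).add (hK _ hy' _ hz')
  · exact ((hu.mul hv).mul (he.ge.mul H.ord₁.ge)).mono (by omega)
  · exact (((hu.mul hd).add (hv.mul hc)).mul ((he.ge.mul hbk).mul H.ord₁.ge)).mono (by omega)
  · exact ((hc.mul hd).mul (he.ge.mul (H.norm₁ _ hb))).mono (by omega)

end HeadPair

theorem HasGoodBONG.exists_drop (m : ℕ) :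
    ∀ {n : ℕ} {L : Submodule O V}, HasGoodBONG Q L (n + m) a → HasOrders O (n + m) a R →
      ∃ M : Submodule O V, HasGoodBONG Q M n (fun i => a (i + m)) := by
  induction m with
  | zero => exact fun h _ => ⟨_, h⟩
  | succ m ih =>
    intro n L h hR
    rw [← add_assoc, add_right_comm] at h hR
    obtain ⟨M, hM⟩ := ih (n := n + 1) h hR
    obtain ⟨x, _, _, _, _, _, hx⟩ := hM.exists_first (hR.shift m)
    exact ⟨_, hx.congr fun i _ _ => by rw [add_right_comm, add_assoc]⟩

theorem HasGoodBONG.exists_headPair_at (h : HasGoodBONG Q L n a) (hR : HasOrders O n a R) {i : ℕ}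
    (hi : 1 ≤ i) (hin : i + 1 ≤ n) :
    ∃ (M M₂ K : Submodule O V) (x₁ x₂ : V), HeadPair Q M (R i) (R (i + 1)) x₁ x₂ M₂ K := by
  obtain ⟨j, rfl⟩ := Nat.exists_eq_add_of_le' hi
  obtain ⟨m, rfl⟩ := Nat.exists_eq_add_of_le' hin
  rw [show m + (j + 1 + 1) = m + 2 + j by omega] at h hR
  obtain ⟨M, hM⟩ := h.exists_drop j hR
  obtain ⟨x₁, x₂, M₂, K, H, _⟩ := hM.exists_headPair (hR.shift j)
  rw [show j + 1 + 1 = 2 + j by omega, show j + 1 = 1 + j by omega]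
  exact ⟨M, M₂, K, x₁, x₂, H⟩

theorem HasGoodBONG.sub_two_mul_le (h : HasGoodBONG Q L n a) (hR : HasOrders O n a R)
    (he : OrdEq O e (2 : F)) {i : ℕ} (hi : 1 ≤ i) (hin : i + 1 ≤ n) :
    R i - 2 * e ≤ R (i + 1) := by
  obtain ⟨_, _, _, _, _, H⟩ := h.exists_headPair_at hR hi hin
  exact H.le_of_ordEq_two he

theorem HasGoodBONG.lt_of_odd (h : HasGoodBONG Q L n a) (hR : HasOrders O n a R)
    (h2 : (2 : F) ≠ 0) {i : ℕ} (hi : 1 ≤ i) (hin : i + 1 ≤ n) (hodd : Odd (R (i + 1) - R i)) :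
    R i < R (i + 1) := by
  obtain ⟨_, _, _, _, _, H⟩ := h.exists_headPair_at hR hi hin
  exact H.lt_of_odd h2 hodd

theorem HasGoodBONG.ordGE_polar_one (he : OrdEq O e (2 : F)) (h : HasGoodBONG Q L 1 a)
    (hR : HasOrders O 1 a R) (hk : k ≤ R 1 + e) :
    ∀ y ∈ L, ∀ z ∈ L, OrdGE O k (polar Q y z) := by
  obtain ⟨x, -, -, hx, hQ, -, hproj⟩ := h.exists_first hR
  have hspan : ∀ y ∈ L, ∃ c : F, OrdGE O 0 c ∧ y = c • x := by
    intro y hy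
    obtain ⟨c, y', hy', rfl⟩ := exists_decomp_of_mem (Q := Q) (x := x) hy
    rw [hasGoodBONG_zero.1 hproj, Submodule.mem_bot] at hy'
    subst hy'
    refine ⟨c, ordGE_of_smul_add (QuadraticMap.polar_zero_right ..) hx (hQ _ hy) ?_, add_zero _⟩
    rw [QuadraticMap.map_zero]
    exact OrdGE.zero _
  intro y hy z hz
  obtain ⟨c, hc, rfl⟩ := hspan y hy
  obtain ⟨d, hd, rfl⟩ := hspan z hz
  rw [QuadraticMap.polar_smul_left, QuadraticMap.polar_smul_right, polar_self_mul, smul_eq_mul,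
    smul_eq_mul]
  exact (hc.mul (hd.mul (he.ge.mul hx.ge))).mono (by omega)

/- The scale of `L` is determined by the first two orders; the induction peels off one vector of the
BONG if `R 1 < R 2`, and two otherwise. -/
theorem HasGoodBONG.ordGE_polar_of_le (he : OrdEq O e (2 : F)) (n : ℕ) :
    ∀ {L : Submodule O V} {a : ℕ → F} {R : ℕ → ℤ}, HasGoodBONG Q L n a → HasOrders O n a R →
      ∀ k : ℤ, (1 ≤ n → k ≤ R 1 + e) → (2 ≤ n → 2 * k ≤ R 1 + R 2 + 2 * e) →
      ∀ y ∈ L, ∀ z ∈ L, OrdGE O k (polar Q y z) := by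
  induction n using Nat.strong_induction_on with
  | _ n ih =>
  intro L a R h hR k hk1 hk2
  rcases n with - | - | n
  · intro y hy z _
    rw [hasGoodBONG_zero.1 h, Submodule.mem_bot] at hy
    rw [hy, QuadraticMap.polar_zero_left]
    exact OrdGE.zero _
  · exact h.ordGE_polar_one he hR (hk1 le_rfl)
  · have hk1 := hk1 (by omega)
    have hk2 := hk2 (by omega)
    have h13 (hn : 1 ≤ n) : R 1 ≤ R 3 := h.le_add_two hR le_rfl (by omega)
    have h24 (hn : 2 ≤ n) : R 2 ≤ R 4 := h.le_add_two hR (by omega) (by omega)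
    obtain ⟨x₁, x₂, L₂, K, H, -, -, hL₂, hK⟩ := h.exists_headPair hR
    rcases lt_or_ge (R 1) (R 2) with hlt | hle
    · refine H.ordGE_polar_of_le he hlt.le hk1
        (ih (n + 1) (by omega) hL₂ (hR.shift 1) k (fun _ => ?_) fun hn => ?_)
      · change k ≤ R 2 + e
        omega
      · change 2 * k ≤ R 2 + R 3 + 2 * e
        have := h13 (by omega)
        omega
    · refine H.ordGE_polar_of_ge he hle hk2
        (hK.ordGE fun hn => ⟨hR 3 (by omega) (by omega), h13 hn⟩)
        (ih n (by omega) hK (hR.shift 2) k (fun hn => ?_) fun hn => ?_)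
      · change k ≤ R 3 + e
        have := h13 hn
        omega
      · change 2 * k ≤ R 3 + R 4 + 2 * e
        have := h13 (by omega)
        have := h24 hn
        omega

theorem HasGoodBONG.ordGE_polar_succ (he : OrdEq O e (2 : F)) (he1 : 1 ≤ e)
    (h : HasGoodBONG Q L n a) (hR : HasOrders O n a R) (h12 : 2 ≤ n → R 1 - 2 * e < R 2) :
    ∀ y ∈ L, ∀ z ∈ L, OrdGE O (R 1 + 1) (polar Q y z) := by
  refine h.ordGE_polar_of_le he n hR _ (fun _ => by omega) fun hn => ?_
  have := h12 hn
  rcases Int.even_or_odd (R 2 - R 1) with ⟨i, hi⟩ | hodd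
  · omega
  · have : R 1 < R 2 := h.lt_of_odd hR he.ne_zero le_rfl hn hodd
    omega

end HeadPair

section BinaryForms

/-- `α² + β² (q / p)` and `2 α`, which are the norm and the trace of the element `α + β √(-q/p)` of
a quadratic algebra, are integral; here `r = ord p`. -/
structure IntegralPair (O : Type*) {F : Type*} [CommRing O] [IsDomain O]
    [IsDiscreteValuationRing O] [Field F] [Algebra O F] [IsFractionRing O F] (p q : F) (r : ℤ)
    (α β : F) : Prop where
  trace : OrdGE O 0 (2 * α)
  norm : OrdGE O r (α ^ 2 * p + β ^ 2 * q)

/-- The numerical form of the maximality of the binary lattice `≺p, q≻`, for `r = ord p`. -/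
def BinaryMaximal (O : Type*) {F : Type*} [CommRing O] [IsDomain O] [IsDiscreteValuationRing O]
    [Field F] [Algebra O F] [IsFractionRing O F] (p q : F) (r : ℤ) : Prop :=
  ∀ ⦃α β : F⦄, IntegralPair O p q r α β → OrdGE O 0 β

variable {O F : Type*} [CommRing O] [IsDomain O] [IsDiscreteValuationRing O]
  [Field F] [Algebra O F] [IsFractionRing O F] {p q π α β α' β' b c : F} {r s e : ℤ}

namespace IntegralPair

theorem ordGE_div (h : IntegralPair O p q r α β) (hp : OrdEq O r p) :
    OrdGE O 0 (α ^ 2 + β ^ 2 * (q / p)) := by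
  have hp0 := hp.ne_zero
  convert (h.norm.div hp).mono (sub_self r).ge using 1
  field_simp

/- The trace of the product of two integral elements of a quadratic algebra is integral, because it
is a root of a monic polynomial with integral coefficients. -/
theorem ordGE_trace_mul (h : IntegralPair O p q r α β) (h' : IntegralPair O p q r α' β')
    (hp : OrdEq O r p) : OrdGE O r (2 * (α * α' * p + β * β' * q)) := by
  have hp0 := hp.ne_zero
  set m := α ^ 2 + β ^ 2 * (q / p) with hm
  set m' := α' ^ 2 + β' ^ 2 * (q / p) with hm'
  have h4 : OrdGE O 0 (4 : F) := map_ofNat (algebraMap O F) 4 ▸ ordGE_algebraMap (4 : O)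
  have hmm := (h.ordGE_div hp).mul (h'.ordGE_div hp)
  have htr : OrdGE O 0 (2 * (α * α' + β * β' * (q / p))) :=
    ordGE_zero_of_root (p := -(2 * α * (2 * α')))
      (q := m * (2 * α') ^ 2 + m' * (2 * α) ^ 2 - 4 * (m * m'))
      (h.trace.mul h'.trace).neg
      ((((h.ordGE_div hp).mul h'.trace.sq).add ((h'.ordGE_div hp).mul h.trace.sq)).sub
        (h4.mul hmm)) (by rw [hm, hm']; ring)
  convert (htr.mul hp.ge).mono (zero_add r).ge using 1
  field_simp

theorem add (h : IntegralPair O p q r α β) (h' : IntegralPair O p q r α' β') (hp : OrdEq O r p) :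
    IntegralPair O p q r (α + α') (β + β') where
  trace := by
    rw [mul_add]
    exact h.trace.add h'.trace
  norm := by
    convert (h.norm.add h'.norm).add (h.ordGE_trace_mul h' hp) using 1
    ring

theorem mul (h : IntegralPair O p q r α β) (hc : OrdGE O 0 c) :
    IntegralPair O p q r (c * α) (c * β) where
  trace := by
    rw [mul_left_comm]
    exact hc.mul h.trace
  norm := by
    convert (hc.sq.mul h.norm).mono (by omega : r ≤ 2 * 0 + r) using 1
    ring

theorem one_zero (hp : OrdGE O r p) : IntegralPair O p q r 1 0 where
  trace := by simpa using ordGE_zero_two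
  norm := by simpa using hp

theorem ordGE_of_right_eq_zero (h : IntegralPair O p q r α 0) (hp : OrdEq O r p) :
    OrdGE O 0 α := by
  have hα : OrdGE O r (α ^ 2 * p) := by simpa using h.norm
  exact (hα.of_mul_right hp (m := 0) (by omega)).of_sq (by omega)

theorem ordGE_sub_mul (h : IntegralPair O p q r α β) (hb : IntegralPair O p q r b 1)
    (hβ : OrdGE O 0 β) (hp : OrdEq O r p) : OrdGE O 0 (α - β * b) := by
  refine ordGE_of_right_eq_zero (p := p) (q := q) (r := r) ?_ hp
  convert h.add (hb.mul hβ.neg) hp using 1 <;> ring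

theorem exists_ordGE (he : OrdEq O e (2 : F)) (hp : OrdEq O r p) (hq : OrdEq O s q) :
    ∃ m : ℤ, ∀ α β : F, IntegralPair O p q r α β → OrdGE O m α ∧ OrdGE O m β := by
  have he0 := he.le_of_ge ordGE_zero_two
  refine ⟨min (-e) ((r - 2 * e - s) / 2), fun α β h => ?_⟩
  have hα : OrdGE O (-e) α := h.trace.of_mul_left he (by omega)
  have hβq : OrdGE O (r - 2 * e) (β ^ 2 * q) := by
    rw [← add_sub_cancel_left (α ^ 2 * p) (β ^ 2 * q)]
    exact (h.norm.mono (by omega)).sub ((hα.sq.mul hp.ge).mono (by omega))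
  exact ⟨hα.mono (by omega), (hβq.of_mul_right hq le_rfl).of_sq (by omega)⟩

end IntegralPair

/- An integral element `α + β √(-q/p)` whose norm is a uniformizer generates the maximal order. -/
theorem binaryMaximal_of_ordEq_succ (hp : OrdEq O r p) (hβ : OrdGE O 0 β)
    (h : OrdEq O (r + 1) (α ^ 2 * p + β ^ 2 * q)) : BinaryMaximal O p q r := by
  intro α' β' h'
  by_contra hβ'
  obtain ⟨j, hj0, hj⟩ := exists_lt_ordEq hβ'
  set l := β / β'
  set γ := α - l * α'
  have hl : OrdGE O 1 l := (hβ.div hj).mono (by omega)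
  have hexpand : α ^ 2 * p + β ^ 2 * q =
      γ ^ 2 * p + (l * (2 * α') * p) * γ + l ^ 2 * (α' ^ 2 * p + β' ^ 2 * q) := by
    rw [← div_mul_cancel₀ β hj.ne_zero]
    ring
  have hcross : OrdGE O (r + 1) (l * (2 * α') * p) :=
    ((hl.mul h'.trace).mul hp.ge).mono (by omega)
  have hlast : OrdGE O (r + 2) (l ^ 2 * (α' ^ 2 * p + β' ^ 2 * q)) :=
    (hl.sq.mul h'.norm).mono (by omega)
  rw [hexpand] at h
  by_cases hγ : OrdGE O 1 γ
  · exact h.not_ge (by omega : r + 1 < r + 2) ((((hγ.sq.mul hp.ge).mono (by omega)).add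
      ((hcross.mul hγ).mono (by omega))).add hlast)
  · obtain ⟨i, hi0, hi⟩ := exists_lt_ordEq hγ
    have hγγ := (hi.sq.mul hp).add_ge ((hcross.mul hi.ge).mono (by omega))
    have := (hγγ.add_ge (hlast.mono (by omega))).unique h
    omega

theorem BinaryMaximal.ne_neg_sq (h : BinaryMaximal O p q r) (he : OrdEq O e (2 : F))
    (hp : OrdEq O r p) (hq : OrdEq O s q) (hrs : r - 2 * e < s) (t : F) : q ≠ -(t ^ 2 * p) := by
  rintro rfl
  have h2 := he.ne_zero
  have ht : t ≠ 0 := by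
    rintro rfl
    exact hq.ne_zero (by ring)
  obtain ⟨j, hj⟩ := exists_ordEq (O := O) ht
  have hint : IntegralPair O p (-(t ^ 2 * p)) r (1 / 2) (1 / (2 * t)) := by
    constructor
    · rw [mul_one_div_cancel h2]
      exact ordEq_one.ge
    · rw [show (1 / 2 : F) ^ 2 * p + (1 / (2 * t)) ^ 2 * -(t ^ 2 * p) = 0 by field_simp; ring]
      exact OrdGE.zero r
  have := ((ordEq_one (O := O)).div (he.mul hj)).le_of_ge (h hint)
  have := (hj.sq.mul hp).neg.unique hq
  omega

theorem IntegralPair.of_anisotropic [HenselianRing O (IsLocalRing.maximalIdeal O)]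
    (hp : OrdEq O r p) (h2 : (2 : F) ≠ 0) (han : ∀ t : F, q ≠ -(t ^ 2 * p))
    (h : OrdGE O r (α ^ 2 * p + β ^ 2 * q)) : IntegralPair O p q r α β := by
  refine ⟨?_, h⟩
  have hp0 := hp.ne_zero
  by_contra htr
  obtain ⟨m, hm0, hm⟩ := exists_lt_ordEq htr
  have hα : α ≠ 0 := right_ne_zero_of_mul hm.ne_zero
  rcases eq_or_ne β 0 with rfl | hβ
  · have hαp : OrdGE O r (α ^ 2 * p) := by simpa using h
    have hα0 : OrdGE O 0 α := (hαp.of_mul_right hp (m := 0) (by omega)).of_sq (by omega)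
    exact htr ((ordGE_zero_two.mul hα0).mono (by omega))
  · obtain ⟨w, -, hw⟩ := exists_root_sq_add_self (O := O)
      (q := (α ^ 2 * p + β ^ 2 * q) / p / (2 * α) ^ 2) (((h.div hp).div hm.sq).mono (by omega))
    refine han ((2 * α * w + α) / β) ?_
    field_simp at hw ⊢
    linear_combination hw

theorem BinaryMaximal.exists_ordEq_succ_of_even [PerfectField (IsLocalRing.ResidueField O)]
    [CharP (IsLocalRing.ResidueField O) 2] (h : BinaryMaximal O p q r) (hπ : OrdEq O 1 π)
    (he : OrdEq O e (2 : F)) (hp : OrdEq O r p) (hq : OrdEq O s q) (hrs : r - 2 * e < s)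
    (hs : Even (s - r)) : ∃ α β : F, α ≠ 0 ∧ OrdEq O (r + 1) (α ^ 2 * p + β ^ 2 * q) := by
  obtain ⟨i, hi⟩ := hs
  have hz := ordEq_uniformizer_zpow hπ (-i)
  have hzq : OrdEq O r ((π ^ (-i)) ^ 2 * q) := by
    convert hz.sq.mul hq using 1
    omega
  by_contra! hno
  have heven : ∀ l : F, ∀ k, OrdGE O 0 l → OrdEq O k ((π ^ (-i)) ^ 2 * q + l ^ 2 * p) →
      k ≤ r + 2 * e - 1 → Even (k - r) := by
    intro l k hl hk _
    by_contra hodd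
    obtain ⟨j, hj⟩ := Int.not_even_iff_odd.1 hodd
    have hw := ordEq_uniformizer_zpow hπ (-j)
    have hl0 : l ≠ 0 := by
      rintro rfl
      have := hzq.unique (by simpa using hk)
      omega
    refine hno (π ^ (-j) * l) (π ^ (-j) * π ^ (-i)) (mul_ne_zero hw.ne_zero hl0) ?_
    convert hw.sq.mul hk using 1
    · omega
    · ring
  obtain ⟨l, hl, hl'⟩ :=
    exists_ordGE_add_sq_mul_of_even (m := r + 2 * e - 1) hπ he hzq.ge hp (by omega) heven
  have hint : IntegralPair O p q r (l / 2) (π ^ (-i) / 2) := by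
    constructor
    · rwa [mul_div_cancel₀ _ he.ne_zero]
    · rw [show (l / 2) ^ 2 * p + (π ^ (-i) / 2) ^ 2 * q =
        ((π ^ (-i)) ^ 2 * q + l ^ 2 * p) / 2 ^ 2 by simp only [div_pow]; ring]
      exact (hl'.div he.sq).mono (by omega)
  have := (hz.div he).le_of_ge (h hint)
  omega

theorem exists_ordEq_succ_of_odd (hπ : OrdEq O 1 π) (hp : OrdEq O r p) (hq : OrdEq O s q)
    (hs : Odd (s - r)) : ∃ α β : F, α ≠ 0 ∧ OrdEq O (r + 1) (α ^ 2 * p + β ^ 2 * q) := by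
  obtain ⟨i, hi⟩ := hs
  have hzq : OrdEq O (r + 1) ((π ^ (-i)) ^ 2 * q) := by
    convert (ordEq_uniformizer_zpow hπ (-i)).sq.mul hq using 1
    omega
  exact ⟨π, π ^ (-i), hπ.ne_zero, add_comm (π ^ 2 * p) _ ▸
    hzq.add_ge ((hπ.sq.mul hp).ge.mono (by omega))⟩

theorem BinaryMaximal.exists_ordEq_succ [PerfectField (IsLocalRing.ResidueField O)]
    [CharP (IsLocalRing.ResidueField O) 2] (h : BinaryMaximal O p q r) (hπ : OrdEq O 1 π)
    (he : OrdEq O e (2 : F)) (hp : OrdEq O r p) (hq : OrdEq O s q) (hrs : r - 2 * e < s) :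
    ∃ α β : F, α ≠ 0 ∧ OrdEq O (r + 1) (α ^ 2 * p + β ^ 2 * q) :=
  (Int.even_or_odd (s - r)).elim (h.exists_ordEq_succ_of_even hπ he hp hq hrs)
    (exists_ordEq_succ_of_odd hπ hp hq)

theorem exists_hilbertSymbol_eq_one (hπ : OrdEq O 1 π) (hp : OrdEq O r p) (hα : α ≠ 0)
    (h : OrdEq O (r + 1) (α ^ 2 * p + β ^ 2 * q)) :
    ∃ η : F, ord O η = 0 ∧ hilbertSymbol (π * η) (-(p * q)) = 1 := by
  have hp0 := hp.ne_zero
  have hπ0 := hπ.ne_zero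
  have hη : OrdEq O 0 ((α ^ 2 * p + β ^ 2 * q) / (π * p)) := by
    convert h.div (hπ.mul hp) using 1
    omega
  refine ⟨_, hη, if_pos ⟨1 / α, β / (α * p), ?_⟩⟩
  field_simp
  ring

omit [CommRing O] [IsDomain O] [IsDiscreteValuationRing O] [Algebra O F] [IsFractionRing O F] in
theorem exists_eq_mul_of_hilbertSymbol (hp : p ≠ 0) (han : ∀ t : F, q ≠ -(t ^ 2 * p))
    (h : hilbertSymbol c (-(p * q)) = 1) : ∃ α β : F, α ^ 2 * p + β ^ 2 * q = c * p := by
  obtain ⟨x, y, hxy⟩ : ∃ x y : F, c * x ^ 2 + -(p * q) * y ^ 2 = 1 := by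
    by_contra hno
    simp [hilbertSymbol, if_neg hno] at h
  have hx : x ≠ 0 := by
    rintro rfl
    have hy : y ≠ 0 := by
      rintro rfl
      simp at hxy
    refine han (1 / (p * y)) ?_
    field_simp
    linear_combination -hxy
  refine ⟨1 / x, p * y / x, ?_⟩
  field_simp
  linear_combination -hxy

theorem even_of_ordEq_sq_mul (hp : OrdEq O r p) (h : OrdEq O s (α ^ 2 * p)) : Even (s - r) := by
  obtain ⟨i, hi⟩ := exists_ordEq (O := O)
    (pow_ne_zero_iff two_ne_zero |>.1 (left_ne_zero_of_mul h.ne_zero))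
  exact ⟨i, by have := (hi.sq.mul hp).unique h; omega⟩

theorem BinaryMaximal.relDefect_le (h : BinaryMaximal O p q r)
    (he : OrdEq O e (2 : F)) (hp : OrdEq O r p) (hq : OrdEq O s q) (hrs : r - 2 * e < s)
    (heven : Even (s - r)) (hα : OrdGE O 0 (2 * α))
    (hαβ : OrdEq O (r + 1) (α ^ 2 * p + β ^ 2 * q)) :
    relDefect O (-(p * q)) ≤ ((e - (s - r) / 2 : ℤ) : WithTop ℤ) := by
  have hp0 := hp.ne_zero
  obtain ⟨i, hi⟩ := heven
  have hparity : ¬ OrdEq O (r + 1) (α ^ 2 * p) := fun hαp => by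
    have := even_of_ordEq_sq_mul hp hαp
    rw [add_sub_cancel_left] at this
    exact Int.not_even_one this
  have hβ : β ≠ 0 := by
    rintro rfl
    exact hparity (by simpa using hαβ)
  obtain ⟨j, hj⟩ := exists_ordEq (O := O) hβ
  have hj0 : 0 ≤ j := hj.le_of_ge (h ⟨hα, hαβ.ge.mono (by omega)⟩)
  have hjs : 2 * j + s ≤ r + 1 := by
    by_contra hjs
    refine hparity ?_
    rw [← add_sub_cancel_right (α ^ 2 * p) (β ^ 2 * q), sub_eq_add_neg]
    exact hαβ.add_ge ((hj.sq.mul hq).neg.ge.mono (by omega))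
  have hαp : OrdEq O (2 * j + s) (α ^ 2 * p) :=
    (hj.sq.mul hq).of_add_ge (add_comm (α ^ 2 * p) _ ▸ hαβ.ge.mono (by omega))
  have hs : OrdEq O (r + i) (p * α / β) := by
    refine OrdEq.of_sq ?_
    convert (hp.mul hαp).div hj.sq using 1
    · omega
    · ring
  have hν : OrdEq O (2 * r + 1 - 2 * j) (-(p * (α ^ 2 * p + β ^ 2 * q) / β ^ 2)) := by
    convert ((hp.mul hαβ).div hj.sq).neg using 1
    omega
  rw [show -(p * q) = (p * α / β) ^ 2 + -(p * (α ^ 2 * p + β ^ 2 * q) / β ^ 2) by field_simp; ring]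
  refine (relDefect_sq_add_le he hs hν ⟨r - j, by omega⟩ (by omega) (by omega)).trans
    (WithTop.coe_le_coe.2 ?_)
  omega

end BinaryForms

section BinaryLattices

variable {O F V : Type*} [CommRing O] [IsDomain O] [IsDiscreteValuationRing O]
  [Field F] [Algebra O F] [IsFractionRing O F]
  [AddCommGroup V] [Module F V] [Module O V] [IsScalarTower O F V]
  {Q : QuadraticForm F V} {L M K L₂ : Submodule O V} {n : ℕ} {a a' : ℕ → F} {R : ℕ → ℤ}
  {r s e : ℤ} {w₁ w₂ x₁ x₂ : V} {b α β π : F}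

/-- `M` is the orthogonal sum of the binary lattice `O w₁ + O (b w₁ + w₂)`, which has the BONG
`w₁, w₂` with values of orders `r` and `s`, and of a lattice `K` whose values have orders at least
`r` and `s`. -/
structure BinarySplitting (Q : QuadraticForm F V) (M K : Submodule O V) (r s : ℤ) (w₁ w₂ : V)
    (b : F) : Prop where
  mem₁ : w₁ ∈ M
  mem₂ : b • w₁ + w₂ ∈ M
  le : K ≤ M
  polar₁₂ : polar Q w₁ w₂ = 0
  polarK₁ : ∀ k ∈ K, polar Q w₁ k = 0
  polarK₂ : ∀ k ∈ K, polar Q w₂ k = 0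
  decomp : ∀ y ∈ M, ∃ u c : F, OrdGE O 0 u ∧ OrdGE O 0 c ∧
    ∃ k ∈ K, y = u • w₁ + c • (b • w₁ + w₂) + k
  ord₁ : OrdEq O r (Q w₁)
  ord₂ : OrdEq O s (Q w₂)
  integral : IntegralPair O (Q w₁) (Q w₂) r b 1
  normK₁ : ∀ k ∈ K, OrdGE O r (Q k)
  normK₂ : ∀ k ∈ K, OrdGE O s (Q k)

namespace BinarySplitting

variable (S : BinarySplitting Q M K r s w₁ w₂ b)

include S

omit [IsScalarTower O F V] in
theorem polar_smul_add (c : F) {k : V} (hk : k ∈ K) : polar Q w₁ (c • w₂ + k) = 0 := by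
  rw [QuadraticMap.polar_add_right, QuadraticMap.polar_smul_right, S.polar₁₂, S.polarK₁ k hk,
    smul_zero, zero_add]

omit [IsScalarTower O F V] in
theorem norm₁ : ∀ y ∈ M, OrdGE O r (Q y) := by
  intro y hy
  obtain ⟨u, c, hu, hc, k, hk, rfl⟩ := S.decomp y hy
  rw [show u • w₁ + c • (b • w₁ + w₂) + k = (u + c * b) • w₁ + (c • w₂ + k) by module,
    map_smul_add_of_polar_eq_zero Q _ (S.polar_smul_add c hk),
    map_smul_add_of_polar_eq_zero Q _ (S.polarK₂ k hk), ← add_assoc]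
  convert (((IntegralPair.one_zero S.ord₁.ge).mul hu).add
    (S.integral.mul hc) S.ord₁).norm.add (S.normK₁ k hk) using 1
  ring

variable (h2 : (2 : F) ≠ 0)

include h2

theorem mem_projLattice {y : V} :
    y ∈ projLattice Q M w₁ ↔ ∃ c : F, OrdGE O 0 c ∧ ∃ k ∈ K, y = c • w₂ + k := by
  have hproj (u c : F) {k : V} (hk : k ∈ K) :
      projPerp Q w₁ (u • w₁ + c • (b • w₁ + w₂) + k) = c • w₂ + k := by
    rw [show u • w₁ + c • (b • w₁ + w₂) + k = (u + c * b) • w₁ + (c • w₂ + k) by module,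
      projPerp_smul_add h2 S.ord₁.ne_zero (S.polar_smul_add c hk)]
  rw [DyadicLattice.mem_projLattice]
  constructor
  · rintro ⟨z, hz, rfl⟩
    obtain ⟨u, c, -, hc, k, hk, rfl⟩ := S.decomp z hz
    exact ⟨c, hc, k, hk, hproj u c hk⟩
  · rintro ⟨c, hc, k, hk, rfl⟩
    exact ⟨_, M.add_mem (M.add_mem (smul_mem_of_ordGE (OrdGE.zero 0) S.mem₁)
      (smul_mem_of_ordGE hc S.mem₂)) (S.le hk), hproj 0 c hk⟩

theorem norm₂ : ∀ y ∈ projLattice Q M w₁, OrdGE O s (Q y) := by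
  intro y hy
  obtain ⟨c, hc, k, hk, rfl⟩ := (S.mem_projLattice h2).1 hy
  rw [map_smul_add_of_polar_eq_zero Q _ (S.polarK₂ k hk)]
  exact ((hc.sq.mul S.ord₂.ge).mono (by omega)).add (S.normK₂ k hk)

theorem projLattice_projLattice : projLattice Q (projLattice Q M w₁) w₂ = K := by
  ext y
  rw [DyadicLattice.mem_projLattice]
  constructor
  · rintro ⟨z, hz, rfl⟩
    obtain ⟨c, -, k, hk, rfl⟩ := (S.mem_projLattice h2).1 hz
    rwa [projPerp_smul_add h2 S.ord₂.ne_zero (S.polarK₂ k hk)]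
  · intro hy
    exact ⟨y, (S.mem_projLattice h2).2 ⟨0, OrdGE.zero 0, y, hy, by module⟩,
      projPerp_eq_self (S.polarK₂ y hy)⟩

theorem hasGoodBONG (h₁ : Q w₁ = a 1) (h₂ : Q w₂ = a 2)
    (hK : HasGoodBONG Q K n (fun i => a (i + 2))) (h₃ : 1 ≤ n → OrdGE O r (a 3))
    (h₄ : 2 ≤ n → OrdGE O s (a 4)) : HasGoodBONG Q M (n + 2) a := by
  have hw₂ : w₂ ∈ projLattice Q M w₁ :=
    (S.mem_projLattice h2).2 ⟨1, ordEq_one.ge, 0, K.zero_mem, by module⟩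
  refine hasGoodBONG_succ (n := n + 1) S.mem₁ h₁ (h₁ ▸ S.ord₁) S.norm₁ ?_ fun hn => h₃ (by omega)
  exact hasGoodBONG_succ hw₂ h₂ (h₂ ▸ S.ord₂) (S.norm₂ h2)
    ((S.projLattice_projLattice h2).symm ▸ hK) h₄

end BinarySplitting

/-- The lattice of the vectors `α x₁ + β x₂` with integral `(α, β)`; it is the greatest lattice in
`F x₁ + F x₂` that contains `x₁` and has norm `𝔭 ^ r = Q(x₁) O`. -/
def integralLattice (Q : QuadraticForm F V) (h : OrdEq O r (Q x₁)) (x₂ : V) : Submodule O V where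
  carrier := {v | ∃ α β : F, v = α • x₁ + β • x₂ ∧ IntegralPair O (Q x₁) (Q x₂) r α β}
  zero_mem' := by
    refine ⟨0 * 1, 0 * 0, ?_, (IntegralPair.one_zero h.ge).mul (OrdGE.zero 0)⟩
    module
  add_mem' := by
    rintro _ _ ⟨α, β, rfl, hi⟩ ⟨α', β', rfl, hi'⟩
    exact ⟨α + α', β + β', by module, hi.add hi' h⟩
  smul_mem' := by
    rintro c _ ⟨α, β, rfl, hi⟩
    refine ⟨algebraMap O F c * α, algebraMap O F c * β, ?_, hi.mul (ordGE_algebraMap c)⟩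
    rw [← algebraMap_smul F c]
    module

theorem span_integralLattice_le (h : OrdEq O r (Q x₁)) :
    Submodule.span F (integralLattice Q h x₂ : Set V) ≤ Submodule.span F {x₁, x₂} := by
  refine Submodule.span_le.2 ?_
  rintro _ ⟨α, β, rfl, -⟩
  exact Submodule.mem_span_pair.2 ⟨α, β, rfl⟩

theorem integralLattice_fg (hπ : OrdEq O 1 π) (he : OrdEq O e (2 : F)) (h₁ : OrdEq O r (Q x₁))
    (h₂ : OrdEq O s (Q x₂)) : (integralLattice Q h₁ x₂).FG := by
  obtain ⟨m, hm⟩ := IntegralPair.exists_ordGE he h₁ h₂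
  have hπm := ordEq_uniformizer_zpow hπ m
  set S := Submodule.span O {π ^ m • x₁, π ^ m • x₂}
  have smul_mem {γ : F} {z : V} (hγ : OrdGE O m γ) (hz : π ^ m • z ∈ S) : γ • z ∈ S := by
    rw [← div_mul_cancel₀ γ hπm.ne_zero, mul_smul]
    exact smul_mem_of_ordGE ((hγ.div hπm).mono (by omega)) hz
  have := isNoetherian_of_fg_of_noetherian S (Submodule.fg_span (by simp))
  refine isNoetherian_submodule.1 this _ ?_
  rintro _ ⟨α, β, rfl, hi⟩
  exact S.add_mem (smul_mem (hm α β hi).1 (Submodule.subset_span (by simp)))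
    (smul_mem (hm α β hi).2 (Submodule.subset_span (by simp)))

omit [IsScalarTower O F V] in
theorem integralPair_of_mem (hM : ∀ y ∈ M, OrdGE O r (Q y)) (h₁ : OrdEq O r (Q x₁))
    (hx₁ : x₁ ∈ M) (h₁₂ : polar Q x₁ x₂ = 0) (h : α • x₁ + β • x₂ ∈ M) :
    IntegralPair O (Q x₁) (Q x₂) r α β where
  trace := by
    have := ordGE_polar hM hx₁ h
    rw [QuadraticMap.polar_add_right, QuadraticMap.polar_smul_right, QuadraticMap.polar_smul_right,
      h₁₂, smul_zero, add_zero, polar_self_mul, smul_eq_mul, mul_left_comm, ← mul_assoc] at this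
    exact this.of_mul_right h₁ (by omega)
  norm := by
    have := hM _ h
    rwa [map_smul_add_of_polar_eq_zero, map_smul_sq] at this
    rw [QuadraticMap.polar_smul_right, h₁₂, smul_zero]

namespace HeadPair

theorem integralPair (H : HeadPair Q L r s x₁ x₂ L₂ K) (h2 : (2 : F) ≠ 0)
    (h : α • x₁ + β • x₂ ∈ L) : IntegralPair O (Q x₁) (Q x₂) r α β :=
  integralPair_of_mem H.norm₁ H.ord₁ H.mem₁ (H.polar₁₂ h2) h

theorem integralPair_lift (H : HeadPair Q L r s x₁ x₂ L₂ K) (h2 : (2 : F) ≠ 0)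
    (hb : b • x₁ + x₂ ∈ L) : IntegralPair O (Q x₁) (Q x₂) r b 1 :=
  H.integralPair h2 (by rwa [one_smul])

theorem span_pair_le (H : HeadPair Q L r s x₁ x₂ L₂ K) :
    Submodule.span F {x₁, x₂} ≤ Submodule.span F (L : Set V) := by
  have hx₁ : x₁ ∈ Submodule.span F (L : Set V) := Submodule.subset_span H.mem₁
  obtain ⟨b, hb⟩ := H.exists_lift₂
  have hx₂ : x₂ ∈ Submodule.span F (L : Set V) := by
    rw [← add_sub_cancel_left (b • x₁) x₂]
    exact Submodule.sub_mem _ (Submodule.subset_span hb) (Submodule.smul_mem _ b hx₁)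
  exact Submodule.span_le.2 (Set.pair_subset hx₁ hx₂)

theorem norm_eq (H : HeadPair Q L r s x₁ x₂ L₂ K) : norm Q L = Submodule.span O {Q x₁} :=
  ((isNormGenerator_iff H.ord₁).2 ⟨H.mem₁, H.norm₁⟩).2.symm

theorem le_integralLattice (H : HeadPair Q L r s x₁ x₂ L₂ ⊥) (h2 : (2 : F) ≠ 0) :
    L ≤ integralLattice Q H.ord₁ x₂ := by
  intro y hy
  obtain ⟨α, β, k, hk, -, rfl⟩ := H.exists_decomp hy
  rw [(Submodule.mem_bot O).1 hk, add_zero] at hy ⊢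
  exact ⟨α, β, rfl, H.integralPair h2 hy⟩

theorem norm_integralLattice_le (H : HeadPair Q L r s x₁ x₂ L₂ K) (h2 : (2 : F) ≠ 0) :
    norm Q (integralLattice Q H.ord₁ x₂) ≤ norm Q L := by
  rw [H.norm_eq]
  refine Submodule.span_le.2 ?_
  rintro _ ⟨_, ⟨α, β, rfl, h⟩, rfl⟩
  rw [H.map_pair h2]
  exact (mem_span_singleton_iff H.ord₁).2 h.norm

theorem ordGE_right (H : HeadPair Q L r s x₁ x₂ L₂ K) (h2 : (2 : F) ≠ 0)
    (h : α • x₁ + β • x₂ ∈ L) : OrdGE O 0 β := by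
  have hβ : β • x₂ ∈ L₂ := H.mem₂_of_eq h2 h rfl (by
    rw [QuadraticMap.polar_smul_right, H.polar₁₂ h2, smul_zero])
  have := map_smul_sq (Q := Q) β x₂ ▸ H.norm₂ _ hβ
  exact (this.of_mul_right H.ord₂ (m := 0) (by omega)).of_sq (by omega)

theorem binarySplitting_span (H : HeadPair Q L r s x₁ x₂ L₂ K) (h2 : (2 : F) ≠ 0)
    (hb : b • x₁ + x₂ ∈ L) :
    BinarySplitting Q (Submodule.span O {x₁, b • x₁ + x₂}) ⊥ r s x₁ x₂ b where
  mem₁ := Submodule.subset_span (by simp)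
  mem₂ := Submodule.subset_span (by simp)
  le := bot_le
  polar₁₂ := H.polar₁₂ h2
  polarK₁ k hk := by rw [(Submodule.mem_bot O).1 hk, QuadraticMap.polar_zero_right]
  polarK₂ k hk := by rw [(Submodule.mem_bot O).1 hk, QuadraticMap.polar_zero_right]
  decomp y hy := by
    obtain ⟨u, c, rfl⟩ := Submodule.mem_span_pair.1 hy
    refine ⟨_, _, ordGE_algebraMap u, ordGE_algebraMap c, 0, Submodule.zero_mem _, ?_⟩
    rw [algebraMap_smul, algebraMap_smul, add_zero]
  ord₁ := H.ord₁
  ord₂ := H.ord₂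
  integral := H.integralPair_lift h2 hb
  normK₁ k hk := by
    rw [(Submodule.mem_bot O).1 hk, QuadraticMap.map_zero]
    exact OrdGE.zero _
  normK₂ k hk := by
    rw [(Submodule.mem_bot O).1 hk, QuadraticMap.map_zero]
    exact OrdGE.zero _

theorem isNormMaximal_span (H : HeadPair Q L r s x₁ x₂ L₂ K) (h2 : (2 : F) ≠ 0)
    (hb : b • x₁ + x₂ ∈ L) (h : BinaryMaximal O (Q x₁) (Q x₂) r) :
    IsNormMaximal Q (Submodule.span O {x₁, b • x₁ + x₂}) := by
  have S := H.binarySplitting_span h2 hb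
  set J := Submodule.span O {x₁, b • x₁ + x₂}
  intro M _ hspan hJM hnorm
  refine le_antisymm (fun y hy => ?_) hJM
  have hM : ∀ z ∈ M, OrdGE O r (Q z) := fun z hz => by
    rw [← mem_span_singleton_iff H.ord₁,
      ((isNormGenerator_iff H.ord₁).2 ⟨S.mem₁, S.norm₁⟩).2]
    exact hnorm (map_mem_norm hz)
  have hJ : Submodule.span F (J : Set V) ≤ Submodule.span F {x₁, x₂} := by
    refine Submodule.span_le.2 fun z hz => ?_
    obtain ⟨u, c, -, -, k, hk, rfl⟩ := S.decomp z hz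
    rw [(Submodule.mem_bot O).1 hk]
    exact Submodule.mem_span_pair.2 ⟨u + c * b, c, by module⟩
  obtain ⟨α, β, rfl⟩ := Submodule.mem_span_pair.1 (hJ (hspan ▸ Submodule.subset_span hy))
  have hi := integralPair_of_mem hM H.ord₁ (hJM S.mem₁) (H.polar₁₂ h2) hy
  have hα := hi.ordGE_sub_mul S.integral (h hi) H.ord₁
  convert J.add_mem (smul_mem_of_ordGE hα S.mem₁) (smul_mem_of_ordGE (h hi) S.mem₂) using 1
  module

end HeadPair

theorem binaryMaximal_of_isMaximalPair (hπ : OrdEq O 1 π) (he : OrdEq O e (2 : F))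
    (hR : HasOrders O 2 a R) (h : IsMaximalPair (V := V) O Q a) :
    BinaryMaximal O (a 1) (a 2) (R 1) := by
  have h2 := he.ne_zero
  obtain ⟨J, ⟨x, hx, hxa⟩, hmax⟩ := h
  have hJ : HasGoodBONG Q J (0 + 2) a := ⟨x, hx, fun i j hij => by omega, hxa⟩
  obtain ⟨x₁, x₂, J₂, K, H, hQ₁, hQ₂, -, hK⟩ := hJ.exists_headPair hR
  obtain rfl := hasGoodBONG_zero.1 hK
  have hJN := H.le_integralLattice h2
  have hNJ : integralLattice Q H.ord₁ x₂ = J :=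
    hmax _ (integralLattice_fg hπ he H.ord₁ H.ord₂)
      (((span_integralLattice_le H.ord₁).trans H.span_pair_le).antisymm
        (Submodule.span_mono hJN)) hJN (H.norm_integralLattice_le h2)
  rw [← hQ₁, ← hQ₂]
  intro α β hi
  exact H.ordGE_right h2 (hNJ ▸ ⟨α, β, rfl, hi⟩ : α • x₁ + β • x₂ ∈ J)

theorem isMaximalPair_of_binaryMaximal (h2 : (2 : F) ≠ 0) (H : HeadPair Q L r s x₁ x₂ L₂ K)
    (h₁ : Q x₁ = a 1) (h₂ : Q x₂ = a 2) (h : BinaryMaximal O (a 1) (a 2) r) :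
    IsMaximalPair (V := V) O Q a := by
  obtain ⟨b, hb⟩ := H.exists_lift₂
  obtain ⟨x, hx, -, hxa⟩ := (H.binarySplitting_span h2 hb).hasGoodBONG (n := 0) h2 h₁ h₂
    (hasGoodBONG_zero.2 rfl) (by omega) (by omega)
  exact ⟨_, ⟨x, hx, hxa⟩, H.isNormMaximal_span h2 hb (h₁ ▸ h₂ ▸ h)⟩

section NoSuccessor

variable [PerfectField (IsLocalRing.ResidueField O)] [CharP (IsLocalRing.ResidueField O) 2]

theorem projLattice_sublatticeOrdGE (hπ : OrdEq O 1 π) (h2 : (2 : F) ≠ 0)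
    (hpol : ∀ x ∈ L, ∀ y ∈ L, OrdGE O (r + 1) (polar Q x y)) {x : V} (hx : x ∈ L)
    (ho : OrdEq O r (Q x)) (hnorm : ∀ y ∈ L, OrdGE O r (Q y)) :
    projLattice Q (sublatticeOrdGE Q L (r + 1) hpol) x = projLattice Q L x := by
  ext y
  rw [mem_projLattice, mem_projLattice]
  constructor
  · rintro ⟨z, hz, rfl⟩
    exact ⟨z, hz.1, rfl⟩
  · rintro ⟨z, hz, rfl⟩
    obtain ⟨c, hc, hcz⟩ := exists_ordGE_add_sq_mul (N := r) (j := 0) hπ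
      ((hnorm z hz).mono (by omega)) ho
    have hcx := smul_mem_of_ordGE hc hx
    refine ⟨c • x + z, ⟨L.add_mem hcx hz, ?_⟩, ?_⟩
    · rw [QuadraticMap.map_add Q, map_smul_sq, add_comm (c ^ 2 * Q x)]
      exact (hcz.mono (by omega)).add (hpol _ hcx _ hz)
    · rw [map_add, map_smul, projPerp_self h2 ho.ne_zero, smul_zero, zero_add]

theorem isLatticeWithGoodBONG_of_no_succ (hπ : OrdEq O 1 π) (h2 : (2 : F) ≠ 0)
    (h : HasGoodBONG Q L (n + 1) a) (hR : HasOrders O (n + 1) a R)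
    (hpol : ∀ x ∈ L, ∀ y ∈ L, OrdGE O (R 1 + 1) (polar Q x y))
    (hno : ∀ x ∈ L, ¬ OrdEq O (R 1 + 1) (Q x)) (h3 : 2 ≤ n → R 1 + 2 ≤ R 3)
    (ha1 : a' 1 = π ^ 2 * a 1) (ha' : ∀ i, 2 ≤ i → i ≤ n + 1 → a' i = a i) :
    IsLatticeWithGoodBONG O Q (nonNormGenerators Q L) (n + 1) a' := by
  obtain ⟨x, hx, hQx, hox, hnorm, hgen, hK⟩ := h.exists_first hR
  refine ⟨sublatticeOrdGE Q L (R 1 + 1) hpol, (nonNormGenerators_eq hox hgen).symm, ?_⟩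
  have hQx' : Q (π • x) = a' 1 := by rw [map_smul_sq, hQx, ha1]
  have ho' : OrdEq O (R 1 + 2) (a' 1) := by
    rw [ha1, ← hQx]
    convert hπ.sq.mul hox using 1
    ring
  have hmem : π • x ∈ sublatticeOrdGE Q L (R 1 + 1) hpol :=
    ⟨smul_mem_of_ordGE (hπ.ge.mono (by omega)) hx, hQx' ▸ ho'.ge.mono (by omega)⟩
  refine hasGoodBONG_succ hmem hQx' ho' ?_ ?_ fun hn => ?_
  · rintro y ⟨hy, hy'⟩
    have := hy'.eq_or.resolve_left (hno y hy)
    rwa [add_assoc] at this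
  · have hproj : projLattice Q (sublatticeOrdGE Q L (R 1 + 1) hpol) (π • x) =
        projLattice Q L x := by
      rw [projLattice, projPerp_smul hπ.ne_zero]
      exact projLattice_sublatticeOrdGE hπ h2 hpol hx hox hnorm
    rw [hproj]
    exact hK.congr fun i hi hin => (ha' (i + 1) (by omega) (by omega)).symm
  · rw [ha' 3 (by omega) (by omega)]
    exact (hR 3 (by omega) (by omega)).ge.mono (h3 hn)

end NoSuccessor

end BinaryLattices

section ReflectionParity

variable {O F V : Type*} [CommRing O] [IsDomain O] [IsDiscreteValuationRing O]
  [Field F] [Algebra O F] [IsFractionRing O F]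
  [AddCommGroup V] [Module F V] [Module O V] [IsScalarTower O F V]
  {Q : QuadraticForm F V} {L K L₂ : Submodule O V} {e k r s : ℤ} {x₁ x₂ : V} {n : ℕ} {a : ℕ → F}
  {R : ℕ → ℤ}

theorem HasOrders.ordGE_third (hR : HasOrders O (n + 2) a R)
    (hK : HasGoodBONG Q K n (fun i => a (i + 2))) (hr : 1 ≤ n → r ≤ R 3) :
    ∀ k ∈ K, OrdGE O r (Q k) :=
  hK.ordGE fun hn => ⟨hR 3 (by omega) (by omega), hr hn⟩

omit [IsScalarTower O F V] in
theorem ReflectionParity.not_ordEq_succ (hpar : ReflectionParity Q L r)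
    (hpol : ∀ x ∈ L, ∀ y ∈ L, OrdGE O (r + 1) (polar Q x y)) :
    ∀ x ∈ L, ¬ OrdEq O (r + 1) (Q x) := by
  intro x hx hox
  obtain ⟨i, hi⟩ := hpar x hx _ hox (hpol x hx)
  omega

theorem HeadPair.even_of_reflectionParity (H : HeadPair Q L r s x₁ x₂ L₂ K) (h2 : (2 : F) ≠ 0)
    (hrs : r ≤ s) (hpar : ReflectionParity Q L r) : Even (s - r) := by
  refine hpar x₂ (H.le_of_norm h2 hrs H.mem₂) s H.ord₂ fun y hy => ?_
  obtain ⟨c, y', hy', rfl⟩ := H.exists_decomp₁ hy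
  rw [QuadraticMap.polar_add_right, QuadraticMap.polar_smul_right, QuadraticMap.polar_comm Q x₂ x₁,
    H.polar₁₂ h2, smul_zero, zero_add]
  exact ordGE_polar H.norm₂ H.mem₂ hy'

theorem HeadPair.even_of_reflectionParity_of_mem (H : HeadPair Q L r s x₁ x₂ L₂ K)
    (h2 : (2 : F) ≠ 0) (hr : r ≤ k) (hs : s ≤ k) (hpar : ReflectionParity Q L r) {x₃ : V}
    (hx₃ : x₃ ∈ K) (ho : OrdEq O k (Q x₃)) (hK : ∀ y ∈ K, OrdGE O k (Q y)) : Even (k - r) := by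
  have hKr : ∀ y ∈ K, OrdGE O r (Q y) := fun y hy => (hK y hy).mono hr
  have hKs : ∀ y ∈ K, OrdGE O s (Q y) := fun y hy => (hK y hy).mono hs
  obtain ⟨b, hb⟩ := H.exists_lift₂
  refine hpar x₃ (H.le_of_norm₂ h2 hKr hKs hx₃) k ho fun y hy => ?_
  obtain ⟨u, c, -, -, z, hz, rfl⟩ := H.exists_integral_decomp h2 hKr hKs hb hy
  simp only [QuadraticMap.polar_add_right, QuadraticMap.polar_smul_right,
    QuadraticMap.polar_comm Q x₃ x₁, QuadraticMap.polar_comm Q x₃ x₂, H.polarK₁ h2 hx₃,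
    H.polarK₂ h2 hx₃, smul_zero, zero_add]
  exact ordGE_polar hK hx₃ hz

theorem HasGoodBONG.third_ne_of_reflectionParity (h : HasGoodBONG Q L (n + 3) a)
    (hR : HasOrders O (n + 3) a R) (h2 : (2 : F) ≠ 0) (hpar : ReflectionParity Q L (R 1)) :
    R 3 ≠ R 1 + 1 := by
  intro h13
  obtain ⟨x₁, x₂, L₂, K, H, -, -, -, hK⟩ := h.exists_headPair (n := n + 1) hR
  rcases Int.even_or_odd (R 2 - R 1) with ⟨i, hi⟩ | hodd
  · have hodd : Odd (R 3 - R 2) := ⟨-i, by omega⟩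
    have h23 : R 2 < R 3 := h.lt_of_odd hR h2 (i := 2) one_le_two (by omega) hodd
    obtain ⟨x₃, hx₃, -, ho₃, hn₃, -⟩ := hK.exists_first (hR.shift (n := n + 1) 2)
    obtain ⟨j, hj⟩ := H.even_of_reflectionParity_of_mem h2 (by omega) h23.le hpar hx₃ ho₃ hn₃
    omega
  · exact Int.not_even_iff_odd.2 hodd (H.even_of_reflectionParity h2 (H.lt_of_odd h2 hodd).le hpar)

theorem HasGoodBONG.third_ne_of_propertyB (h : HasGoodBONG Q L (n + 3) a)
    (hR : HasOrders O (n + 3) a R) (he : OrdEq O e (2 : F))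
    (hB : PropertyB O e (n + 3) a R) : R 3 ≠ R 1 + 1 := by
  intro h13
  have h2 := he.ne_zero
  rcases Int.even_or_odd (R 3 - R 2) with ⟨i, hi⟩ | hodd
  · have hodd : Odd (R 2 - R 1) := ⟨-i, by omega⟩
    have hlt : R 1 < R 2 := h.lt_of_odd hR h2 (i := 1) le_rfl (by omega) hodd
    have h23 : R 2 - 2 * e ≤ R 3 := h.sub_two_mul_le hR he (i := 2) one_le_two (by omega)
    have hgap : R 3 - R 2 > 2 * e :=
      (hB.2 1 le_rfl (by omega) (Or.inl ⟨hodd, by change R 2 - R 1 ≤ _; omega⟩)).2 (by omega)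
    omega
  · have hlt : R 2 < R 3 := h.lt_of_odd hR h2 (i := 2) one_le_two (by omega) hodd
    have h12 : R 1 - 2 * e ≤ R 2 := h.sub_two_mul_le hR he (i := 1) le_rfl (by omega)
    have hgap : R 2 - R 1 > 2 * e :=
      (hB.2 2 one_le_two (by omega) (Or.inl ⟨hodd, by change R 3 - R 2 ≤ _; omega⟩)).1 le_rfl
    omega

theorem HasGoodBONG.add_two_le_third (h : HasGoodBONG Q L n a) (hR : HasOrders O n a R)
    (he : OrdEq O e (2 : F)) (hB : PropertyB O e n a R ∨ ReflectionParity Q L (R 1))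
    (h3 : 3 ≤ n) (h13 : R 1 < R 3) : R 1 + 2 ≤ R 3 := by
  obtain ⟨m, rfl⟩ := Nat.exists_eq_add_of_le' h3
  have : R 3 ≠ R 1 + 1 := hB.elim (h.third_ne_of_propertyB hR he)
    (h.third_ne_of_reflectionParity hR he.ne_zero)
  omega

theorem HeadPair.ordGE_zero_of_ordEq_succ (H : HeadPair Q L r s x₁ x₂ L₂ K) (h2 : (2 : F) ≠ 0)
    {k : V} {α β : F} (hk : k ∈ K) (hQk : OrdGE O (r + 2) (Q k)) (hL₂ : β • x₂ + k ∈ L₂)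
    (h : OrdEq O (r + 1) (α ^ 2 * Q x₁ + β ^ 2 * Q x₂)) : OrdGE O 0 β := by
  by_contra hβ
  obtain ⟨j, hj0, hj⟩ := exists_lt_ordEq hβ
  have ho := hj.sq.mul H.ord₂
  have hge := H.norm₂ _ hL₂
  rw [map_smul_add_of_polar_eq_zero Q _ (H.polarK₂ h2 hk)] at hge
  have hdiff := (hge.mono (min_le_left s (r + 2))).sub (hQk.mono (min_le_right s (r + 2)))
  rw [add_sub_cancel_right] at hdiff
  have := ho.le_of_ge hdiff
  have hα : OrdEq O (r + 1) (α ^ 2 * Q x₁) := by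
    rw [← add_sub_cancel_right (α ^ 2 * Q x₁) (β ^ 2 * Q x₂), sub_eq_add_neg]
    exact h.add_ge (ho.neg.ge.mono (by omega))
  obtain ⟨i, hi⟩ := even_of_ordEq_sq_mul H.ord₁ hα
  omega

theorem HasGoodBONG.not_ordEq_succ (h : HasGoodBONG Q L (n + 2) a) (hR : HasOrders O (n + 2) a R)
    (h2 : (2 : F) ≠ 0) (h3 : 1 ≤ n → R 1 + 2 ≤ R 3)
    (hmax : ¬ IsMaximalPair (V := V) O Q a) : ∀ x ∈ L, ¬ OrdEq O (R 1 + 1) (Q x) := by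
  intro x hx hox
  obtain ⟨x₁, x₂, L₂, K, H, hQ₁, hQ₂, -, hK⟩ := h.exists_headPair hR
  refine hmax (isMaximalPair_of_binaryMaximal h2 H hQ₁ hQ₂ ?_)
  rw [← hQ₁, ← hQ₂]
  obtain ⟨α, β, k, hk, hL₂, rfl⟩ := H.exists_decomp hx
  have hQk := hR.ordGE_third hK h3 k hk
  have hz : OrdEq O (R 1 + 1) (α ^ 2 * Q x₁ + β ^ 2 * Q x₂) := by
    rw [H.map_eq h2 hk] at hox
    convert hox.add_ge (hQk.neg.mono (by omega)) using 1
    ring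
  exact binaryMaximal_of_ordEq_succ H.ord₁ (H.ordGE_zero_of_ordEq_succ h2 hk hQk hL₂ hz) hz

end ReflectionParity

section UnimodularPlanes

variable {O F V : Type*} [CommRing O] [IsDomain O] [IsDiscreteValuationRing O]
  [Field F] [Algebra O F] [IsFractionRing O F]
  [AddCommGroup V] [Module F V] [Module O V] [IsScalarTower O F V]
  {Q : QuadraticForm F V} {L K L₂ : Submodule O V} {e r s : ℤ} {p q ρ π b c t u v w : F}
  {x₁ x₂ : V} {n : ℕ} {a a' : ℕ → F} {R : ℕ → ℤ}

theorem HeadPair.nonNormGenerators_eq (H : HeadPair Q L r s x₁ x₂ L₂ K) :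
    nonNormGenerators Q L = {y | y ∈ L ∧ OrdGE O (r + 1) (Q y)} :=
  DyadicLattice.nonNormGenerators_eq H.ord₁ ((isNormGenerator_iff H.ord₁).2 ⟨H.mem₁, H.norm₁⟩)

theorem HeadPair.smul_add_mem (H : HeadPair Q L r s x₁ x₂ L₂ K) (h2 : (2 : F) ≠ 0)
    (h : IntegralPair O (Q x₁) (Q x₂) r c 1) : c • x₁ + x₂ ∈ L := by
  obtain ⟨b, hb⟩ := H.exists_lift₂
  simpa using H.pair_mem hb ordEq_one.ge
    (h.ordGE_sub_mul (H.integralPair_lift h2 hb) ordEq_one.ge H.ord₁)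

/-- With respect to `x₁` and `c x₁ + x₂`, where `Q(x₁) = p` and `Q(x₂) = q`, the quadratic form
becomes `p` times the norm form `X² + XW + ρW²`, and `W = 2cY` is a unit multiple of the second
coordinate `Y`. -/
structure IsNormForm (O : Type*) {F : Type*} [CommRing O] [IsDomain O] [IsDiscreteValuationRing O]
    [Field F] [Algebra O F] [IsFractionRing O F] (p q ρ c : F) : Prop where
  ord : OrdEq O 0 (2 * c)
  eq : c ^ 2 * p + q = ρ * (2 * c) ^ 2 * p

theorem exists_isNormForm [CharP (IsLocalRing.ResidueField O) 2] (he : OrdEq O e (2 : F))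
    (hp : OrdEq O r p) (hq : OrdEq O (r - 2 * e) q) (hρ : OrdGE O 0 ρ)
    (h : p * q = -(1 - 4 * ρ) * t ^ 2) : ∃ c, IsNormForm O p q ρ c := by
  have hp0 := hp.ne_zero
  have hΔ : OrdEq O 0 (1 - 4 * ρ) := by
    rw [sub_eq_add_neg, show (4 : F) = 2 ^ 2 by norm_num]
    exact ordEq_one.add_ge ((ordGE_one_two.sq.mul hρ).neg.mono (by omega))
  have ht : OrdEq O (r - e) t := by
    refine OrdEq.of_sq ?_
    rw [← mul_div_cancel_left₀ (t ^ 2) hΔ.neg.ne_zero, ← h]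
    convert (hp.mul hq).div hΔ.neg using 1
    omega
  refine ⟨t / p, ?_, ?_⟩
  · convert he.mul (ht.div hp) using 1
    omega
  · field_simp
    linear_combination h

namespace IsNormForm

variable (hN : IsNormForm O p q ρ c)

include hN

theorem integralPair (hρ : OrdGE O 0 ρ) (hp : OrdEq O r p) : IntegralPair O p q r c 1 where
  trace := hN.ord.ge
  norm := by
    rw [one_pow, one_mul, hN.eq]
    exact ((hρ.mul hN.ord.ge.sq).mul hp.ge).mono (by omega)

end IsNormForm

theorem not_ordGE_one_of_quadraticDefect (h2 : (2 : F) ≠ 0)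
    (h : quadraticDefect O (1 - 4 * ρ) = Submodule.span O {(4 : F)}) (v : F) :
    ¬ OrdGE O 1 (v ^ 2 + v + ρ) := by
  intro hv
  obtain ⟨e, he⟩ := exists_ordEq (O := O) h2
  have h4 : OrdEq O (2 * e) (4 : F) := by
    convert he.sq using 1
    norm_num
  have hmem : (4 : F) ∈ quadraticDefect O (1 - 4 * ρ) :=
    h ▸ Submodule.mem_span_singleton_self _
  obtain ⟨o, ho⟩ := Submodule.mem_span_singleton.1 ((Submodule.mem_iInf _).1 hmem (1 + 2 * v))
  rw [show 1 - 4 * ρ - (1 + 2 * v) ^ 2 = -4 * (v ^ 2 + v + ρ) by ring, Algebra.smul_def] at ho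
  have : OrdGE O (2 * e + 1) (4 : F) := by
    rw [← ho]
    exact ((ordGE_algebraMap o).mul (h4.neg.ge.mul hv)).mono (by omega)
  exact h4.not_ge (by omega) this

theorem ordGE_one_of_normForm (h : ∀ v : F, ¬ OrdGE O 1 (v ^ 2 + v + ρ)) (hρ : OrdGE O 0 ρ)
    (hu : OrdGE O 0 u) (hw : OrdGE O 0 w) (huw : OrdGE O 1 (u ^ 2 + u * w + ρ * w ^ 2)) :
    OrdGE O 1 u ∧ OrdGE O 1 w := by
  rcases hw.eq_or with hw | hw
  · refine absurd ?_ (h (u / w))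
    have hw0 := hw.ne_zero
    convert (huw.div hw.sq).mono (by omega : (1 : ℤ) ≤ _) using 1
    field_simp
  · have huu : OrdGE O 1 (u ^ 2) := by
      convert (huw.sub ((hu.mul hw).mono (by omega))).sub
        ((hρ.mul hw.sq).mono (by omega : (1 : ℤ) ≤ _)) using 1
      ring
    exact ⟨huu.of_sq (by omega), hw⟩

namespace HeadPair

variable (H : HeadPair Q L r s x₁ x₂ L₂ K)

include H

theorem map_normForm (h2 : (2 : F) ≠ 0) (hN : IsNormForm O (Q x₁) (Q x₂) ρ c) {k : V}
    (hk : k ∈ K) :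
    Q (u • x₁ + v • (c • x₁ + x₂) + k) =
      (u ^ 2 + u * (2 * c * v) + ρ * (2 * c * v) ^ 2) * Q x₁ + Q k := by
  rw [show u • x₁ + v • (c • x₁ + x₂) + k = (u + v * c) • x₁ + (v • x₂ + k) by module,
    H.map_eq h2 hk]
  linear_combination v ^ 2 * hN.eq

theorem not_submodule_of_hyperbolic (h2 : (2 : F) ≠ 0)
    (hN : IsNormForm O (Q x₁) (Q x₂) 0 c) :
    ¬ ∃ M : Submodule O V, (M : Set V) = nonNormGenerators Q L := by
  rintro ⟨M, hM⟩
  rw [H.nonNormGenerators_eq] at hM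
  have key : ∀ c : F, IsNormForm O (Q x₁) (Q x₂) 0 c → c • x₁ + x₂ ∈ M := by
    intro c hN
    rw [← SetLike.mem_coe, hM]
    refine ⟨H.smul_add_mem h2 (hN.integralPair (OrdGE.zero 0) H.ord₁), ?_⟩
    rw [H.map_lift h2, hN.eq, zero_mul, zero_mul]
    exact OrdGE.zero _
  have hneg : IsNormForm O (Q x₁) (Q x₂) 0 (-c) :=
    ⟨by simpa using hN.ord.neg, by simpa using hN.eq⟩
  have hdiff : (2 * c) • x₁ ∈ (M : Set V) := by
    rw [show (2 * c) • x₁ = c • x₁ + x₂ - (-c • x₁ + x₂) by module]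
    exact M.sub_mem (key c hN) (key (-c) hneg)
  rw [hM] at hdiff
  exact (hN.ord.sq.mul H.ord₁).not_ge (by omega) (map_smul_sq (Q := Q) (2 * c) x₁ ▸ hdiff.2)

theorem ordEq_zero_two_mul (he : OrdEq O e (2 : F)) (he1 : 1 ≤ e) (hs : s = r - 2 * e)
    (hb : b • x₁ + x₂ ∈ L) : OrdEq O 0 (2 * b) := by
  subst hs
  have hbp : OrdEq O (r - 2 * e) (b ^ 2 * Q x₁) := by
    refine H.ord₂.of_add_ge ?_
    rw [add_comm (Q x₂), ← H.map_lift he.ne_zero]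
    exact (H.norm₁ _ hb).mono (by omega)
  have hbb := hbp.div H.ord₁
  rw [mul_div_cancel_right₀ _ H.ord₁.ne_zero] at hbb
  have hb' : OrdEq O (-e) b := OrdEq.of_sq (by convert hbb using 1; ring)
  exact add_neg_cancel e ▸ he.mul hb'

end HeadPair

theorem HasGoodBONG.not_submodule_of_hyperbolic [CharP (IsLocalRing.ResidueField O) 2]
    (h : HasGoodBONG Q L (n + 2) a) (hR : HasOrders O (n + 2) a R) (he : OrdEq O e (2 : F))
    (h12 : R 2 = R 1 - 2 * e) (ht : a 1 * a 2 = -t ^ 2) :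
    ¬ ∃ M : Submodule O V, (M : Set V) = nonNormGenerators Q L := by
  obtain ⟨x₁, x₂, L₂, K, H, hQ₁, hQ₂, -, -⟩ := h.exists_headPair hR
  obtain ⟨c, hN⟩ := exists_isNormForm he H.ord₁ (h12 ▸ H.ord₂) (OrdGE.zero 0)
    (by rw [hQ₁, hQ₂, ht]; ring : Q x₁ * Q x₂ = -(1 - 4 * 0) * t ^ 2)
  exact H.not_submodule_of_hyperbolic he.ne_zero hN

section Perfect

variable [PerfectField (IsLocalRing.ResidueField O)] [CharP (IsLocalRing.ResidueField O) 2]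

theorem exists_smul_add_mem_ordGE_succ (hπ : OrdEq O 1 π) (hL : ∀ y ∈ L, OrdGE O r (Q y))
    {x y : V} (hx : x ∈ L) (hox : OrdEq O r (Q x)) (hy : y ∈ L) (hxy : polar Q x y = 0) :
    ∃ c : F, OrdGE O 0 c ∧ c • x + y ∈ L ∧ OrdGE O (r + 1) (Q (c • x + y)) := by
  obtain ⟨c, hc, hc'⟩ := exists_ordGE_add_sq_mul (N := r) (j := 0) hπ
    ((hL y hy).mono (by omega)) hox
  refine ⟨c, hc, L.add_mem (smul_mem_of_ordGE hc hx) hy, ?_⟩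
  rw [map_smul_add_of_polar_eq_zero Q _ hxy, add_comm (c ^ 2 * Q x)]
  exact hc'.mono (by omega)

/- Both `x₁` and `b x₁ + x₂` become elements of `L'` after adding multiples of `x₃`, but the sum
of these two elements of `L'` is a norm generator. -/
theorem HeadPair.not_submodule_of_mem (H : HeadPair Q L r s x₁ x₂ L₂ K) (hπ : OrdEq O 1 π)
    (h2 : (2 : F) ≠ 0) (hb : b • x₁ + x₂ ∈ L) (hob : OrdEq O 0 (2 * b)) {x₃ : V} (hx₃ : x₃ ∈ K)
    (hx₃L : x₃ ∈ L) (ho₃ : OrdEq O r (Q x₃)) :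
    ¬ ∃ M : Submodule O V, (M : Set V) = nonNormGenerators Q L := by
  rintro ⟨M, hM⟩
  rw [H.nonNormGenerators_eq] at hM
  have h₃₁ : polar Q x₃ x₁ = 0 := (QuadraticMap.polar_comm Q x₃ x₁).trans (H.polarK₁ h2 hx₃)
  have h₃₂ : polar Q x₃ x₂ = 0 := (QuadraticMap.polar_comm Q x₃ x₂).trans (H.polarK₂ h2 hx₃)
  obtain ⟨c, hc, hcL, hcQ⟩ := exists_smul_add_mem_ordGE_succ hπ H.norm₁ hx₃L ho₃ H.mem₁ h₃₁
  obtain ⟨d, hd, hdL, hdQ⟩ := exists_smul_add_mem_ordGE_succ hπ H.norm₁ hx₃L ho₃ hb (by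
    rw [QuadraticMap.polar_add_right, QuadraticMap.polar_smul_right, h₃₁, h₃₂, smul_zero, add_zero])
  have hcM : c • x₃ + x₁ ∈ M := by
    rw [← SetLike.mem_coe, hM]
    exact ⟨hcL, hcQ⟩
  have hdM : d • x₃ + (b • x₁ + x₂) ∈ M := by
    rw [← SetLike.mem_coe, hM]
    exact ⟨hdL, hdQ⟩
  have hsum : c • x₃ + x₁ + (d • x₃ + (b • x₁ + x₂)) ∈ (M : Set V) := M.add_mem hcM hdM
  rw [hM] at hsum
  have hpolar : polar Q (c • x₃ + x₁) (d • x₃ + (b • x₁ + x₂)) =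
      2 * b * Q x₁ + c * d * (2 * Q x₃) := by
    simp only [QuadraticMap.polar_add_right, QuadraticMap.polar_add_left,
      QuadraticMap.polar_smul_left, QuadraticMap.polar_smul_right, smul_eq_mul, h₃₁, h₃₂,
      QuadraticMap.polar_comm Q x₁ x₃, H.polar₁₂ h2, polar_self_mul]
    ring
  have hge : OrdGE O (r + 1) (2 * b * Q x₁ + c * d * (2 * Q x₃)) :=
    hpolar ▸ (hsum.2.sub hcQ).sub hdQ
  refine ((hob.mul H.ord₁).add_ge ?_).not_ge (by omega) hge
  exact ((hc.mul hd).mul (ordGE_one_two.mul ho₃.ge)).mono (by omega)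

theorem HasGoodBONG.not_submodule_of_eq_third (h : HasGoodBONG Q L (n + 3) a)
    (hR : HasOrders O (n + 3) a R) (hπ : OrdEq O 1 π) (he : OrdEq O e (2 : F))
    (h12 : R 2 = R 1 - 2 * e) (h13 : R 1 = R 3) :
    ¬ ∃ M : Submodule O V, (M : Set V) = nonNormGenerators Q L := by
  have h2 := he.ne_zero
  have he1 := one_le_of_ordEq_two he
  obtain ⟨x₁, x₂, L₂, K, H, -, -, -, hK⟩ := h.exists_headPair (n := n + 1) hR
  obtain ⟨b, hb⟩ := H.exists_lift₂
  obtain ⟨x₃, hx₃, -, ho₃, -⟩ := hK.exists_first (hR.shift (n := n + 1) 2)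
  have hKL : K ≤ L := H.le_of_norm₂ h2 (hR.ordGE_third hK fun _ => h13.le)
    (hR.ordGE_third hK fun _ => by omega)
  exact H.not_submodule_of_mem hπ h2 hb (H.ordEq_zero_two_mul he he1 h12 hb) hx₃ (hKL hx₃)
    (h13 ▸ ho₃)

end Perfect

section Unramified

omit [IsDomain O] [IsDiscreteValuationRing O] [IsFractionRing O F] in
theorem mem_span_pair_sup_iff {y y₁ y₂ : V} :
    y ∈ Submodule.span O {y₁, y₂} ⊔ K ↔ ∃ u v : O, ∃ k ∈ K, y = u • y₁ + v • y₂ + k := by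
  simp only [Submodule.mem_sup, Submodule.mem_span_pair]
  constructor
  · rintro ⟨_, ⟨u, v, rfl⟩, k, hk, rfl⟩
    exact ⟨u, v, k, hk, rfl⟩
  · rintro ⟨u, v, k, hk, rfl⟩
    exact ⟨_, ⟨u, v, rfl⟩, k, hk, rfl⟩

namespace HeadPair

variable (H : HeadPair Q L r s x₁ x₂ L₂ K) (h2 : (2 : F) ≠ 0) (hπ : OrdEq O 1 π)
  (hρ : OrdGE O 0 ρ) (hN : IsNormForm O (Q x₁) (Q x₂) ρ c)

include H h2 hπ hρ hN

theorem nonNormGenerators_eq_span_sup (han : ∀ v : F, ¬ OrdGE O 1 (v ^ 2 + v + ρ))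
    (hr : ∀ k ∈ K, OrdGE O (r + 1) (Q k)) (hs : ∀ k ∈ K, OrdGE O s (Q k)) :
    nonNormGenerators Q L =
      (Submodule.span O {π • x₁, π • (c • x₁ + x₂)} ⊔ K : Submodule O V) := by
  have hπ0 := hπ.ne_zero
  have hrK : ∀ k ∈ K, OrdGE O r (Q k) := fun k hk => (hr k hk).mono (by omega)
  have hy₀ := H.smul_add_mem h2 (hN.integralPair hρ H.ord₁)
  rw [H.nonNormGenerators_eq]
  ext y
  rw [Set.mem_ofPred_eq, SetLike.mem_coe, mem_span_pair_sup_iff]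
  constructor
  · rintro ⟨hy, hyQ⟩
    obtain ⟨u, v, hu, hv, k, hk, rfl⟩ := H.exists_integral_decomp h2 hrK hs hy₀ hy
    rw [H.map_normForm h2 hN hk] at hyQ
    have hpair := add_sub_cancel_right _ (Q k) ▸ hyQ.sub (hr k hk)
    obtain ⟨hu', hw'⟩ := ordGE_one_of_normForm han hρ hu (by simpa using hN.ord.ge.mul hv)
      (hpair.of_mul_right H.ord₁ (by omega))
    have hv' : OrdGE O 1 v := hw'.of_mul_left hN.ord (by omega)
    obtain ⟨u', hu'⟩ := ordGE_zero_iff.1 (by simpa using hu'.div hπ)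
    obtain ⟨v', hv'⟩ := ordGE_zero_iff.1 (by simpa using hv'.div hπ)
    refine ⟨u', v', k, hk, ?_⟩
    rw [← algebraMap_smul F u', ← algebraMap_smul F v', hu', hv', smul_smul, smul_smul,
      div_mul_cancel₀ _ hπ0, div_mul_cancel₀ _ hπ0]
  · rintro ⟨u', v', k, hk, rfl⟩
    rw [← algebraMap_smul F u', ← algebraMap_smul F v', smul_smul, smul_smul]
    have hu : OrdGE O 1 (algebraMap O F u' * π) := by simpa using (ordGE_algebraMap u').mul hπ.ge
    have hv : OrdGE O 1 (algebraMap O F v' * π) := by simpa using (ordGE_algebraMap v').mul hπ.ge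
    have hw := (hN.ord.ge.mul hv).mono (by omega : (1 : ℤ) ≤ _)
    refine ⟨L.add_mem (L.add_mem (smul_mem_of_ordGE (hu.mono (by omega)) H.mem₁)
      (smul_mem_of_ordGE (hv.mono (by omega)) hy₀)) (H.le_of_norm₂ h2 hrK hs hk), ?_⟩
    rw [H.map_normForm h2 hN hk, add_comm r]
    refine (OrdGE.mul ?_ H.ord₁.ge).add (add_comm r 1 ▸ hr k hk)
    exact ((hu.sq.mono (by omega)).add ((hu.mul hw).mono (by omega))).add
      ((hρ.mul hw.sq).mono (by omega))

theorem binarySplitting_span_sup (hr : ∀ k ∈ K, OrdGE O (r + 2) (Q k))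
    (hs : ∀ k ∈ K, OrdGE O (s + 2) (Q k)) :
    BinarySplitting Q (Submodule.span O {π • x₁, π • (c • x₁ + x₂)} ⊔ K) K (r + 2) (s + 2)
      (π • x₁) (π • x₂) c where
  mem₁ := Submodule.mem_sup_left (Submodule.subset_span (by simp))
  mem₂ := by
    rw [smul_comm, ← smul_add]
    exact Submodule.mem_sup_left (Submodule.subset_span (by simp))
  le := le_sup_right
  polar₁₂ := by
    rw [QuadraticMap.polar_smul_left, QuadraticMap.polar_smul_right, H.polar₁₂ h2, smul_zero,
      smul_zero]
  polarK₁ k hk := by rw [QuadraticMap.polar_smul_left, H.polarK₁ h2 hk, smul_zero]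
  polarK₂ k hk := by rw [QuadraticMap.polar_smul_left, H.polarK₂ h2 hk, smul_zero]
  decomp y hy := by
    obtain ⟨u, v, k, hk, rfl⟩ := mem_span_pair_sup_iff.1 hy
    refine ⟨_, _, ordGE_algebraMap u, ordGE_algebraMap v, k, hk, ?_⟩
    rw [algebraMap_smul, algebraMap_smul, smul_comm c, ← smul_add]
  ord₁ := by simpa [map_smul_sq, add_comm r] using hπ.sq.mul H.ord₁
  ord₂ := by simpa [map_smul_sq, add_comm s] using hπ.sq.mul H.ord₂
  integral := by
    have hint := hN.integralPair hρ H.ord₁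
    refine ⟨hint.trace, ?_⟩
    rw [map_smul_sq, map_smul_sq]
    convert hπ.sq.ge.mul hint.norm using 1 <;> ring
  normK₁ := hr
  normK₂ := hs

end HeadPair

theorem HasGoodBONG.isLattice_of_unramified [CharP (IsLocalRing.ResidueField O) 2]
    (h : HasGoodBONG Q L (n + 2) a) (hR : HasOrders O (n + 2) a R) (hπ : OrdEq O 1 π)
    (he : OrdEq O e (2 : F)) (h12 : R 2 = R 1 - 2 * e) (hρ : OrdGE O 0 ρ)
    (hΔ : quadraticDefect O (1 - 4 * ρ) = Submodule.span O {(4 : F)})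
    (ht : a 1 * a 2 = -(1 - 4 * ρ) * t ^ 2) (h3 : 1 ≤ n → R 1 + 2 ≤ R 3)
    (ha₁ : a' 1 = π ^ 2 * a 1) (ha₂ : a' 2 = π ^ 2 * a 2) (ha' : ∀ i, 3 ≤ i → a' i = a i) :
    IsLatticeWithGoodBONG O Q (nonNormGenerators Q L) (n + 2) a' := by
  have h2 := he.ne_zero
  have he1 := one_le_of_ordEq_two he
  obtain ⟨x₁, x₂, L₂, K, H, hQ₁, hQ₂, -, hK⟩ := h.exists_headPair hR
  have hr := hR.ordGE_third hK h3
  have hs : ∀ k ∈ K, OrdGE O (R 2 + 2) (Q k) := fun k hk => (hr k hk).mono (by omega)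
  obtain ⟨c, hN⟩ := exists_isNormForm he H.ord₁ (h12 ▸ H.ord₂) hρ
    (by rw [hQ₁, hQ₂, ht] : Q x₁ * Q x₂ = -(1 - 4 * ρ) * t ^ 2)
  refine ⟨_, (H.nonNormGenerators_eq_span_sup h2 hπ hρ hN
    (not_ordGE_one_of_quadraticDefect h2 hΔ) (fun k hk => (hr k hk).mono (by omega))
    (fun k hk => (hs k hk).mono (by omega))).symm,
    (H.binarySplitting_span_sup h2 hπ hρ hN hr hs).hasGoodBONG h2 (by rw [map_smul_sq, hQ₁, ha₁])
      (by rw [map_smul_sq, hQ₂, ha₂])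
      (hK.congr fun i hi _ => (ha' (i + 2) (by omega)).symm) (fun hn => ?_) (fun hn => ?_)⟩
  · rw [ha' 3 le_rfl]
    exact (hR 3 (by omega) (by omega)).ge.mono (h3 hn)
  · rw [ha' 4 (by omega)]
    have h34 : R 3 - 2 * e ≤ R 4 := h.sub_two_mul_le hR he (i := 3) (by omega) (by omega)
    have := h3 (by omega)
    exact (hR 4 (by omega) (by omega)).ge.mono (by omega)

end Unramified

end UnimodularPlanes

section MaximalPlanes

variable {O F V : Type*} [CommRing O] [IsDomain O] [IsDiscreteValuationRing O]
  [Field F] [Algebra O F] [IsFractionRing O F]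
  [AddCommGroup V] [Module F V] [Module O V] [IsScalarTower O F V]
  {Q : QuadraticForm F V} {L K L₂ : Submodule O V} {e r s : ℤ} {π η b c : F}
  {x₁ x₂ w₁ w₂ y k : V} {n : ℕ} {a a' : ℕ → F} {R : ℕ → ℤ}

/-- `w₁, w₂` is the image of the orthogonal basis `x₁, x₂` of a plane under a similitude of ratio
`c` of that plane. -/
structure SimilarPair (Q : QuadraticForm F V) (c : F) (x₁ x₂ w₁ w₂ : V) : Prop where
  map₁ : Q w₁ = c * Q x₁
  map₂ : Q w₂ = c * Q x₂
  polar : polar Q w₁ w₂ = 0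
  span_eq : Submodule.span F {w₁, w₂} = Submodule.span F {x₁, x₂}

omit [IsScalarTower O F V] in
/- If `c p = α² p + β² q`, the multiplication by `α + β √(-q/p)` is a similitude of ratio `c`. -/
theorem exists_similarPair (h₁₂ : polar Q x₁ x₂ = 0) (h₁ : Q x₁ ≠ 0) (hc : c ≠ 0)
    (han : ∀ t : F, Q x₂ ≠ -(t ^ 2 * Q x₁)) (hsymb : hilbertSymbol c (-(Q x₁ * Q x₂)) = 1) :
    ∃ w₁ w₂, SimilarPair Q c x₁ x₂ w₁ w₂ := by
  obtain ⟨α, β, h⟩ := exists_eq_mul_of_hilbertSymbol h₁ han hsymb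
  have h' : α ^ 2 + β ^ 2 * (Q x₂ / Q x₁) = c := by
    field_simp
    linear_combination h
  have hmap (u v : F) : Q (u • x₁ + v • x₂) = u ^ 2 * Q x₁ + v ^ 2 * Q x₂ := by
    rw [map_smul_add_of_polar_eq_zero, map_smul_sq]
    rw [QuadraticMap.polar_smul_right, h₁₂, smul_zero]
  refine ⟨α • x₁ + β • x₂, (-(β * (Q x₂ / Q x₁))) • x₁ + α • x₂, by rw [hmap, h], ?_, ?_,
    le_antisymm (Submodule.span_le.2 (Set.pair_subset ?_ ?_))
      (Submodule.span_le.2 (Set.pair_subset ?_ ?_))⟩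
  · rw [hmap, ← h']
    field_simp
    ring
  · simp only [QuadraticMap.polar_add_right, QuadraticMap.polar_add_left,
      QuadraticMap.polar_smul_left, QuadraticMap.polar_smul_right, smul_eq_mul,
      QuadraticMap.polar_comm Q x₂ x₁, h₁₂, polar_self_mul]
    field_simp
    ring
  · exact Submodule.mem_span_pair.2 ⟨_, _, rfl⟩
  · exact Submodule.mem_span_pair.2 ⟨_, _, rfl⟩
  · refine Submodule.mem_span_pair.2 ⟨α / c, -(β / c), ?_⟩
    match_scalars
    · field_simp
      linear_combination h
    · ring
  · refine Submodule.mem_span_pair.2 ⟨β * (Q x₂ / Q x₁) / c, α / c, ?_⟩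
    match_scalars
    · ring
    · field_simp
      linear_combination h

omit [IsScalarTower O F V] in
theorem SimilarPair.map_smul_add_smul (S : SimilarPair Q c x₁ x₂ w₁ w₂) (α β : F) :
    Q (α • w₁ + β • w₂) = c * (α ^ 2 * Q x₁ + β ^ 2 * Q x₂) := by
  rw [map_smul_add_of_polar_eq_zero, map_smul_sq, S.map₁, S.map₂]
  · ring
  · rw [QuadraticMap.polar_smul_right, S.polar, smul_zero]

theorem HeadPair.polar_of_mem_span (H : HeadPair Q L r s x₁ x₂ L₂ K) (h2 : (2 : F) ≠ 0)
    (hy : y ∈ Submodule.span F {x₁, x₂}) (hk : k ∈ K) : polar Q y k = 0 := by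
  obtain ⟨α, β, rfl⟩ := Submodule.mem_span_pair.1 hy
  rw [QuadraticMap.polar_add_left, QuadraticMap.polar_smul_left, QuadraticMap.polar_smul_left,
    H.polarK₁ h2 hk, H.polarK₂ h2 hk, smul_zero, smul_zero, add_zero]

theorem BinaryMaximal.add_two_mul_lt_third [PerfectField (IsLocalRing.ResidueField O)]
    [CharP (IsLocalRing.ResidueField O) 2] [HenselianRing O (IsLocalRing.maximalIdeal O)]
    (hmax : BinaryMaximal O (a 1) (a 2) (R 1)) (hR : HasOrders O (n + 3) a R) (hπ : OrdEq O 1 π)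
    (he : OrdEq O e (2 : F)) (h12 : R 1 - 2 * e < R 2) (hB : PropertyB O e (n + 3) a R) :
    R 2 + 2 * e < R 3 := by
  have h₁ := hR 1 le_rfl (by omega)
  have h₂ := hR 2 one_le_two (by omega)
  obtain ⟨α, β, -, hαβ⟩ := hmax.exists_ordEq_succ hπ he h₁ h₂ h12
  have hint := IntegralPair.of_anisotropic h₁ he.ne_zero (hmax.ne_neg_sq he h₁ h₂ h12)
    (hαβ.ge.mono (by omega))
  have hgap : R 3 - R 2 > 2 * e := by
    refine (hB.2 1 le_rfl (by omega) ?_).2 (by omega)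
    rcases Int.even_or_odd (R 2 - R 1) with heven | ⟨i, hi⟩
    · exact Or.inr ⟨heven, hmax.relDefect_le he h₁ h₂ h12 heven hint.trace hαβ⟩
    · refine Or.inl ⟨⟨i, hi⟩, ?_⟩
      have hz := ordEq_uniformizer_zpow hπ (-i)
      have hint : IntegralPair O (a 1) (a 2) (R 1) 0 (π ^ (-i)) :=
        ⟨by simpa using OrdGE.zero (O := O) (F := F) 0,
          by simpa using (hz.sq.mul h₂).ge.mono (by omega : R 1 ≤ _)⟩
      have := hz.le_of_ge (hmax hint)
      change R 2 - R 1 ≤ 2 * e + 1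
      omega
  omega

namespace HeadPair

variable [HenselianRing O (IsLocalRing.maximalIdeal O)] (H : HeadPair Q L r s x₁ x₂ L₂ K)
  (h2 : (2 : F) ≠ 0) (hmax : BinaryMaximal O (Q x₁) (Q x₂) r)
  (han : ∀ t : F, Q x₂ ≠ -(t ^ 2 * Q x₁))

include H h2 hmax han

theorem mem_of_binaryMaximal (hy : y ∈ Submodule.span F {x₁, x₂}) (hQ : OrdGE O r (Q y)) :
    y ∈ L := by
  obtain ⟨b, hb⟩ := H.exists_lift₂
  obtain ⟨α, β, rfl⟩ := Submodule.mem_span_pair.1 hy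
  have hint := IntegralPair.of_anisotropic H.ord₁ h2 han (H.map_pair h2 ▸ hQ)
  exact H.pair_mem hb (hmax hint)
    (hint.ordGE_sub_mul (H.integralPair_lift h2 hb) (hmax hint) H.ord₁)

theorem binarySplitting_sublatticeOrdGE (S : SimilarPair Q c x₁ x₂ w₁ w₂) (hc : OrdEq O 1 c)
    (hb : b • x₁ + x₂ ∈ L) (hr : ∀ k ∈ K, OrdGE O (r + 1) (Q k))
    (hs : ∀ k ∈ K, OrdGE O (s + 1) (Q k))
    (hpol : ∀ x ∈ L, ∀ y ∈ L, OrdGE O (r + 1) (polar Q x y)) :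
    BinarySplitting Q (sublatticeOrdGE Q L (r + 1) hpol) K (r + 1) (s + 1) w₁ w₂ b := by
  have hint := H.integralPair_lift h2 hb
  have hrK : ∀ k ∈ K, OrdGE O r (Q k) := fun k hk => (hr k hk).mono (by omega)
  have hsK : ∀ k ∈ K, OrdGE O s (Q k) := fun k hk => (hs k hk).mono (by omega)
  have hspan {α β : F} : α • w₁ + β • w₂ ∈ Submodule.span F {x₁, x₂} :=
    S.span_eq ▸ Submodule.mem_span_pair.2 ⟨α, β, rfl⟩
  have hw₁ : w₁ ∈ Submodule.span F {x₁, x₂} := S.span_eq ▸ Submodule.subset_span (by simp)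
  have hw₂ : w₂ ∈ Submodule.span F {x₁, x₂} := S.span_eq ▸ Submodule.subset_span (by simp)
  have ho₁ : OrdEq O (r + 1) (Q w₁) := by simpa [S.map₁, add_comm] using hc.mul H.ord₁
  have ho₂ : OrdEq O (s + 1) (Q w₂) := by simpa [S.map₂, add_comm] using hc.mul H.ord₂
  have hnorm : OrdGE O (r + 1) (b ^ 2 * Q w₁ + 1 ^ 2 * Q w₂) := by
    rw [S.map₁, S.map₂]
    convert hc.ge.mul hint.norm using 1 <;> ring
  have hmem {z : V} (hz : z ∈ Submodule.span F {x₁, x₂}) (hQ : OrdGE O (r + 1) (Q z)) :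
      z ∈ sublatticeOrdGE Q L (r + 1) hpol :=
    ⟨H.mem_of_binaryMaximal h2 hmax han hz (hQ.mono (by omega)), hQ⟩
  refine ⟨hmem hw₁ ho₁.ge, ?_, fun k hk => ⟨H.le_of_norm₂ h2 hrK hsK hk, hr k hk⟩, S.polar,
    fun k hk => H.polar_of_mem_span h2 hw₁ hk, fun k hk => H.polar_of_mem_span h2 hw₂ hk, ?_,
    ho₁, ho₂, ⟨hint.trace, hnorm⟩, hr, hs⟩
  · rw [← one_smul F w₂]
    refine hmem hspan ?_
    rwa [S.map_smul_add_smul, mul_add, mul_left_comm, mul_left_comm c, ← S.map₁, ← S.map₂]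
  · rintro y ⟨hy, hyQ⟩
    obtain ⟨u, v, -, -, k, hk, rfl⟩ := H.exists_integral_decomp h2 hrK hsK hb hy
    have hz : u • x₁ + v • (b • x₁ + x₂) ∈ Submodule.span F {x₁, x₂} :=
      Submodule.mem_span_pair.2 ⟨u + v * b, v, by module⟩
    have hzQ := hyQ.sub (hr k hk)
    rw [QuadraticMap.map_add Q, H.polar_of_mem_span h2 hz hk, add_zero, add_sub_cancel_right] at hzQ
    obtain ⟨α, β, hαβ⟩ := Submodule.mem_span_pair.1 (S.span_eq ▸ hz)
    rw [← hαβ, S.map_smul_add_smul] at hzQ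
    have hi := IntegralPair.of_anisotropic H.ord₁ h2 han (hzQ.of_mul_left hc (by omega))
    exact ⟨_, β, hi.ordGE_sub_mul hint (hmax hi) H.ord₁, hmax hi, k, hk, by rw [← hαβ]; module⟩

end HeadPair

section Perfect

variable [PerfectField (IsLocalRing.ResidueField O)] [CharP (IsLocalRing.ResidueField O) 2]
  [HenselianRing O (IsLocalRing.maximalIdeal O)]

theorem HasGoodBONG.not_binaryMaximal_of_reflectionParity (h : HasGoodBONG Q L (n + 2) a)
    (hR : HasOrders O (n + 2) a R) (hπ : OrdEq O 1 π) (he : OrdEq O e (2 : F))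
    (h12 : R 1 - 2 * e < R 2) (hpar : ReflectionParity Q L (R 1)) :
    ¬ BinaryMaximal O (a 1) (a 2) (R 1) := by
  intro hmax
  have h2 := he.ne_zero
  obtain ⟨x₁, x₂, L₂, K, H, hQ₁, hQ₂, -, -⟩ := h.exists_headPair hR
  rw [← hQ₁, ← hQ₂] at hmax
  obtain ⟨α, β, -, hαβ⟩ := hmax.exists_ordEq_succ hπ he H.ord₁ H.ord₂ h12
  rw [← H.map_pair h2] at hαβ
  exact hpar.not_ordEq_succ (h.ordGE_polar_succ he (one_le_of_ordEq_two he) hR fun _ => h12) _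
    (H.mem_of_binaryMaximal h2 hmax (hmax.ne_neg_sq he H.ord₁ H.ord₂ h12)
      (Submodule.mem_span_pair.2 ⟨α, β, rfl⟩) (hαβ.ge.mono (by omega))) hαβ

theorem HasGoodBONG.isLattice_of_binaryMaximal (h : HasGoodBONG Q L (n + 2) a)
    (hR : HasOrders O (n + 2) a R) (hπ : OrdEq O 1 π) (he : OrdEq O e (2 : F))
    (h12 : R 1 - 2 * e < R 2) (hB : PropertyB O e (n + 2) a R)
    (hmax : BinaryMaximal O (a 1) (a 2) (R 1)) (hη : OrdEq O 0 η)
    (hsymb : hilbertSymbol (π * η) (-(a 1 * a 2)) = 1) (ha₁ : a' 1 = π * η * a 1)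
    (ha₂ : a' 2 = π * η * a 2) (ha' : ∀ i, 3 ≤ i → a' i = a i) :
    IsLatticeWithGoodBONG O Q (nonNormGenerators Q L) (n + 2) a' := by
  have h2 := he.ne_zero
  have h13 : 1 ≤ n → R 1 + 1 ≤ R 3 ∧ R 2 + 1 ≤ R 3 := fun hn => by
    obtain ⟨m, rfl⟩ := Nat.exists_eq_add_of_le' hn
    have := hmax.add_two_mul_lt_third (n := m) hR hπ he h12 hB
    have := one_le_of_ordEq_two he
    omega
  obtain ⟨x₁, x₂, L₂, K, H, hQ₁, hQ₂, -, hK⟩ := h.exists_headPair hR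
  rw [← hQ₁, ← hQ₂] at hmax hsymb
  have han := hmax.ne_neg_sq he H.ord₁ H.ord₂ h12
  have hπη : OrdEq O 1 (π * η) := by simpa using hπ.mul hη
  obtain ⟨w₁, w₂, S⟩ := exists_similarPair (H.polar₁₂ h2) H.ord₁.ne_zero hπη.ne_zero han hsymb
  obtain ⟨b, hb⟩ := H.exists_lift₂
  have hpol := h.ordGE_polar_succ he (one_le_of_ordEq_two he) hR fun _ => h12
  refine ⟨sublatticeOrdGE Q L (R 1 + 1) hpol, H.nonNormGenerators_eq.symm,
    (H.binarySplitting_sublatticeOrdGE h2 hmax han S hπη hb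
      (hR.ordGE_third hK fun hn => (h13 hn).1)
      (hR.ordGE_third hK fun hn => (h13 hn).2) hpol).hasGoodBONG h2 (by rw [S.map₁, hQ₁, ha₁])
    (by rw [S.map₂, hQ₂, ha₂]) (hK.congr fun i hi _ => (ha' (i + 2) (by omega)).symm)
    (fun hn => ?_) (fun hn => ?_)⟩
  · rw [ha' 3 le_rfl]
    exact (hR 3 (by omega) (by omega)).ge.mono (h13 hn).1
  · have : R 2 < R 4 := hB.1 2 one_le_two (by omega)
    rw [ha' 4 (by omega)]
    exact (hR 4 (by omega) (by omega)).ge.mono (by omega)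

end Perfect

end MaximalPlanes

section HyperbolicSplittings

variable {O F V : Type*} [CommRing O] [IsDomain O] [IsDiscreteValuationRing O]
  [Field F] [Algebra O F] [IsFractionRing O F]
  [AddCommGroup V] [Module F V] [Module O V]
  {Q : QuadraticForm F V} {L J : Submodule O V} {c κ u v : F} {e j r : ℤ} {n : ℕ}
  {a b : ℕ → F} {S : ℕ → ℤ} {y g t w : V}

/-- `L` is the orthogonal sum of the lattice with the isotropic basis `y, g` and of `J`. -/
structure HyperbolicSplitting (Q : QuadraticForm F V) (L J : Submodule O V) (y g : V) : Prop where
  mem_left : y ∈ L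
  mem_right : g ∈ L
  le : J ≤ L
  map_left : Q y = 0
  map_right : Q g = 0
  polar_left : ∀ w ∈ J, polar Q y w = 0
  polar_right : ∀ w ∈ J, polar Q g w = 0
  exists_decomp : ∀ x ∈ L, ∃ u v : F, OrdGE O 0 u ∧ OrdGE O 0 v ∧ ∃ w ∈ J, x = u • y + v • g + w

/-- On the complement of the hyperbolic plane with the isotropic basis `y, g` this is the Eichler
transformation fixing `y` that moves this complement to the complement of `y, t - g`. -/
noncomputable def eichlerMap (Q : QuadraticForm F V) (y g t : V) : V →ₗ[F] V :=
  LinearMap.id + ((polar Q y g)⁻¹ • Q.polarBilin t).smulRight y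

theorem eichlerMap_apply : eichlerMap Q y g t w = w + ((polar Q y g)⁻¹ * polar Q t w) • y := by
  simp [eichlerMap]

theorem map_eichlerMap (hy : Q y = 0) (hw : polar Q y w = 0) : Q (eichlerMap Q y g t w) = Q w := by
  rw [eichlerMap_apply, add_comm, map_smul_add, hy, hw]
  ring

namespace HyperbolicSplitting

variable (H : HyperbolicSplitting Q L J y g)

include H

theorem map_eq (u v : F) (hw : w ∈ J) : Q (u • y + v • g + w) = u * v * polar Q y g + Q w := by
  rw [show u • y + v • g + w = u • y + (v • g + w) by module, map_smul_add, map_smul_add,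
    QuadraticMap.polar_add_right, QuadraticMap.polar_smul_right, H.map_left, H.map_right,
    H.polar_left w hw, H.polar_right w hw, smul_eq_mul]
  ring

theorem smul [IsScalarTower O F V] (hc : OrdEq O 0 c) : HyperbolicSplitting Q L J (c • y) g where
  mem_left := smul_mem_of_ordGE hc.ge H.mem_left
  mem_right := H.mem_right
  le := H.le
  map_left := by rw [map_smul_sq, H.map_left, mul_zero]
  map_right := H.map_right
  polar_left w hw := by rw [QuadraticMap.polar_smul_left, H.polar_left w hw, smul_zero]
  polar_right := H.polar_right
  exists_decomp x hx := by
    obtain ⟨u, v, hu, hv, w, hw, rfl⟩ := H.exists_decomp x hx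
    refine ⟨u / c, v, (hu.div hc).mono (by omega), hv, w, hw, ?_⟩
    rw [smul_smul, div_mul_cancel₀ _ hc.ne_zero]

theorem reflectionParity (hpar : ReflectionParity Q L r) : ReflectionParity Q J r := by
  intro x hx k hk hpol
  refine hpar x (H.le hx) k hk fun z hz => ?_
  obtain ⟨u, v, -, -, w, hw, rfl⟩ := H.exists_decomp z hz
  rw [QuadraticMap.polar_add_right, QuadraticMap.polar_add_right, QuadraticMap.polar_smul_right,
    QuadraticMap.polar_smul_right, QuadraticMap.polar_comm Q x y, QuadraticMap.polar_comm Q x g,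
    H.polar_left x hx, H.polar_right x hx, smul_zero, smul_zero, zero_add, zero_add]
  exact hpol w hw

variable (ht : t ∈ J)

include ht

theorem map_sub_right : Q (t - g) = Q t := by
  rw [show t - g = (-1 : F) • g + t by module, map_smul_add, H.map_right, H.polar_right t ht]
  ring

theorem polar_sub_right : polar Q y (t - g) = -polar Q y g := by
  rw [QuadraticMap.polar_sub_right, H.polar_left t ht, zero_sub]

variable (hyg : polar Q y g = -(2 * κ * Q t))

include hyg

theorem polar_sub_right_sub_smul : polar Q (t - g) (y - κ • (t - g)) = 0 := by
  rw [QuadraticMap.polar_sub_right, QuadraticMap.polar_smul_right, polar_self_mul,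
    H.map_sub_right ht, QuadraticMap.polar_comm Q (t - g) y, H.polar_sub_right ht, hyg, smul_eq_mul]
  ring

theorem map_left_sub_smul : Q (y - κ • (t - g)) = -(κ ^ 2 * Q t) := by
  rw [show y - κ • (t - g) = (-κ) • (t - g) + y by module, map_smul_add, H.map_left,
    H.map_sub_right ht, QuadraticMap.polar_comm, H.polar_sub_right ht, hyg]
  ring

variable (h0 : polar Q y g ≠ 0)

include h0

omit hyg in
theorem polar_sub_right_eichlerMap (hw : w ∈ J) : polar Q (t - g) (eichlerMap Q y g t w) = 0 := by
  rw [eichlerMap_apply, QuadraticMap.polar_add_right, QuadraticMap.polar_smul_right,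
    QuadraticMap.polar_comm Q (t - g) y, H.polar_sub_right ht, QuadraticMap.polar_sub_left,
    H.polar_right w hw, smul_eq_mul]
  field_simp
  ring

omit hyg in
theorem polar_left_sub_smul_eichlerMap (hw : w ∈ J) :
    polar Q (y - κ • (t - g)) (eichlerMap Q y g t w) = 0 := by
  rw [QuadraticMap.polar_sub_left, QuadraticMap.polar_smul_left,
    H.polar_sub_right_eichlerMap ht h0 hw, eichlerMap_apply, QuadraticMap.polar_add_right,
    QuadraticMap.polar_smul_right, polar_self_mul, H.map_left, H.polar_left w hw]
  simp

variable (h2 : (2 : F) ≠ 0)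

include h2

theorem projPerp_eq (hw : w ∈ J) : projPerp Q (t - g) (u • y + v • g + w) =
    (u - (polar Q y g)⁻¹ * polar Q t (w + v • t)) • (y - κ • (t - g)) +
      eichlerMap Q y g t (w + v • t) := by
  have hQt : Q t ≠ 0 := by
    rintro hQt
    simp [hQt, hyg] at h0
  set γ := u - (polar Q y g)⁻¹ * polar Q t (w + v • t) with hγ
  have hdecomp : u • y + v • g + w = (γ * κ - v) • (t - g) +
      (γ • (y - κ • (t - g)) + eichlerMap Q y g t (w + v • t)) := by
    rw [eichlerMap_apply, hγ]
    module
  rw [hdecomp, projPerp_smul_add h2 (H.map_sub_right ht ▸ hQt)]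
  rw [QuadraticMap.polar_add_right, QuadraticMap.polar_smul_right,
    H.polar_sub_right_sub_smul ht hyg, map_add, map_smul, QuadraticMap.polar_add_right,
    QuadraticMap.polar_smul_right, H.polar_sub_right_eichlerMap ht h0 hw,
    H.polar_sub_right_eichlerMap ht h0 ht, smul_zero, smul_zero, add_zero, add_zero]

theorem map_smul_add_eichlerMap (hw : w ∈ J) :
    Q ((u - (polar Q y g)⁻¹ * polar Q t w) • (y - κ • (t - g)) + eichlerMap Q y g t w) =
      u ^ 2 * -(κ ^ 2 * Q t) - u * κ * polar Q t w + Q (projPerp Q t w) := by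
  have hκ : κ ≠ 0 := by
    rintro rfl
    simp [hyg] at h0
  have hQt : Q t ≠ 0 := by
    rintro hQt
    simp [hQt, hyg] at h0
  rw [map_smul_add_of_polar_eq_zero Q _ (H.polar_left_sub_smul_eichlerMap ht h0 hw),
    H.map_left_sub_smul ht hyg, map_eichlerMap H.map_left (H.polar_left w hw), hyg,
    projPerp_apply, sub_eq_add_neg w, ← neg_smul, add_comm w, map_smul_add]
  field_simp
  ring

variable [IsScalarTower O F V]

theorem mem_projLattice {z : V} : z ∈ projLattice Q L (t - g) ↔ ∃ u : F, OrdGE O 0 u ∧ ∃ w ∈ J,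
    z = (u - (polar Q y g)⁻¹ * polar Q t w) • (y - κ • (t - g)) + eichlerMap Q y g t w := by
  rw [DyadicLattice.mem_projLattice]
  constructor
  · rintro ⟨x, hx, rfl⟩
    obtain ⟨u, v, hu, hv, w, hw, rfl⟩ := H.exists_decomp x hx
    exact ⟨u, hu, w + v • t, J.add_mem hw (smul_mem_of_ordGE hv ht),
      H.projPerp_eq ht hyg h0 h2 hw⟩
  · rintro ⟨u, hu, w, hw, rfl⟩
    refine ⟨u • y + w, L.add_mem (smul_mem_of_ordGE hu H.mem_left) (H.le hw), ?_⟩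
    simpa using H.projPerp_eq (u := u) (v := 0) ht hyg h0 h2 hw

theorem projLattice_projLattice :
    projLattice Q (projLattice Q L (t - g)) (y - κ • (t - g)) =
      J.map ((eichlerMap Q y g t).restrictScalars O) := by
  have hQ : Q (y - κ • (t - g)) ≠ 0 := by
    rw [H.map_left_sub_smul ht hyg]
    rintro hQ
    rw [neg_eq_zero, mul_eq_zero, sq_eq_zero_iff] at hQ
    rcases hQ with hQ | hQ <;> simp [hQ, hyg] at h0
  have hproj (γ : F) {w : V} (hw : w ∈ J) : projPerp Q (y - κ • (t - g))
      (γ • (y - κ • (t - g)) + eichlerMap Q y g t w) = eichlerMap Q y g t w :=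
    projPerp_smul_add h2 hQ (H.polar_left_sub_smul_eichlerMap ht h0 hw) γ
  ext z
  rw [DyadicLattice.mem_projLattice, Submodule.mem_map]
  constructor
  · rintro ⟨x, hx, rfl⟩
    obtain ⟨u, -, w, hw, rfl⟩ := (H.mem_projLattice ht hyg h0 h2).1 hx
    exact ⟨w, hw, (hproj _ hw).symm⟩
  · rintro ⟨w, hw, rfl⟩
    exact ⟨_, (H.mem_projLattice ht hyg h0 h2).2 ⟨0, OrdGE.zero 0, w, hw, rfl⟩, hproj _ hw⟩

omit ht hyg h0 h2 in
/- The vectors `t - g` and `y - κ (t - g)`, where `t` is the first vector of the BONG of `J`, begin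
a BONG of `L`, whose rest is the image of that of `J` under an Eichler transformation. -/
theorem hasGoodBONG (he : OrdEq O e (2 : F)) (hJ : HasGoodBONG Q J (n + 1) b)
    (hS : HasOrders O (n + 1) b S) (hκ : OrdEq O j κ) (hj : -e ≤ j) (hj' : j ≤ e)
    (hyg : polar Q y g = -(2 * κ * b 1)) (hS2 : 1 ≤ n → S 1 + 2 * j ≤ S 2)
    (ha1 : a 1 = b 1) (ha2 : a 2 = -(κ ^ 2 * b 1)) (ha : ∀ i, 1 ≤ i → i ≤ n + 1 → a (i + 2) = b i) :
    HasGoodBONG Q L (n + 3) a := by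
  have h2 := he.ne_zero
  obtain ⟨t, ht, hQt, hot, hnorm, -, hJ2⟩ := hJ.exists_first hS
  rw [← hQt] at hyg ha1 ha2
  have hoyg : OrdEq O (e + j + S 1) (polar Q y g) := hyg ▸ ((he.mul hκ).mul hot).neg
  have h0 := hoyg.ne_zero
  have ho₂ : OrdEq O (S 1 + 2 * j) (-(κ ^ 2 * Q t)) := add_comm (S 1) _ ▸ (hκ.sq.mul hot).neg
  have hnorm₁ : ∀ x ∈ L, OrdGE O (S 1) (Q x) := fun x hx => by
    obtain ⟨u, v, hu, hv, w, hw, rfl⟩ := H.exists_decomp x hx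
    rw [H.map_eq u v hw]
    exact (((hu.mul hv).mul hoyg.ge).mono (by omega)).add (hnorm w hw)
  have hnorm₂ : ∀ z ∈ projLattice Q L (t - g), OrdGE O (S 1 + 2 * j) (Q z) := fun z hz => by
    obtain ⟨u, hu, w, hw, rfl⟩ := (H.mem_projLattice ht hyg h0 h2).1 hz
    have htw : OrdGE O (S 1 + j) (polar Q t w) :=
      hJ.ordGE_polar_of_le he _ hS _ (fun _ => by omega)
        (fun hn => by have := hS2 (by omega); omega) t ht w hw
    rw [H.map_smul_add_eichlerMap ht hyg h0 h2 hw]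
    exact (((hu.sq.mul ho₂.ge).mono (by omega)).sub
      (((hu.mul hκ.ge).mul htw).mono (by omega))).add
      (hJ2.ordGE (fun hn => ⟨hS 2 (by omega) (by omega), hS2 hn⟩) _
        (DyadicLattice.mem_projLattice.2 ⟨w, hw, rfl⟩))
  have hx₂ : y - κ • (t - g) ∈ projLattice Q L (t - g) :=
    (H.mem_projLattice ht hyg h0 h2).2 ⟨1, ordEq_one.ge, 0, J.zero_mem, by simp⟩
  refine hasGoodBONG_succ (n := n + 2) (L.sub_mem (H.le ht) H.mem_right)
    ((H.map_sub_right ht).trans ha1.symm) (ha1 ▸ hot) hnorm₁ ?_ fun _ => ?_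
  · refine hasGoodBONG_succ (n := n + 1) hx₂ ((H.map_left_sub_smul ht hyg).trans ha2.symm)
      (ha2 ▸ ho₂) hnorm₂ ?_ fun hn => ?_
    · rw [H.projLattice_projLattice ht hyg h0 h2]
      exact (hJ.map (W := LinearMap.ker (Q.polarBilin y)) (fun w hw => map_eichlerMap H.map_left hw)
        H.polar_left).congr fun i hi hin => (ha i hi hin).symm
    · rw [ha 2 one_le_two (by omega)]
      exact (hS 2 one_le_two (by omega)).ge.mono (hS2 (by omega))
  · rw [ha 1 le_rfl (by omega), ← hQt]
    exact hot.ge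

end HyperbolicSplitting

end HyperbolicSplittings

section HyperbolicProjections

variable {F V : Type*} [Field F] [AddCommGroup V] [Module F V] {Q : QuadraticForm F V}

/-- The orthogonal projection to the complement of the hyperbolic plane with the isotropic basis
`y, g`. -/
noncomputable def hyperbolicProj (Q : QuadraticForm F V) (y g : V) : V →ₗ[F] V :=
  LinearMap.id - ((polar Q y g)⁻¹ • Q.polarBilin g).smulRight y -
    ((polar Q y g)⁻¹ • Q.polarBilin y).smulRight g

theorem hyperbolicProj_apply (y g x : V) : hyperbolicProj Q y g x =
    x - ((polar Q y g)⁻¹ * polar Q g x) • y - ((polar Q y g)⁻¹ * polar Q y x) • g := by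
  simp [hyperbolicProj]

variable {y g x z : V}

theorem hyperbolicProj_eq_self (hy : polar Q y x = 0) (hg : polar Q g x = 0) :
    hyperbolicProj Q y g x = x := by
  simp [hyperbolicProj_apply, hy, hg]

theorem polar_hyperbolicProj_of_orthogonal (hy : polar Q y z = 0) (hg : polar Q g z = 0)
    (x : V) : polar Q (hyperbolicProj Q y g x) z = polar Q x z := by
  simp [hyperbolicProj_apply, QuadraticMap.polar_sub_left, QuadraticMap.polar_smul_left, hy, hg]

variable (hy : Q y = 0) (hg : Q g = 0) (h : polar Q y g ≠ 0)

section

include hy h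

theorem hyperbolicProj_left : hyperbolicProj Q y g y = 0 := by
  simp [hyperbolicProj_apply, QuadraticMap.polar_comm Q g y, hy, h]

theorem polar_left_hyperbolicProj (x : V) : polar Q y (hyperbolicProj Q y g x) = 0 := by
  simp only [hyperbolicProj_apply, QuadraticMap.polar_sub_right, QuadraticMap.polar_smul_right,
    polar_self_mul, hy, smul_eq_mul]
  field_simp
  ring

end

section

include hg h

theorem hyperbolicProj_right : hyperbolicProj Q y g g = 0 := by
  simp [hyperbolicProj_apply, hg, h]

theorem polar_right_hyperbolicProj (x : V) : polar Q g (hyperbolicProj Q y g x) = 0 := by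
  simp only [hyperbolicProj_apply, QuadraticMap.polar_sub_right, QuadraticMap.polar_smul_right,
    polar_self_mul, hg, QuadraticMap.polar_comm Q g y, smul_eq_mul]
  field_simp
  ring

end

include hy hg h

theorem map_hyperbolicProj (x : V) : Q (hyperbolicProj Q y g x) =
    Q x - polar Q y x * polar Q g x / polar Q y g := by
  rw [hyperbolicProj_apply, show x - ((polar Q y g)⁻¹ * polar Q g x) • y -
      ((polar Q y g)⁻¹ * polar Q y x) • g = (-((polar Q y g)⁻¹ * polar Q g x)) • y +
      ((-((polar Q y g)⁻¹ * polar Q y x)) • g + x) by module, map_smul_add, map_smul_add,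
    QuadraticMap.polar_add_right, QuadraticMap.polar_smul_right, hy, hg, smul_eq_mul]
  field_simp
  ring

theorem hyperbolicProj_mem_span_of_mem_span (hx : x ∈ Submodule.span F {y, g, z}) :
    hyperbolicProj Q y g x ∈ Submodule.span F {hyperbolicProj Q y g z} := by
  obtain ⟨α, β, γ, rfl⟩ := Submodule.mem_span_triple.1 hx
  rw [map_add, map_add, map_smul, map_smul, map_smul, hyperbolicProj_left hy h,
    hyperbolicProj_right hg h, smul_zero, smul_zero, zero_add, zero_add]
  exact Submodule.smul_mem _ _ (Submodule.mem_span_singleton_self _)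

omit hy hg h

section Triples

variable {u₁ u₂ u₃ : V} (p₁₂ : polar Q u₁ u₂ = 0) (p₁₃ : polar Q u₁ u₃ = 0)
  (p₂₃ : polar Q u₂ u₃ = 0)

include p₁₂ p₁₃ p₂₃

theorem map_smul_add_smul_add_smul (α β γ : F) :
    Q (α • u₁ + β • u₂ + γ • u₃) = α ^ 2 * Q u₁ + β ^ 2 * Q u₂ + γ ^ 2 * Q u₃ := by
  rw [QuadraticMap.map_add Q, QuadraticMap.map_add Q, map_smul_sq, map_smul_sq, map_smul_sq]
  simp only [QuadraticMap.polar_add_left, QuadraticMap.polar_smul_left,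
    QuadraticMap.polar_smul_right, p₁₂, p₁₃, p₂₃, smul_zero, add_zero]

theorem polar_smul_add_smul_add_smul (α β γ α' β' γ' : F) :
    polar Q (α • u₁ + β • u₂ + γ • u₃) (α' • u₁ + β' • u₂ + γ' • u₃) =
      2 * (α * α' * Q u₁ + β * β' * Q u₂ + γ * γ' * Q u₃) := by
  simp only [QuadraticMap.polar_add_left, QuadraticMap.polar_add_right,
    QuadraticMap.polar_smul_left, QuadraticMap.polar_smul_right, p₁₂, p₁₃, p₂₃,
    QuadraticMap.polar_comm Q u₂ u₁, QuadraticMap.polar_comm Q u₃ u₁,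
    QuadraticMap.polar_comm Q u₃ u₂, polar_self_mul, smul_eq_mul]
  ring

/- Both sides are minus the determinant of the Gram matrix of `y, g, u₃`, up to the factor two. -/
theorem map_hyperbolicProj_mul_polar_sq {α β γ α' β' γ' : F}
    (hy : Q (α • u₁ + β • u₂ + γ • u₃) = 0) (hg : Q (α' • u₁ + β' • u₂ + γ' • u₃) = 0)
    (h : polar Q (α • u₁ + β • u₂ + γ • u₃) (α' • u₁ + β' • u₂ + γ' • u₃) ≠ 0) :
    Q (hyperbolicProj Q (α • u₁ + β • u₂ + γ • u₃) (α' • u₁ + β' • u₂ + γ' • u₃) u₃) *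
        polar Q (α • u₁ + β • u₂ + γ • u₃) (α' • u₁ + β' • u₂ + γ' • u₃) ^ 2 =
      -(4 * Q u₁ * Q u₂ * Q u₃ * (α * β' - β * α') ^ 2) := by
  have hpolar (α β γ : F) : polar Q (α • u₁ + β • u₂ + γ • u₃) u₃ = 2 * γ * Q u₃ := by
    have := polar_smul_add_smul_add_smul p₁₂ p₁₃ p₂₃ α β γ 0 0 1
    rw [zero_smul, zero_smul, one_smul, zero_add, zero_add] at this
    rw [this]
    ring
  have hpair := polar_smul_add_smul_add_smul p₁₂ p₁₃ p₂₃ α β γ α' β' γ'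
  rw [map_hyperbolicProj hy hg h, hpolar, hpolar, sub_mul, pow_two (polar Q _ _), ← mul_assoc,
    ← mul_assoc, div_mul_cancel₀ _ h, hpair]
  rw [map_smul_add_smul_add_smul p₁₂ p₁₃ p₂₃] at hy hg
  linear_combination (-4 * Q u₃) * (hy * (γ' ^ 2 * Q u₃) - hg * (α ^ 2 * Q u₁ + β ^ 2 * Q u₂))

end Triples

end HyperbolicProjections

section ScaledDuals

variable {O F V : Type*} [CommRing O] [IsDomain O] [IsDiscreteValuationRing O]
  [Field F] [Algebra O F] [IsFractionRing O F]
  [AddCommGroup V] [Module F V] [Module O V] [IsScalarTower O F V]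
  {Q : QuadraticForm F V} {L : Submodule O V} {π : F} {e m N r : ℤ} {y g u z : V}

/-- The vectors of the lattice `L` whose polar form with `L` has order at least `m`, as a
sublattice; it is the intersection of `L` and `𝔭 ^ m` times the dual of `L`. -/
def scaledDual (Q : QuadraticForm F V) (L : Submodule O V) (m : ℤ) : Submodule O V where
  carrier := {x | x ∈ L ∧ ∀ y ∈ L, OrdGE O m (polar Q x y)}
  zero_mem' := ⟨L.zero_mem, fun y _ => by
    rw [QuadraticMap.polar_zero_left]
    exact OrdGE.zero _⟩
  add_mem' hx hx' := ⟨L.add_mem hx.1 hx'.1, fun y hy => by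
    rw [QuadraticMap.polar_add_left]
    exact (hx.2 y hy).add (hx'.2 y hy)⟩
  smul_mem' c x hx := ⟨L.smul_mem c hx.1, fun y hy => by
    rw [← algebraMap_smul F c x, QuadraticMap.polar_smul_left, smul_eq_mul]
    exact ((ordGE_algebraMap c).mul (hx.2 y hy)).mono (by omega)⟩

section Hyperbolic

variable (hy : y ∈ scaledDual Q L m) (hg : g ∈ scaledDual Q L m) (hyg : OrdEq O m (polar Q y g))

include hy hg hyg

theorem HyperbolicSplitting.of_mem_scaledDual (hQy : Q y = 0) (hQg : Q g = 0) :
    HyperbolicSplitting Q L (L.map ((hyperbolicProj Q y g).restrictScalars O)) y g := by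
  have hcoef {w : V} (hw : w ∈ scaledDual Q L m) {x : V} (hx : x ∈ L) :
      OrdGE O 0 ((polar Q y g)⁻¹ * polar Q w x) :=
    (hyg.inv.ge.mul (hw.2 x hx)).mono (by omega)
  refine ⟨hy.1, hg.1, ?_, hQy, hQg, ?_, ?_, fun x hx => ?_⟩
  · rintro _ ⟨x, hx, rfl⟩
    rw [LinearMap.restrictScalars_apply, hyperbolicProj_apply]
    exact L.sub_mem (L.sub_mem hx (smul_mem_of_ordGE (hcoef hg hx) hy.1))
      (smul_mem_of_ordGE (hcoef hy hx) hg.1)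
  · rintro _ ⟨x, _, rfl⟩
    exact polar_left_hyperbolicProj hQy hyg.ne_zero x
  · rintro _ ⟨x, _, rfl⟩
    exact polar_right_hyperbolicProj hQg hyg.ne_zero x
  · refine ⟨_, _, hcoef hg hx, hcoef hy hx, _, Submodule.mem_map_of_mem hx, ?_⟩
    rw [LinearMap.restrictScalars_apply, hyperbolicProj_apply]
    abel

theorem ReflectionParity.even_sub_of_ordEq_polar (hpar : ReflectionParity Q L r)
    (hQy : OrdGE O (m + 1) (Q y)) (hQg : OrdGE O (m + 1) (Q g)) : Even (m - r) := by
  have hsum := (scaledDual Q L m).add_mem hy hg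
  refine hpar _ hsum.1 m ?_ hsum.2
  rw [QuadraticMap.map_add Q, add_comm]
  exact hyg.add_ge (hQy.add hQg)

end Hyperbolic

theorem ReflectionParity.exists_ordGE_map_add_smul [CharP (IsLocalRing.ResidueField O) 2]
    [PerfectField (IsLocalRing.ResidueField O)] (hpar : ReflectionParity Q L r)
    (hπ : OrdEq O 1 π) (he : OrdEq O e (2 : F)) (hm : m < N + 2 * e) (hN : Even (N - r))
    (hz : z ∈ scaledDual Q L m) (hu : u ∈ scaledDual Q L m) (huz : polar Q u z = 0)
    (hQz : OrdGE O N (Q z)) (hQu : OrdEq O N (Q u)) :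
    ∃ l : F, OrdGE O 0 l ∧ OrdGE O (m + 1) (Q (z + l • u)) := by
  have hQ (l : F) : Q (z + l • u) = Q z + l ^ 2 * Q u := by
    rw [add_comm, map_smul_add_of_polar_eq_zero Q _ huz, add_comm]
  simp only [hQ]
  refine exists_ordGE_add_sq_mul_of_even hπ he hQz hQu hm fun l k hl hk hkm => ?_
  have hmem := (scaledDual Q L m).add_mem hz (smul_mem_of_ordGE hl hu)
  have hparity := hpar _ hmem.1 k (hQ l ▸ hk) fun x hx => (hmem.2 x hx).mono hkm
  simpa using hparity.sub hN

omit [Module O V] [IsScalarTower O F V] in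
theorem exists_isotropic_pair [HenselianRing O (IsLocalRing.maximalIdeal O)]
    (hy : OrdGE O (m + 1) (Q y)) (hg : OrdGE O (m + 1) (Q g)) (hyg : OrdEq O m (polar Q y g)) :
    ∃ τ σ : F, OrdGE O 0 τ ∧ OrdGE O 0 σ ∧ Q (y + τ • g) = 0 ∧ Q (g - σ • (y + τ • g)) = 0 ∧
      OrdEq O m (polar Q (y + τ • g) (g - σ • (y + τ • g))) := by
  obtain ⟨τ, hτ, hroot⟩ := exists_root_of_ordGE hy hyg hg
  have hQy : Q (y + τ • g) = 0 := by
    rw [add_comm, map_smul_add, QuadraticMap.polar_comm]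
    linear_combination hroot
  have hpol : OrdEq O m (polar Q (y + τ • g) g) := by
    rw [add_comm, polar_smul_add_left, polar_self_mul, add_comm]
    exact hyg.add_ge ((hτ.mul (ordGE_zero_two.mul hg)).mono (by omega))
  refine ⟨τ, Q g / polar Q (y + τ • g) g, hτ.mono (by omega), (hg.div hpol).mono (by omega), hQy,
    ?_, ?_⟩
  · rw [sub_eq_add_neg, ← neg_smul, add_comm, map_smul_add, hQy, neg_mul,
      div_mul_cancel₀ _ hpol.ne_zero]
    ring
  · rwa [QuadraticMap.polar_sub_right, QuadraticMap.polar_smul_right, polar_self_mul, hQy, mul_zero,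
      smul_zero, sub_zero]

end ScaledDuals

section TernarySublattices

variable {O F V : Type*} [CommRing O] [IsDomain O] [IsDiscreteValuationRing O]
  [Field F] [Algebra O F] [IsFractionRing O F]
  [AddCommGroup V] [Module F V] [Module O V]
  {Q : QuadraticForm F V} {L M : Submodule O V} {π b β l μ : F} {e r N s : ℤ} {u₁ u₂ u₃ : V}

theorem ordEq_sub_of_sub_mul_add (he : OrdEq O e (2 : F)) (hs : 0 ≤ s) (hse : s ≤ e)
    (hβ : OrdGE O 0 β) (h : OrdEq O (-(2 * s)) ((b - β) * (b + β))) : OrdEq O (-s) (b - β) := by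
  obtain ⟨k, hk⟩ := exists_ordEq (O := O) (left_ne_zero_of_mul h.ne_zero)
  have hsum : b + β = (b - β) + 2 * β := by ring
  have h2β : OrdGE O e (2 * β) := (he.ge.mul hβ).mono (by omega)
  rcases lt_or_ge k e with hlt | hge
  · have hk' : OrdEq O k (b + β) := hsum ▸ hk.add_ge (h2β.mono (by omega))
    have : k + k = -(2 * s) := (hk.mul hk').unique h
    rwa [show -s = k by omega]
  · have hge' : OrdGE O e (b + β) := hsum ▸ (hk.ge.mono hge).add h2β
    have := h.le_of_ge (hk.ge.mul hge')
    obtain rfl : k = -s := by omega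
    exact hk

/-- The lattice `M` contains the lattice with the basis `u₁, b u₁ + u₂, u₃`, where `u₁, u₂, u₃` are
orthogonal vectors whose values have the orders `N, N - 2s, N`. -/
structure TernarySublattice (Q : QuadraticForm F V) (M : Submodule O V) (N s : ℤ) (b : F)
    (u₁ u₂ u₃ : V) : Prop where
  polar₁₂ : polar Q u₁ u₂ = 0
  polar₁₃ : polar Q u₁ u₃ = 0
  polar₂₃ : polar Q u₂ u₃ = 0
  ord₁ : OrdEq O N (Q u₁)
  ord₂ : OrdEq O (N - 2 * s) (Q u₂)
  ord₃ : OrdEq O N (Q u₃)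
  mem₁ : u₁ ∈ M
  mem₂ : b • u₁ + u₂ ∈ M
  mem₃ : u₃ ∈ M
  norm₂ : OrdGE O N (Q (b • u₁ + u₂))

namespace TernarySublattice

variable (T : TernarySublattice Q M N s b u₁ u₂ u₃)

include T

theorem polar₃₁ : polar Q u₃ u₁ = 0 := by
  rw [QuadraticMap.polar_comm, T.polar₁₃]

theorem polar₃₂ : polar Q u₃ (b • u₁ + u₂) = 0 := by
  rw [QuadraticMap.polar_comm, polar_smul_add_left, T.polar₁₃, T.polar₂₃, mul_zero, add_zero]

theorem ordEq_coeff {m : ℤ} (hm : N < m) (hμ : OrdGE O m (Q (u₁ + μ • u₃))) : OrdEq O 0 μ := by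
  rw [add_comm, map_smul_add_of_polar_eq_zero Q _ T.polar₃₁, add_comm] at hμ
  have := (T.ord₁.of_add_ge (hμ.mono hm)).div T.ord₃
  rw [mul_div_cancel_right₀ _ T.ord₃.ne_zero] at this
  exact OrdEq.of_sq (by simpa using this)

/- The two vectors are congruent to isotropic ones. Comparing their values gives the order of
`(b - β) (b + β)` for `β = l / μ`, which for integral `β` determines that of `b - β`. -/
theorem ordEq_polar (he : OrdEq O e (2 : F)) (hs : 0 ≤ s) (hse : s ≤ e) (hl : OrdGE O 0 l)
    (hQg : OrdGE O (N + e - s + 1) (Q (u₁ + μ • u₃)))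
    (hQy : OrdGE O (N + e - s + 1) (Q (b • u₁ + u₂ + l • u₃))) :
    OrdEq O (N + e - s) (polar Q (b • u₁ + u₂ + l • u₃) (u₁ + μ • u₃)) := by
  have hμ := T.ordEq_coeff (by omega) hQg
  obtain ⟨β, rfl⟩ : ∃ β, l = β * μ := ⟨l / μ, (div_mul_cancel₀ _ hμ.ne_zero).symm⟩
  have hβ : OrdGE O 0 β := hl.of_mul_right hμ (by omega)
  have hvalue : Q (b • u₁ + u₂ + (β * μ) • u₃) =
      b ^ 2 * Q u₁ + Q u₂ + (β * μ) ^ 2 * Q u₃ := by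
    simpa using map_smul_add_smul_add_smul T.polar₁₂ T.polar₁₃ T.polar₂₃ b 1 (β * μ)
  have hvalue' : Q (u₁ + μ • u₃) = Q u₁ + μ ^ 2 * Q u₃ := by
    simpa using map_smul_add_smul_add_smul T.polar₁₂ T.polar₁₃ T.polar₂₃ 1 0 μ
  have hpolar : polar Q (b • u₁ + u₂ + (β * μ) • u₃) (u₁ + μ • u₃) =
      2 * (Q u₁ * (b - β) + β * Q (u₁ + μ • u₃)) := by
    rw [hvalue']
    have := polar_smul_add_smul_add_smul T.polar₁₂ T.polar₁₃ T.polar₂₃ b 1 (β * μ) 1 0 μ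
    rw [one_smul, one_smul, zero_smul, add_zero] at this
    rw [this]
    ring
  have hprod : OrdEq O (N - 2 * s) ((b - β) * (b + β) * Q u₁) := by
    refine T.ord₂.of_add_ge ?_
    rw [show Q u₂ + (b - β) * (b + β) * Q u₁ =
      Q (b • u₁ + u₂ + (β * μ) • u₃) - β ^ 2 * Q (u₁ + μ • u₃) by rw [hvalue, hvalue']; ring]
    exact (hQy.sub ((hβ.sq.mul hQg).mono (by omega))).mono (by omega)
  have hprod' := hprod.div T.ord₁
  rw [mul_div_cancel_right₀ _ T.ord₁.ne_zero, sub_sub_cancel_left] at hprod'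
  rw [hpolar]
  convert he.mul ((T.ord₁.mul (ordEq_sub_of_sub_mul_add he hs hse hβ hprod')).add_ge
    (y := β * Q (u₁ + μ • u₃)) ((hβ.mul hQg).mono (by omega))) using 1
  ring

omit T in
theorem span_eq (b l μ τ σ : F) (u₁ u₂ u₃ : V) :
    Submodule.span F {(b + τ) • u₁ + (1 : F) • u₂ + (l + τ * μ) • u₃,
      (1 - σ * (b + τ)) • u₁ + (-σ) • u₂ + (μ - σ * (l + τ * μ)) • u₃, u₃} =
      Submodule.span F {u₁, u₂, u₃} := by
  apply le_antisymm <;> rw [Submodule.span_le] <;> rintro _ (rfl | rfl | rfl) <;>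
    rw [SetLike.mem_coe, Submodule.mem_span_triple]
  · exact ⟨_, _, _, rfl⟩
  · exact ⟨_, _, _, rfl⟩
  · exact ⟨0, 0, 1, by module⟩
  · exact ⟨σ, 1, -μ, by module⟩
  · exact ⟨1 - σ * (b + τ), -(b + τ), (b + τ) * μ - (l + τ * μ), by module⟩
  · exact ⟨0, 0, 1, by module⟩

end TernarySublattice

variable [IsScalarTower O F V]

/-- The isotropic vectors `y, g` split a hyperbolic plane from `L`, and span together with `t` the
same ternary space as the orthogonal vectors `u₁, u₂, u₃`. -/
structure TernarySplitting (Q : QuadraticForm F V) (L : Submodule O V) (m : ℤ)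
    (y g t u₁ u₂ u₃ : V) : Prop where
  splitting : HyperbolicSplitting Q L (L.map ((hyperbolicProj Q y g).restrictScalars O)) y g
  ord_polar : OrdEq O m (polar Q y g)
  mem : t ∈ L
  span_eq : Submodule.span F {y, g, t} = Submodule.span F {u₁, u₂, u₃}
  map_proj : Q (hyperbolicProj Q y g t) * polar Q y g ^ 2 = -(4 * Q u₁ * Q u₂ * Q u₃)

theorem TernarySublattice.exists_ternarySplitting [CharP (IsLocalRing.ResidueField O) 2]
    [PerfectField (IsLocalRing.ResidueField O)] [HenselianRing O (IsLocalRing.maximalIdeal O)]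
    (T : TernarySublattice Q (scaledDual Q L (N + e - s)) N s b u₁ u₂ u₃)
    (hπ : OrdEq O 1 π) (he : OrdEq O e (2 : F)) (hs : 0 ≤ s) (hse : s ≤ e) (hN : Even (N - r))
    (hpar : ReflectionParity Q L r) :
    Even (e - s) ∧ ∃ y g : V, TernarySplitting Q L (N + e - s) y g u₃ u₁ u₂ u₃ := by
  have he1 := one_le_of_ordEq_two he
  obtain ⟨μ, hμ, hQg⟩ := hpar.exists_ordGE_map_add_smul hπ he (by omega) hN T.mem₁ T.mem₃
    T.polar₃₁ T.ord₁.ge T.ord₃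
  obtain ⟨l, hl, hQy⟩ := hpar.exists_ordGE_map_add_smul hπ he (by omega) hN T.mem₂ T.mem₃
    T.polar₃₂ T.norm₂ T.ord₃
  have hyg := T.ordEq_polar he hs hse hl hQg hQy
  have hy := Submodule.add_mem _ T.mem₂ (smul_mem_of_ordGE hl T.mem₃)
  have hg := Submodule.add_mem _ T.mem₁ (smul_mem_of_ordGE hμ T.mem₃)
  refine ⟨?_, ?_⟩
  · have := (hpar.even_sub_of_ordEq_polar hy hg hyg hQy hQg).sub hN
    rwa [show N + e - s - r - (N - r) = e - s by ring] at this
  obtain ⟨τ, σ, hτ, hσ, hQy', hQg', hyg'⟩ := exists_isotropic_pair hQy hQg hyg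
  have hy' := Submodule.add_mem _ hy (smul_mem_of_ordGE hτ hg)
  have hg' := Submodule.sub_mem _ hg (smul_mem_of_ordGE hσ hy')
  have hsplit := HyperbolicSplitting.of_mem_scaledDual hy' hg' hyg' hQy' hQg'
  have hycoord : b • u₁ + u₂ + l • u₃ + τ • (u₁ + μ • u₃) =
      (b + τ) • u₁ + (1 : F) • u₂ + (l + τ * μ) • u₃ := by module
  have hgcoord : u₁ + μ • u₃ - σ • (b • u₁ + u₂ + l • u₃ + τ • (u₁ + μ • u₃)) =
      (1 - σ * (b + τ)) • u₁ + (-σ) • u₂ + (μ - σ * (l + τ * μ)) • u₃ := by module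
  refine ⟨_, _, hsplit, hyg', T.mem₃.1, ?_, ?_⟩
  · rw [hgcoord, hycoord]
    exact span_eq ..
  rw [hgcoord] at hQg' hyg' ⊢
  rw [hycoord] at hQy' hyg' ⊢
  rw [map_hyperbolicProj_mul_polar_sq T.polar₁₂ T.polar₁₃ T.polar₂₃ hQy' hQg' hyg'.ne_zero]
  ring

end TernarySublattices

section TernarySplittings

variable {O F V : Type*} [CommRing O] [IsDomain O] [IsDiscreteValuationRing O]
  [Field F] [Algebra O F] [IsFractionRing O F]
  [AddCommGroup V] [Module F V] [Module O V] [IsScalarTower O F V]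
  {Q : QuadraticForm F V} {L L₂ K K' : Submodule O V} {π c : F} {e j m r s s' : ℤ}
  {n : ℕ} {a : ℕ → F} {R : ℕ → ℤ} {y g t x₁ x₂ x₃ : V}

namespace TernarySplitting

theorem of_smul (T : TernarySplitting Q L m y g (c • x₁) x₂ x₃ (c • x₁)) (hc : c ≠ 0)
    (h : x₁ ∈ L) : TernarySplitting Q L m y g x₁ x₁ x₂ x₃ where
  splitting := T.splitting
  ord_polar := T.ord_polar
  mem := h
  span_eq := by
    have hrotate (u v w : V) : ({u, v, w} : Set V) = {w, u, v} := by
      rw [Set.pair_comm v, Set.insert_comm u]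
    have := T.span_eq
    rwa [hrotate, hrotate x₂, Submodule.span_insert, Submodule.span_insert (c • x₁),
      Submodule.span_singleton_smul_eq (IsUnit.mk0 c hc), ← Submodule.span_insert,
      ← Submodule.span_insert, ← hrotate y] at this
  map_proj := by
    have := T.map_proj
    rw [map_smul, map_smul_sq, map_smul_sq] at this
    apply mul_left_cancel₀ (pow_ne_zero 2 hc)
    linear_combination this

variable (T : TernarySplitting Q L m y g t x₁ x₂ x₃)

include T

theorem ordEq_map_proj (he : OrdEq O e (2 : F)) (hm : m = r + e + j) (h₁ : OrdEq O r (Q x₁))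
    (h₂ : OrdEq O (r + 2 * j) (Q x₂)) (h₃ : OrdEq O r (Q x₃)) :
    OrdEq O r (Q (hyperbolicProj Q y g t)) := by
  have := (((he.sq.mul h₁).mul h₂).mul h₃).neg.div T.ord_polar.sq
  rw [show -(2 ^ 2 * Q x₁ * Q x₂ * Q x₃) = Q (hyperbolicProj Q y g t) * polar Q y g ^ 2 by
    rw [T.map_proj]; ring, mul_div_cancel_right₀ _ T.ord_polar.sq.ne_zero] at this
  rwa [show r = 2 * e + r + (r + 2 * j) + r - 2 * m by omega]

variable (H : HeadPair Q L r s x₁ x₂ L₂ K) (H₂ : HeadPair Q L₂ s s' x₂ x₃ K K')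

include H H₂

theorem hasGoodBONG (h2 : (2 : F) ≠ 0)
    (hlift : ∀ v ∈ K', ∃ γ : F, γ • t + v ∈ L) (ht : OrdEq O r (Q (hyperbolicProj Q y g t)))
    (hK : HasGoodBONG Q K' n (fun i => a (i + 3))) (hgood : 2 ≤ n → OrdGE O r (a 5)) :
    HasGoodBONG Q (L.map ((hyperbolicProj Q y g).restrictScalars O)) (n + 1)
      (Function.update (fun i => a (i + 2)) 1 (Q (hyperbolicProj Q y g t))) := by
  have hyg := T.ord_polar.ne_zero
  have hpolar {w v : V} (hw : w ∈ Submodule.span F {y, g, t}) (hv : v ∈ K') : polar Q w v = 0 := by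
    obtain ⟨α, β, γ, rfl⟩ := Submodule.mem_span_triple.1 (T.span_eq ▸ hw)
    have h₁ : polar Q x₁ v = 0 := by
      obtain ⟨z, hz, rfl⟩ := mem_projLattice.1 (H₂.proj₂ ▸ hv)
      rw [projPerp_apply, QuadraticMap.polar_sub_right, QuadraticMap.polar_smul_right,
        H.polarK₁ h2 hz, H.polarK₁ h2 H₂.mem₂, smul_zero, sub_zero]
    simp only [QuadraticMap.polar_add_left, QuadraticMap.polar_smul_left, h₁, H₂.polarK₁ h2 hv,
      H₂.polarK₂ h2 hv, smul_zero, add_zero]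
  have hself {v : V} (hv : v ∈ K') : hyperbolicProj Q y g v = v :=
    hyperbolicProj_eq_self (hpolar (Submodule.subset_span (by simp)) hv)
      (hpolar (Submodule.subset_span (by simp)) hv)
  have hpolar_proj {v : V} (hv : v ∈ K') : polar Q (hyperbolicProj Q y g t) v = 0 := by
    rw [polar_hyperbolicProj_of_orthogonal (hpolar (Submodule.subset_span (by simp)) hv)
      (hpolar (Submodule.subset_span (by simp)) hv)]
    exact hpolar (Submodule.subset_span (by simp)) hv
  refine hasGoodBONG_succ (Submodule.mem_map_of_mem T.mem) (by simp) (by simpa using ht)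
    (fun z hz => H.norm₁ z (T.splitting.le hz)) ?_ (by simpa using hgood)
  suffices projLattice Q (L.map ((hyperbolicProj Q y g).restrictScalars O))
      (hyperbolicProj Q y g t) = K' from this ▸ hK.congr fun i _ _ => by
      rw [Function.update_of_ne (by omega)]
  ext v
  rw [mem_projLattice]
  constructor
  · rintro ⟨_, ⟨x, hx, rfl⟩, rfl⟩
    obtain ⟨α, β, k, hk, -, rfl⟩ := H.exists_decomp hx
    obtain ⟨γ, v, hv, rfl⟩ := H₂.exists_decomp₂ hk
    have hw : α • x₁ + β • x₂ + γ • x₃ ∈ Submodule.span F {y, g, t} := by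
      rw [T.span_eq]
      exact Submodule.mem_span_triple.2 ⟨_, _, _, rfl⟩
    obtain ⟨δ, hδ⟩ := Submodule.mem_span_singleton.1
      (hyperbolicProj_mem_span_of_mem_span T.splitting.map_left T.splitting.map_right hyg hw)
    rwa [LinearMap.restrictScalars_apply, ← add_assoc, ← add_assoc, map_add, ← hδ, hself hv,
      projPerp_smul_add h2 ht.ne_zero (hpolar_proj hv)]
  · intro hv
    obtain ⟨γ, hγ⟩ := hlift v hv
    refine ⟨_, Submodule.mem_map_of_mem hγ, ?_⟩
    rw [LinearMap.restrictScalars_apply, map_add, map_smul, hself hv,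
      projPerp_smul_add h2 ht.ne_zero (hpolar_proj hv)]

end TernarySplitting

section Existence

variable [CharP (IsLocalRing.ResidueField O) 2] [PerfectField (IsLocalRing.ResidueField O)]
  [HenselianRing O (IsLocalRing.maximalIdeal O)]
  (H : HeadPair Q L r (r + 2 * j) x₁ x₂ L₂ K) (H₂ : HeadPair Q L₂ (r + 2 * j) r x₂ x₃ K K')
  (hπ : OrdEq O 1 π) (he : OrdEq O e (2 : F)) (hpar : ReflectionParity Q L r)

include H H₂ hπ he hpar

theorem HeadPair.exists_ternarySplitting_of_nonpos (hje : -e ≤ j) (hj : j ≤ 0)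
    (hpol : ∀ x ∈ L, ∀ y ∈ L, OrdGE O (r + e + j) (polar Q x y)) :
    Even (e + j) ∧ ∃ y g t, TernarySplitting Q L (r + e + j) y g t x₁ x₂ x₃ ∧
      ∀ v ∈ K', ∃ γ : F, γ • t + v ∈ L := by
  have h2 := he.ne_zero
  have hKL : K ≤ L := H.le_of_norm₂ h2 H₂.norm₂ fun k hk => (H₂.norm₂ k hk).mono (by omega)
  have hdual : scaledDual Q L (r + e - -j) = L :=
    le_antisymm (fun x hx => hx.1) fun x hx => ⟨hx, sub_neg_eq_add (r + e) j ▸ hpol x hx⟩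
  obtain ⟨b, hb⟩ := H.exists_lift₂
  have T : TernarySublattice Q (scaledDual Q L (r + e - -j)) r (-j) b x₁ x₂ x₃ := by
    rw [hdual]
    refine ⟨H.polar₁₂ h2, H.polarK₁ h2 H₂.mem₂, H₂.polar₁₂ h2, H.ord₁, ?_, H₂.ord₂, H.mem₁, hb,
      hKL H₂.mem₂, H.norm₁ _ hb⟩
    convert H.ord₂ using 1
    ring
  obtain ⟨heven, y, g, S⟩ := T.exists_ternarySplitting hπ he (by omega) (by omega) (by simp) hpar
  rw [sub_neg_eq_add] at heven S
  refine ⟨heven, y, g, x₃, S, fun v hv => ?_⟩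
  obtain ⟨γ, hγ⟩ := exists_lift_of_mem_projLattice (H₂.proj₂ ▸ hv)
  exact ⟨γ, hKL hγ⟩

/- The ternary sublattice is now the one given by `x₂, x₃, π ^ j x₁`. -/
theorem HeadPair.exists_ternarySplitting_of_pos (hj : 0 < j)
    (hpol : ∀ x ∈ L₂, ∀ y ∈ L₂, OrdGE O (r + e + j) (polar Q x y))
    (hK' : ∀ v ∈ K', OrdGE O (r + 2 * j) (Q v)) :
    Even (e + j) ∧ ∃ y g t, TernarySplitting Q L (r + e + j) y g t x₁ x₂ x₃ ∧
      ∀ v ∈ K', ∃ γ : F, γ • t + v ∈ L := by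
  have h2 := he.ne_zero
  have hje := H₂.le_of_ordEq_two he
  have hL₂ : L₂ ≤ L := H.le_of_norm h2 (by omega)
  have hdual {z : V} (hz : z ∈ L₂) : z ∈ scaledDual Q L (r + 2 * j + e - j) := by
    refine ⟨hL₂ hz, fun x hx => ?_⟩
    obtain ⟨c, x', hx', rfl⟩ := H.exists_decomp₁ hx
    rw [QuadraticMap.polar_add_right, QuadraticMap.polar_smul_right,
      QuadraticMap.polar_comm Q z x₁, H.polar₁ h2 hz, smul_zero, zero_add]
    exact (hpol z hz x' hx').mono (by omega)
  have hπj := ordEq_uniformizer_zpow hπ j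
  have hdual₁ : π ^ j • x₁ ∈ scaledDual Q L (r + 2 * j + e - j) := by
    refine ⟨smul_mem_of_ordGE (hπj.ge.mono hj.le) H.mem₁, fun x hx => ?_⟩
    obtain ⟨c, hc, x', hx', rfl⟩ := H.exists_integral_decomp₁ h2 (by omega) hx
    rw [QuadraticMap.polar_smul_left, QuadraticMap.polar_add_right,
      QuadraticMap.polar_smul_right, H.polar₁ h2 hx', polar_self_mul, add_zero, smul_eq_mul,
      smul_eq_mul]
    exact (hπj.ge.mul (hc.mul (he.ge.mul H.ord₁.ge))).mono (by omega)
  have horth {z : V} (hz : z ∈ L₂) : polar Q z (π ^ j • x₁) = 0 := by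
    rw [QuadraticMap.polar_smul_right, QuadraticMap.polar_comm, H.polar₁ h2 hz, smul_zero]
  obtain ⟨b, hb⟩ := H₂.exists_lift₂
  have T : TernarySublattice Q (scaledDual Q L (r + 2 * j + e - j)) (r + 2 * j) j b x₂ x₃
      (π ^ j • x₁) := by
    refine ⟨H₂.polar₁₂ h2, horth H.mem₂, ?_, H.ord₂, by simpa using H₂.ord₂, ?_, hdual H.mem₂,
      hdual hb, hdual₁, H₂.norm₁ _ hb⟩
    · rw [QuadraticMap.polar_smul_right, QuadraticMap.polar_comm, H.polarK₁ h2 H₂.mem₂, smul_zero]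
    · rw [map_smul_sq]
      convert hπj.sq.mul H.ord₁ using 1
      ring
  obtain ⟨heven, y, g, S⟩ := T.exists_ternarySplitting hπ he hj.le (by omega) (by simp) hpar
  rw [show r + 2 * j + e - j = r + e + j by ring] at S
  refine ⟨(show e + j = e - j + 2 * j by ring) ▸ heven.add (even_two_mul j), y, g, x₁,
    S.of_smul hπj.ne_zero H.mem₁, fun v hv => ⟨0, ?_⟩⟩
  rw [zero_smul, zero_add]
  exact hL₂ (H₂.le_of_norm₂ h2 hK' (fun v hv => (hK' v hv).mono (by omega)) hv)

end Existence

theorem HasGoodBONG.even_of_eq_add_two (h : HasGoodBONG Q L n a) (hR : HasOrders O n a R)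
    (h2 : (2 : F) ≠ 0) {i : ℕ} (hi : 1 ≤ i) (hin : i + 2 ≤ n) (heq : R i = R (i + 2)) :
    Even (R (i + 1) - R i) := by
  by_contra hodd
  rw [Int.not_even_iff_odd] at hodd
  have hlt := h.lt_of_odd hR h2 hi (by omega) hodd
  have hlt' := h.lt_of_odd hR h2 (i := i + 1) (by omega) hin (by
    rw [add_assoc, ← heq, ← neg_sub]
    exact hodd.neg)
  rw [add_assoc, ← heq] at hlt'
  omega

section Hyperbolic

variable [CharP (IsLocalRing.ResidueField O) 2] [PerfectField (IsLocalRing.ResidueField O)]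
  [HenselianRing O (IsLocalRing.maximalIdeal O)]

theorem HasGoodBONG.exists_ternarySplitting (h : HasGoodBONG Q L (n + 3) a)
    (hR : HasOrders O (n + 3) a R) (hπ : OrdEq O 1 π) (he : OrdEq O e (2 : F)) (h13 : R 1 = R 3)
    (h12 : R 2 = R 1 + 2 * j) (hpar : ReflectionParity Q L (R 1)) :
    Even (e + j) ∧ ∃ y g t : V,
      HyperbolicSplitting Q L (L.map ((hyperbolicProj Q y g).restrictScalars O)) y g ∧
      OrdEq O (R 1 + e + j) (polar Q y g) ∧ OrdEq O (R 1) (Q (hyperbolicProj Q y g t)) ∧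
      Q (hyperbolicProj Q y g t) * polar Q y g ^ 2 = -(4 * a 1 * a 2 * a 3) ∧
      HasGoodBONG Q (L.map ((hyperbolicProj Q y g).restrictScalars O)) (n + 1)
        (Function.update (fun i => a (i + 2)) 1 (Q (hyperbolicProj Q y g t))) := by
  have h2 := he.ne_zero
  have hj : -e ≤ j := by
    have : R 1 - 2 * e ≤ R 2 := h.sub_two_mul_le hR he (i := 1) le_rfl (by omega)
    omega
  obtain ⟨x₁, x₂, L₂, K, H, hQ₁, hQ₂, hL₂, hK⟩ := h.exists_headPair (n := n + 1) hR
  obtain ⟨x₃, hx₃, hQ₃, ho₃, hn₃, -, hK'⟩ := hK.exists_first (hR.shift (n := n + 1) 2)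
  have H₂ : HeadPair Q L₂ (R 2) (R 3) x₂ x₃ K (projLattice Q K x₃) :=
    ⟨H.mem₂, H.ord₂, H.norm₂, H.proj₂, hx₃, ho₃, hn₃, rfl⟩
  rw [h12] at H H₂
  rw [← h13] at H₂
  have hexists : Even (e + j) ∧ ∃ y g t, TernarySplitting Q L (R 1 + e + j) y g t x₁ x₂ x₃ ∧
      ∀ v ∈ projLattice Q K x₃, ∃ γ : F, γ • t + v ∈ L := by
    rcases le_or_gt j 0 with hj0 | hj0
    · exact H.exists_ternarySplitting_of_nonpos H₂ hπ he hpar hj hj0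
        (h.ordGE_polar_of_le he _ hR _ (fun _ => by omega) fun _ => by omega)
    · refine H.exists_ternarySplitting_of_pos H₂ hπ he hpar hj0
        (hL₂.ordGE_polar_of_le he _ (hR.shift (n := n + 2) 1) _ (fun _ => ?_) fun _ => ?_)
        (hK'.ordGE (s := R 4) fun hn => ?_)
      · change R 1 + e + j ≤ R 2 + e
        omega
      · change 2 * (R 1 + e + j) ≤ R 2 + R 3 + 2 * e
        omega
      · exact ⟨hR 4 (by omega) (by omega), h12 ▸ h.le_add_two hR (i := 2) (by omega) (by omega)⟩
  obtain ⟨heven, y, g, t, T, hlift⟩ := hexists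
  have ht := T.ordEq_map_proj he rfl H.ord₁ H.ord₂ H₂.ord₂
  refine ⟨heven, y, g, t, T.splitting, T.ord_polar, ht, hQ₁ ▸ hQ₂ ▸ hQ₃ ▸ T.map_proj,
    T.hasGoodBONG H H₂ h2 hlift ht hK' fun hn => ?_⟩
  exact (hR 5 (by omega) (by omega)).ge.mono
    (h13.le.trans (h.le_add_two hR (i := 3) (by omega) (by omega)))

theorem HasGoodBONG.exists_hyperbolicSplitting (h : HasGoodBONG Q L (n + 3) a)
    (hR : HasOrders O (n + 3) a R) (hπ : OrdEq O 1 π) (he : OrdEq O e (2 : F)) (h13 : R 1 = R 3)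
    (hpar : ReflectionParity Q L (R 1)) :
    ∃ j, R 2 = R 1 + 2 * j ∧ Even (e + j) ∧ ∃ y g J, HyperbolicSplitting Q L J y g ∧
      OrdEq O (R 1 + e + j) (polar Q y g) ∧ ∃ b, OrdEq O (R 1) b ∧
      (∃ t, t ≠ 0 ∧ a 1 * a 2 * a 3 = -(b * t ^ 2)) ∧
      HasGoodBONG Q J (n + 1) (Function.update (fun i => a (i + 2)) 1 b) := by
  have h2 := he.ne_zero
  obtain ⟨j, hj⟩ := h.even_of_eq_add_two hR h2 le_rfl (by omega) h13
  replace hj : R 2 = R 1 + 2 * j := by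
    rw [← sub_eq_iff_eq_add', two_mul, ← hj]
  obtain ⟨heven, y, g, t, H, hyg, ht, hprod, hJ⟩ :=
    h.exists_ternarySplitting hR hπ he h13 hj hpar
  refine ⟨j, hj, heven, y, g, _, H, hyg, _, ht,
    ⟨polar Q y g / 2, div_ne_zero hyg.ne_zero h2, ?_⟩, hJ⟩
  field_simp
  linear_combination hprod

end Hyperbolic

end TernarySplittings

section AlternatingValues

variable {O F V : Type*} [CommRing O] [IsDomain O] [IsDiscreteValuationRing O]
  [Field F] [Algebra O F] [IsFractionRing O F]
  [AddCommGroup V] [Module F V] [Module O V] [IsScalarTower O F V]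
  {Q : QuadraticForm F V} {L M J : Submodule O V} {π ε b c r t : F} {e j : ℤ} {k n : ℕ}
  {a : ℕ → F} {R S : ℕ → ℤ} {y g : V}

/-- The values `π ^ S 1 * ε, -π ^ S 2 * ε, …, π ^ S (2k + 1) * ε, a (2k + 2), …`. -/
def alternatingValues (π ε : F) (S : ℕ → ℤ) (k : ℕ) (a : ℕ → F) (i : ℕ) : F :=
  if i ≤ 2 * k + 1 then (if Odd i then π ^ S i * ε else -(π ^ S i * ε)) else a i

/-- The orders `R 1 + 2, R 2 - 2, R 3 + 2, …, R (2k + 1) + 2, R (2k + 2), …`. -/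
def alternatingOrders (k : ℕ) (R : ℕ → ℤ) (i : ℕ) : ℤ :=
  if i ≤ 2 * k + 1 then (if Odd i then R i + 2 else R i - 2) else R i

theorem alternatingValues_alternatingOrders :
    alternatingValues π ε (alternatingOrders k R) k a = fun i =>
      if i ≤ 2 * k + 1 then (if Odd i then π ^ (R i + 2) * ε else -(π ^ (R i - 2) * ε))
      else a i := by
  ext i
  by_cases hi : Odd i <;> simp +contextual [alternatingValues, alternatingOrders, hi]

theorem alternatingValues_one : alternatingValues π ε S k a 1 = π ^ S 1 * ε := by
  simp [alternatingValues]

theorem alternatingValues_two : alternatingValues π ε S (k + 1) a 2 = -(π ^ S 2 * ε) := by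
  rw [alternatingValues, if_pos (by omega), if_neg (by decide)]

theorem alternatingValues_add_two (i : ℕ) :
    alternatingValues π ε S (k + 1) a (i + 2) =
      alternatingValues π ε (fun i => S (i + 2)) k (fun i => a (i + 2)) i := by
  simp only [alternatingValues, Nat.odd_add, even_two, iff_true,
    show i + 2 ≤ 2 * (k + 1) + 1 ↔ i ≤ 2 * k + 1 by omega]

theorem alternatingValues_update_one :
    alternatingValues π ε S k (Function.update a 1 b) = alternatingValues π ε S k a := by
  ext i
  rw [alternatingValues, alternatingValues]
  split_ifs
  · rfl
  · rfl
  · exact Function.update_of_ne (by omega) _ _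

theorem alternatingValues_zero {i : ℕ} (hi : 1 ≤ i) :
    alternatingValues π ε S 0 a i = Function.update a 1 (π ^ S 1 * ε) i := by
  rcases hi.eq_or_lt with rfl | hi
  · rw [alternatingValues_one, Function.update_self]
  · rw [alternatingValues, if_neg (by omega), Function.update_of_ne (by omega)]

theorem alternatingOrders_add_two (i : ℕ) :
    alternatingOrders (k + 1) R (i + 2) = alternatingOrders k (fun i => R (i + 2)) i := by
  simp only [alternatingOrders, Nat.odd_add, even_two, iff_true,
    show i + 2 ≤ 2 * (k + 1) + 1 ↔ i ≤ 2 * k + 1 by omega]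

theorem alternatingOrders_one : alternatingOrders k R 1 = R 1 + 2 := by
  simp [alternatingOrders]

theorem alternatingOrders_two : alternatingOrders (k + 1) R 2 = R 2 - 2 := by
  rw [alternatingOrders, if_pos (by omega), if_neg (by decide)]

theorem sub_two_le_alternatingOrders (i : ℕ) : R i - 2 ≤ alternatingOrders k R i := by
  unfold alternatingOrders
  split_ifs <;> omega

theorem ordEq_alternatingValues (hπ : OrdEq O 1 π) (hε : OrdEq O 0 ε) {i : ℕ}
    (h : 2 * k + 1 < i → OrdEq O (S i) (a i)) :
    OrdEq O (S i) (alternatingValues π ε S k a i) := by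
  have hi : OrdEq O (S i) (π ^ S i * ε) := by
    simpa using (ordEq_uniformizer_zpow hπ (S i)).mul hε
  unfold alternatingValues
  split_ifs
  · exact hi
  · exact hi.neg
  · exact h (by omega)

/- The first two values are those of `t - g` and `y - π ^ j (t - g)`, where `t` is the first vector
of the BONG of `J`. -/
theorem HyperbolicSplitting.hasGoodBONG_alternatingValues (H : HyperbolicSplitting Q L J y g)
    (hπ : OrdEq O 1 π) (he : OrdEq O e (2 : F)) (hε : OrdEq O 0 ε)
    (ha : ∀ i, 2 * k + 3 < i → i ≤ n + 3 → OrdEq O (S i) (a i)) (hj : -e ≤ j) (hj' : j ≤ e)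
    (hS1 : S 1 = S 3) (hS2 : S 2 = S 3 + 2 * j) (hS4 : 1 ≤ n → S 2 ≤ S 4)
    (hyg : polar Q y g = -(2 * π ^ j * (π ^ S 3 * ε)))
    (hJ : HasGoodBONG Q J (n + 1)
      (alternatingValues π ε (fun i => S (i + 2)) k (fun i => a (i + 2)))) :
    HasGoodBONG Q L (n + 3) (alternatingValues π ε S (k + 1) a) := by
  refine H.hasGoodBONG he hJ (S := fun i => S (i + 2)) (fun i _ _ => ?_)
    (ordEq_uniformizer_zpow hπ j) hj hj' (by rw [alternatingValues_one]; exact hyg)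
    (fun hn => hS2 ▸ hS4 hn) ?_ ?_ fun i _ _ => alternatingValues_add_two i
  · exact ordEq_alternatingValues (S := fun i => S (i + 2)) hπ hε fun _ =>
      ha (i + 2) (by omega) (by omega)
  · rw [alternatingValues_one, alternatingValues_one, hS1]
  · rw [alternatingValues_one, alternatingValues_two, hS2, zpow_add₀ hπ.ne_zero, mul_comm 2 j,
      zpow_mul, zpow_ofNat]
    ring

theorem HyperbolicSplitting.hasGoodBONG_alternatingOrders (H : HyperbolicSplitting Q L J y g)
    (hπ : OrdEq O 1 π) (he : OrdEq O e (2 : F)) (hε : OrdEq O 0 ε)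
    (ha : ∀ i, 2 * k + 3 < i → i ≤ n + 3 → OrdEq O (R i) (a i)) (hj : 2 - e ≤ j) (hj' : j ≤ e)
    (h13 : R 1 = R 3) (h23 : R 2 = R 3 + 2 * j) (h24 : 1 ≤ n → R 2 ≤ R 4)
    (hyg : polar Q y g = -(2 * π ^ j * (π ^ R 3 * ε)))
    (hJ : HasGoodBONG Q J (n + 1) (alternatingValues π ε
      (alternatingOrders k (fun i => R (i + 2))) k (fun i => a (i + 2)))) :
    HasGoodBONG Q L (n + 3) (alternatingValues π ε (alternatingOrders (k + 1) R) (k + 1) a) := by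
  have h3 : alternatingOrders (k + 1) R 3 = R 3 + 2 := by
    rw [alternatingOrders_add_two 1, alternatingOrders_one]
  refine H.hasGoodBONG_alternatingValues (j := j - 2) hπ he hε (fun i hi hin => ?_) (by omega)
    (by omega) ?_ ?_ (fun hn => ?_) ?_ (by simpa only [alternatingOrders_add_two] using hJ)
  · rw [alternatingOrders, if_neg (by omega)]
    exact ha i hi hin
  · rw [h3, alternatingOrders_one, h13]
  · rw [h3, alternatingOrders_two, h23]
    ring
  · rw [alternatingOrders_two]
    exact (sub_le_sub_right (h24 hn) 2).trans (sub_two_le_alternatingOrders 4)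
  · have hπ0 := hπ.ne_zero
    rw [hyg, h3, zpow_sub₀ hπ0, zpow_add₀ hπ0]
    field_simp

theorem HyperbolicSplitting.sublatticeOrdGE (H : HyperbolicSplitting Q L J y g) {r : ℤ}
    (hpol : ∀ x ∈ L, ∀ y ∈ L, OrdGE O r (polar Q x y))
    (hM : (M : Set V) = {w | w ∈ J ∧ OrdGE O r (Q w)}) :
    HyperbolicSplitting Q (DyadicLattice.sublatticeOrdGE Q L r hpol) M y g := by
  have hM (w : V) : w ∈ M ↔ w ∈ J ∧ OrdGE O r (Q w) := Set.ext_iff.1 hM w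
  refine ⟨⟨H.mem_left, by rw [H.map_left]; exact OrdGE.zero _⟩,
    ⟨H.mem_right, by rw [H.map_right]; exact OrdGE.zero _⟩, fun w hw => ?_, H.map_left, H.map_right,
    fun w hw => H.polar_left w ((hM w).1 hw).1, fun w hw => H.polar_right w ((hM w).1 hw).1, ?_⟩
  · exact ⟨H.le ((hM w).1 hw).1, ((hM w).1 hw).2⟩
  · rintro x ⟨hx, hxQ⟩
    obtain ⟨u, v, hu, hv, w, hw, rfl⟩ := H.exists_decomp x hx
    refine ⟨u, v, hu, hv, w, (hM w).2 ⟨hw, ?_⟩, rfl⟩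
    have huv := (hu.mul hv).mul (hpol y H.mem_left g H.mem_right)
    rw [H.map_eq u v hw] at hxQ
    simpa using hxQ.sub (huv.mono (by omega : r ≤ 0 + 0 + r))

theorem HyperbolicSplitting.exists_polar_eq {r : ℤ} (H : HyperbolicSplitting Q L J y g)
    (hyg : OrdEq O r (polar Q y g)) (hc : OrdEq O r c) :
    ∃ y', HyperbolicSplitting Q L J y' g ∧ polar Q y' g = c := by
  refine ⟨(c / polar Q y g) • y, H.smul (sub_self r ▸ hc.div hyg), ?_⟩
  rw [QuadraticMap.polar_smul_left, smul_eq_mul, div_mul_cancel₀ _ hyg.ne_zero]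

theorem HasGoodBONG.update_one (h : HasGoodBONG Q L (n + 1) a) (hR : HasOrders O (n + 1) a R)
    (hc : OrdEq O (R 1) c) (ht : t ≠ 0) (h1 : a 1 = c * t ^ 2) :
    HasGoodBONG Q L (n + 1) (Function.update a 1 c) := by
  obtain ⟨x, hx, hQx, hox, hnorm, -, hK⟩ := h.exists_first hR
  have htc : OrdEq O 0 t := by
    have := hox.div hc
    rw [hQx, h1, mul_div_cancel_left₀ _ hc.ne_zero, sub_self] at this
    exact OrdEq.of_sq (by simpa using this)
  refine hasGoodBONG_succ (x := t⁻¹ • x) (smul_mem_of_ordGE (by simpa using htc.inv.ge) hx) ?_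
    (by simpa using hc) hnorm ?_ fun hn => ?_
  · rw [map_smul_sq, hQx, h1, Function.update_self]
    field_simp
  · rw [projLattice, projPerp_smul (inv_ne_zero ht)]
    exact hK.congr fun i hi _ => (Function.update_of_ne (by omega) _ _).symm
  · rw [Function.update_of_ne (by decide)]
    exact (hR 3 (by omega) (by omega)).ge.mono (h.le_add_two hR (i := 1) le_rfl (by omega))

/-- `2k + 1` is the greatest odd `i ≤ n` such that `R 1 = R 3 = ⋯ = R i`. -/
structure OddPlateau (n k : ℕ) (R : ℕ → ℤ) : Prop where
  le : 2 * k + 1 ≤ n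
  eq : ∀ i ≤ k, R (2 * i + 1) = R 1
  lt : 2 * k + 3 ≤ n → R 1 < R (2 * k + 3)

theorem OddPlateau.shift (h : OddPlateau (n + 2) (k + 1) R) :
    OddPlateau n k (fun i => R (i + 2)) := by
  have h3 : R 3 = R 1 := h.eq 1 (by omega)
  exact ⟨by have := h.le; omega, fun i hi => (h.eq (i + 1) (by omega)).trans h3.symm,
    fun hn => h3.symm ▸ h.lt (by omega)⟩

theorem HasOrders.update_shift (hR : HasOrders O (n + 3) a R) (hb : OrdEq O (R 3) b) :
    HasOrders O (n + 1) (Function.update (fun i => a (i + 2)) 1 b) (fun i => R (i + 2)) := by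
  intro i hi hin
  rcases hi.eq_or_lt with rfl | hi
  · rwa [Function.update_self]
  · rw [Function.update_of_ne (by omega)]
    exact hR _ (by omega) (by omega)

theorem prod_range_update_shift (hs : r ≠ 0) (h : a 1 * a 2 * a 3 = -(b * r ^ 2))
    (ht : ∏ i ∈ Finset.range (2 * (k + 1) + 1), a (i + 1) = (-1) ^ (k + 1) * c * t ^ 2) :
    ∏ i ∈ Finset.range (2 * k + 1), Function.update (fun i => a (i + 2)) 1 b (i + 1) =
      (-1) ^ k * c * (t / r) ^ 2 := by
  rw [show 2 * (k + 1) + 1 = 2 * k + 1 + 1 + 1 by ring, Finset.prod_range_succ',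
    Finset.prod_range_succ', Finset.prod_range_succ'] at ht
  rw [Finset.prod_range_succ']
  simp only [zero_add, Function.update_self, add_assoc, Nat.reduceAdd,
    Function.update_of_ne (show _ + 2 ≠ 1 by omega)] at ht ⊢
  field_simp
  linear_combination (∏ i ∈ Finset.range (2 * k), a (i + 4)) * h - ht

section Alternating

variable [CharP (IsLocalRing.ResidueField O) 2] [PerfectField (IsLocalRing.ResidueField O)]

theorem HasGoodBONG.alternating_zero (h : HasGoodBONG Q L n a) (hR : HasOrders O n a R)
    (hpl : OddPlateau n 0 R) (hπ : OrdEq O 1 π) (he : OrdEq O e (2 : F)) (hε : OrdEq O 0 ε)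
    (hpar : ReflectionParity Q L (R 1)) (h12 : 2 ≤ n → R 1 - 2 * e < R 2) (ht : t ≠ 0)
    (h1 : a 1 = ε * π ^ R 1 * t ^ 2) :
    HasGoodBONG Q L n (alternatingValues π ε R 0 a) ∧
    IsLatticeWithGoodBONG O Q (nonNormGenerators Q L) n
      (alternatingValues π ε (alternatingOrders 0 R) 0 a) := by
  obtain ⟨n, rfl⟩ := Nat.exists_eq_add_of_le' hpl.le
  have hR' : HasOrders O (n + 1) (alternatingValues π ε R 0 a) R := fun i hi hin =>
    ordEq_alternatingValues hπ hε fun _ => hR i hi hin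
  have hL : HasGoodBONG Q L (n + 1) (alternatingValues π ε R 0 a) :=
    (h.update_one hR (by simpa [alternatingValues_one] using hR' 1 le_rfl (by omega)) ht
      (by rw [h1, mul_comm ε])).congr fun i hi _ => (alternatingValues_zero hi).symm
  have hpol := h.ordGE_polar_succ he (one_le_of_ordEq_two he) hR h12
  refine ⟨hL, isLatticeWithGoodBONG_of_no_succ hπ he.ne_zero hL hR' hpol
    (hpar.not_ordEq_succ hpol) (fun hn => ?_) ?_ fun i hi _ => ?_⟩
  · exact h.add_two_le_third hR he (Or.inr hpar) (by omega) (hpl.lt (by omega))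
  · rw [alternatingValues_one, alternatingValues_one, alternatingOrders, if_pos (by omega),
      if_pos odd_one, zpow_add₀ hπ.ne_zero, zpow_ofNat]
    ring
  · rw [alternatingValues_zero (by omega), alternatingValues_zero (by omega),
      Function.update_of_ne (by omega), Function.update_of_ne (by omega)]

variable [HenselianRing O (IsLocalRing.maximalIdeal O)]

theorem HasGoodBONG.alternating (hπ : OrdEq O 1 π) (he : OrdEq O e (2 : F)) (hε : OrdEq O 0 ε)
    (k : ℕ) : ∀ {n : ℕ} {L : Submodule O V} {a : ℕ → F} {R : ℕ → ℤ},
    HasGoodBONG Q L n a → HasOrders O n a R → OddPlateau n k R → ReflectionParity Q L (R 1) →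
    (2 ≤ n → R 1 - 2 * e < R 2) →
    (∃ t : F, t ≠ 0 ∧
      ∏ i ∈ Finset.range (2 * k + 1), a (i + 1) = (-1) ^ k * (ε * π ^ R 1) * t ^ 2) →
    HasGoodBONG Q L n (alternatingValues π ε R k a) ∧
    IsLatticeWithGoodBONG O Q (nonNormGenerators Q L) n
      (alternatingValues π ε (alternatingOrders k R) k a) := by
  have he1 := one_le_of_ordEq_two he
  induction k with
  | zero =>
    rintro n L a R h hR hpl hpar h12 ⟨t, ht0, ht⟩
    exact h.alternating_zero hR hpl hπ he hε hpar h12 ht0 (by simpa using ht)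
  | succ k ih =>
    rintro n L a R h hR hpl hpar h12 ⟨t, ht0, ht⟩
    have hle := hpl.le
    obtain ⟨n, rfl⟩ := Nat.exists_eq_add_of_le' (show 3 ≤ n by omega)
    have h13 : R 3 = R 1 := hpl.eq 1 (by omega)
    have h24 (hn : 1 ≤ n) : R 2 ≤ R 4 := h.le_add_two hR (i := 2) (by omega) (by omega)
    have h23 : R 2 - 2 * e ≤ R 3 := h.sub_two_mul_le hR he (by omega) (by omega)
    obtain ⟨j, hj, hje, y, g, J, H, hyg, b, hb, ⟨s, hs0, hs⟩, hJ⟩ :=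
      h.exists_hyperbolicSplitting hR hπ he h13.symm hpar
    have hJR : HasOrders O (n + 1) _ _ := hR.update_shift (h13 ▸ hb)
    obtain ⟨hJ₁, M, hM, hM₁⟩ := ih hJ hJR hpl.shift (h13.symm ▸ H.reflectionParity hpar)
      (fun hn => show R 3 - 2 * e < R 4 by linarith [h24 (by omega), h12 (by omega)])
      ⟨t / s, div_ne_zero ht0 hs0, h13.symm ▸ prod_range_update_shift hs0 hs ht⟩
    rw [alternatingValues_update_one] at hJ₁ hM₁
    have hpol := h.ordGE_polar_succ he he1 hR h12
    obtain ⟨x, -, -, hox, -, hgen, -⟩ := h.exists_first hR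
    obtain ⟨z, -, -, hoz, -, hgenz, -⟩ := hJ.exists_first hJR
    rw [nonNormGenerators_eq hoz hgenz] at hM
    obtain ⟨y, H', hyg'⟩ := H.exists_polar_eq hyg (c := -(2 * π ^ j * (π ^ R 3 * ε))) (by
      convert ((he.mul (ordEq_uniformizer_zpow hπ j)).mul
        ((ordEq_uniformizer_zpow hπ (R 3)).mul hε)).neg using 1
      omega)
    refine ⟨H'.hasGoodBONG_alternatingValues hπ he hε (fun i _ hin => hR i (by omega) hin)
      (by omega) (by omega) h13.symm (by omega) h24 hyg' hJ₁,
      sublatticeOrdGE Q L (R 1 + 1) hpol, (nonNormGenerators_eq hox hgen).symm, ?_⟩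
    have hje' : 2 - e ≤ j := by
      obtain ⟨i, hi⟩ := hje
      have := h12 (by omega)
      omega
    exact (H'.sublatticeOrdGE hpol (h13 ▸ hM)).hasGoodBONG_alternatingOrders hπ he hε
      (fun i _ hin => hR i (by omega) hin) hje' (by omega) h13.symm (by omega) h24 hyg' hM₁

end Alternating

end AlternatingValues

section Parts

variable {O F V : Type*} [CommRing O] [IsDomain O] [IsDiscreteValuationRing O]
  [Field F] [Algebra O F] [IsFractionRing O F]
  [AddCommGroup V] [Module F V] [Module O V] [IsScalarTower O F V]
  {Q : QuadraticForm F V} {L : Submodule O V} {π u x : F} {e r c : ℤ} {i j k n : ℕ}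
  {a : ℕ → F} {R : ℕ → ℤ}

theorem OrdEq.exists_eq_mul_sq (h : OrdEq O (r + 2 * c) x) (hπ : OrdEq O 1 π) (hu : OrdEq O 0 u) :
    ∃ ε : F, OrdEq O 0 ε ∧ ∃ t : F, t ≠ 0 ∧ x = u * ε * π ^ r * t ^ 2 := by
  have hc := ordEq_uniformizer_zpow hπ c
  have hd : OrdEq O (r + 2 * c) (u * π ^ r * (π ^ c) ^ 2) := by
    simpa using (hu.mul (ordEq_uniformizer_zpow hπ r)).mul hc.sq
  refine ⟨_, sub_self (r + 2 * c) ▸ h.div hd, π ^ c, hc.ne_zero, ?_⟩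
  rw [mul_right_comm u, mul_right_comm (u * π ^ r), mul_div_cancel₀ _ hd.ne_zero]

theorem HasGoodBONG.exists_ordEq_prod (h : HasGoodBONG Q L n a) (hR : HasOrders O n a R)
    (h2 : (2 : F) ≠ 0) (hk : 2 * k + 1 ≤ n) (heq : ∀ i ≤ k, R (2 * i + 1) = R 1) :
    ∃ c : ℤ, OrdEq O (R 1 + 2 * c) (∏ i ∈ Finset.range (2 * k + 1), a (i + 1)) := by
  induction k with
  | zero => exact ⟨0, by simpa using hR 1 le_rfl hk⟩
  | succ k ih =>
    obtain ⟨c, hc⟩ := ih (by omega) fun i hi => heq i (by omega)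
    have h₁ : R (2 * k + 1) = R 1 := heq k (by omega)
    have h₃ : R (2 * k + 3) = R 1 := heq (k + 1) le_rfl
    obtain ⟨i, hi⟩ := h.even_of_eq_add_two hR h2 (i := 2 * k + 1) (by omega) (by omega)
      (h₁.trans h₃.symm)
    refine ⟨c + R 1 + i, ?_⟩
    rw [show 2 * (k + 1) + 1 = 2 * k + 1 + 1 + 1 by ring, Finset.prod_range_succ,
      Finset.prod_range_succ]
    convert (hc.mul (hR (2 * k + 2) (by omega) (by omega))).mul
      (hR (2 * k + 3) (by omega) (by omega)) using 1
    change R (2 * k + 2) - R (2 * k + 1) = i + i at hi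
    omega

theorem HasGoodBONG.not_ordEq_succ_of_unary (h : HasGoodBONG Q L 1 a) (hR : HasOrders O 1 a R) :
    ∀ x ∈ L, ¬ OrdEq O (R 1 + 1) (Q x) := by
  intro y hy hoy
  obtain ⟨x, -, -, hox, -, -, hK⟩ := h.exists_first hR
  obtain ⟨c, y', hy', rfl⟩ := exists_decomp_of_mem (Q := Q) (x := x) hy
  rw [hasGoodBONG_zero.1 hK, Submodule.mem_bot] at hy'
  rw [hy', add_zero, map_smul_sq] at hoy
  obtain ⟨k, hk⟩ := exists_ordEq (O := O) (pow_ne_zero_iff two_ne_zero |>.1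
    (left_ne_zero_of_mul hoy.ne_zero))
  have := hoy.unique (hk.sq.mul hox)
  omega

theorem HasGoodBONG.le_of_odd_index (h : HasGoodBONG Q L n a) (hR : HasOrders O n a R)
    (hij : i ≤ j) (hj : 2 * j + 1 ≤ n) : R (2 * i + 1) ≤ R (2 * j + 1) := by
  induction j, hij using Nat.le_induction with
  | base => exact le_rfl
  | succ j _ ih =>
    exact (ih (by omega)).trans (h.le_add_two hR (i := 2 * j + 1) (by omega) (by omega))

theorem HasGoodBONG.oddPlateau (h : HasGoodBONG Q L n a) (hR : HasOrders O n a R)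
    (hk : 2 * k + 1 ≤ n) (heq : R 1 = R (2 * k + 1))
    (hmax : ∀ j : ℕ, 2 * j + 1 ≤ n → R 1 = R (2 * j + 1) → j ≤ k) : OddPlateau n k R where
  le := hk
  eq j hj := le_antisymm (heq ▸ h.le_of_odd_index hR hj hk)
    (h.le_of_odd_index hR (Nat.zero_le j) (by omega))
  lt hn := (h.le_of_odd_index hR (Nat.zero_le (k + 1)) hn).lt_of_ne fun heq =>
    (hmax (k + 1) hn heq).not_gt (Nat.lt_succ_self k)

theorem prod_Icc_one_eq_prod_range (m : ℕ) :
    ∏ i ∈ Finset.Icc 1 m, a i = ∏ i ∈ Finset.range m, a (i + 1) := by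
  rw [Finset.range_eq_Ico, Finset.prod_Ico_add' a, ← Finset.Ico_add_one_right_eq_Icc, zero_add]

omit [IsDomain O] [IsDiscreteValuationRing O] [IsFractionRing O F] in
theorem finite_of_isLattice (L : Submodule O V) [L.IsLattice F] : Module.Finite F V := by
  obtain ⟨s, hs⟩ := Submodule.IsLattice.fg (A := F) (M := L)
  refine ⟨s, ?_⟩
  rw [← Submodule.IsLattice.span_eq_top (A := F) (M := L), ← hs, Submodule.span_span_of_tower]

theorem HasGoodBONG.propertyB_or_reflectionParity [Module.Finite F V] (h : HasGoodBONG Q L n a)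
    (hR : HasOrders O n a R) (hn : 1 ≤ n)
    (hB : PropertyB O e n a R ∨ spinorNorms Q L ⊆ unitSquares O) :
    PropertyB O e n a R ∨ ReflectionParity Q L (R 1) := by
  obtain ⟨m, rfl⟩ := Nat.exists_eq_add_of_le' hn
  obtain ⟨x, -, -, hox, -, hgen, -⟩ := h.exists_first hR
  exact hB.imp_right (reflectionParity_of_spinorNorms hox hgen)

section Perfect

variable [PerfectField (IsLocalRing.ResidueField O)] [CharP (IsLocalRing.ResidueField O) 2]

theorem HasGoodBONG.isLattice_of_unary (h : HasGoodBONG Q L 1 a) (hR : HasOrders O 1 a R)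
    (hπ : OrdEq O 1 π) (he : OrdEq O e (2 : F)) :
    IsLatticeWithGoodBONG O Q (nonNormGenerators Q L) 1 (Function.update a 1 (π ^ 2 * a 1)) :=
  isLatticeWithGoodBONG_of_no_succ (n := 0) hπ he.ne_zero h hR
    (h.ordGE_polar_succ he (one_le_of_ordEq_two he) hR fun _ => by omega)
    (h.not_ordEq_succ_of_unary hR) (fun _ => by omega) (by simp)
    fun i hi _ => Function.update_of_ne (by omega) _ _

theorem HasGoodBONG.isLattice_of_not_isMaximalPair (h : HasGoodBONG Q L (n + 2) a)
    (hR : HasOrders O (n + 2) a R) (hπ : OrdEq O 1 π) (he : OrdEq O e (2 : F))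
    (h12 : R 1 - 2 * e < R 2) (h3 : 1 ≤ n → R 1 + 2 ≤ R 3)
    (hmax : ¬ IsMaximalPair (V := V) O Q a) :
    IsLatticeWithGoodBONG O Q (nonNormGenerators Q L) (n + 2)
      (Function.update a 1 (π ^ 2 * a 1)) :=
  isLatticeWithGoodBONG_of_no_succ (n := n + 1) hπ he.ne_zero h hR
    (h.ordGE_polar_succ he (one_le_of_ordEq_two he) hR fun _ => h12)
    (h.not_ordEq_succ hR he.ne_zero h3 hmax) (fun _ => h3 (by omega)) (by simp)
    fun i hi _ => Function.update_of_ne (by omega) _ _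

variable [HenselianRing O (IsLocalRing.maximalIdeal O)]

theorem HasGoodBONG.isLattice_of_isMaximalPair (h : HasGoodBONG Q L (n + 2) a)
    (hR : HasOrders O (n + 2) a R) (hπ : OrdEq O 1 π) (he : OrdEq O e (2 : F))
    (h12 : R 1 - 2 * e < R 2) (hB : PropertyB O e (n + 2) a R ∨ ReflectionParity Q L (R 1))
    (hmax : IsMaximalPair (V := V) O Q a) :
    (∃ η : F, OrdEq O 0 η ∧ hilbertSymbol (π * η) (-(a 1 * a 2)) = 1) ∧
      ∀ η : F, OrdEq O 0 η → hilbertSymbol (π * η) (-(a 1 * a 2)) = 1 →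
        IsLatticeWithGoodBONG O Q (nonNormGenerators Q L) (n + 2)
          (Function.update (Function.update a 1 (π * η * a 1)) 2 (π * η * a 2)) := by
  have hbin := binaryMaximal_of_isMaximalPair hπ he (fun i hi hi2 => hR i hi (by omega)) hmax
  have h₁ : OrdEq O (R 1) (a 1) := hR 1 le_rfl (by omega)
  obtain ⟨α, β, hα, hαβ⟩ := hbin.exists_ordEq_succ hπ he h₁ (hR 2 one_le_two (by omega)) h12
  refine ⟨exists_hilbertSymbol_eq_one hπ h₁ hα hαβ, fun η hη hsymb => ?_⟩
  have hB := hB.resolve_right fun hpar =>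
    h.not_binaryMaximal_of_reflectionParity hR hπ he h12 hpar hbin
  exact h.isLattice_of_binaryMaximal hR hπ he h12 hB hbin hη hsymb (by simp) (by simp)
    fun i hi => by
      rw [Function.update_of_ne (by omega), Function.update_of_ne (by omega)]

theorem HasGoodBONG.isLattice_of_oddPlateau (h : HasGoodBONG Q L n a) (hR : HasOrders O n a R)
    (hπ : OrdEq O 1 π) (he : OrdEq O e (2 : F)) (h12 : R 1 - 2 * e < R 2) (hpl : OddPlateau n k R)
    (hpar : ReflectionParity Q L (R 1)) :
    (∃ ε : F, OrdEq O 0 ε ∧ ∃ t : F, t ≠ 0 ∧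
      ∏ i ∈ Finset.Icc 1 (2 * k + 1), a i = (-1) ^ k * ε * π ^ R 1 * t ^ 2) ∧
    ∀ ε : F, OrdEq O 0 ε →
      (∃ t : F, t ≠ 0 ∧
        ∏ i ∈ Finset.Icc 1 (2 * k + 1), a i = (-1) ^ k * ε * π ^ R 1 * t ^ 2) →
      HasGoodBONG Q L n (alternatingValues π ε R k a) ∧
        IsLatticeWithGoodBONG O Q (nonNormGenerators Q L) n
          (alternatingValues π ε (alternatingOrders k R) k a) := by
  rw [prod_Icc_one_eq_prod_range]
  refine ⟨?_, fun ε hε ht => HasGoodBONG.alternating hπ he hε k h hR hpl hpar (fun _ => h12) ?_⟩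
  · obtain ⟨c, hc⟩ := h.exists_ordEq_prod hR he.ne_zero hpl.le hpl.eq
    exact hc.exists_eq_mul_sq hπ (by simpa using ordEq_one.neg.zpow k)
  · simpa only [mul_assoc] using ht

end Perfect

end Parts

end DyadicLattice

open DyadicLattice in
theorem lemma4p14_general {O F V : Type*}
    [CommRing O] [IsDomain O] [IsDiscreteValuationRing O]
    [HenselianRing O (IsLocalRing.maximalIdeal O)]
    [PerfectField (IsLocalRing.ResidueField O)] [CharP (IsLocalRing.ResidueField O) 2]
    [Field F] [Algebra O F] [IsFractionRing O F]
    (π : F) (hπ : ord O π = 1)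
    (e : ℤ) (he : ord O (2 : F) = (e : WithTop ℤ))
    (Δ : F) (hΔ : ∃ ρ : F, ord O ρ = 0 ∧ Δ = 1 - 4 * ρ)
    (hΔ' : quadraticDefect O Δ = Submodule.span O {(4 : F)})
    [AddCommGroup V] [Module F V] [Module O V] [IsScalarTower O F V]
    (Q : QuadraticForm F V) (L : Submodule O V) [L.IsLattice F]
    (n : ℕ) (a : ℕ → F) (hL : HasGoodBONG Q L n a)
    (R : ℕ → ℤ) (hR : ∀ i, 1 ≤ i → i ≤ n → ord O (a i) = (R i : WithTop ℤ))
    (hB : PropertyB O e n a R ∨ spinorNorms Q L ⊆ unitSquares O) :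
    (2 ≤ n → R 2 - R 1 = -2 * e →
      (∃ t : F, t ≠ 0 ∧ a 1 * a 2 = -Δ * t ^ 2) → (3 ≤ n → R 1 < R 3) →
      IsLatticeWithGoodBONG O Q (nonNormGenerators Q L) n
        (Function.update (Function.update a 1 (π ^ 2 * a 1)) 2 (π ^ 2 * a 2))) ∧
    (2 ≤ n → R 2 - R 1 = -2 * e →
      ((∃ t : F, t ≠ 0 ∧ a 1 * a 2 = -t ^ 2) ∨ (3 ≤ n ∧ R 1 = R 3)) →
      ¬ ∃ M : Submodule O V, (M : Set V) = nonNormGenerators Q L) ∧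
    ((n = 1 ∨ (2 ≤ n ∧ R 2 - R 1 > -2 * e ∧ ¬ IsMaximalPair (V := V) O Q a ∧
        (3 ≤ n → R 1 < R 3))) →
      IsLatticeWithGoodBONG O Q (nonNormGenerators Q L) n
        (Function.update a 1 (π ^ 2 * a 1))) ∧
    (2 ≤ n → R 2 - R 1 > -2 * e → IsMaximalPair (V := V) O Q a →
      (∃ η : F, ord O η = 0 ∧ hilbertSymbol (π * η) (-(a 1 * a 2)) = 1) ∧
      ∀ η : F, ord O η = 0 → hilbertSymbol (π * η) (-(a 1 * a 2)) = 1 →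
        IsLatticeWithGoodBONG O Q (nonNormGenerators Q L) n
          (Function.update (Function.update a 1 (π * η * a 1)) 2 (π * η * a 2))) ∧
    (3 ≤ n → R 2 - R 1 > -2 * e → R 1 = R 3 →
      ∀ k : ℕ, 1 ≤ k → 2 * k + 1 ≤ n → R 1 = R (2 * k + 1) →
        (∀ j : ℕ, 2 * j + 1 ≤ n → R 1 = R (2 * j + 1) → j ≤ k) →
        (∃ ε : F, ord O ε = 0 ∧ ∃ t : F, t ≠ 0 ∧
          ∏ i ∈ Finset.Icc 1 (2 * k + 1), a i = (-1) ^ k * ε * π ^ R 1 * t ^ 2) ∧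
        ∀ ε : F, ord O ε = 0 →
          (∃ t : F, t ≠ 0 ∧
            ∏ i ∈ Finset.Icc 1 (2 * k + 1), a i = (-1) ^ k * ε * π ^ R 1 * t ^ 2) →
          HasGoodBONG Q L n
            (fun i => if i ≤ 2 * k + 1 then
                (if Odd i then π ^ R i * ε else -(π ^ R i * ε))
              else a i) ∧
          IsLatticeWithGoodBONG O Q (nonNormGenerators Q L) n
            (fun i => if i ≤ 2 * k + 1 then
                (if Odd i then π ^ (R i + 2) * ε else -(π ^ (R i - 2) * ε))
              else a i)) := by
  have := finite_of_isLattice (F := F) L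
  have hB' (hn : 1 ≤ n) := hL.propertyB_or_reflectionParity hR hn hB
  have h3 (hn : 3 ≤ n) (h : R 1 < R 3) := hL.add_two_le_third hR he (hB' (by omega)) hn h
  have hshift {k : ℕ} (hn : k ≤ n) := Nat.exists_eq_add_of_le' hn
  refine ⟨fun hn h12 ⟨t, _, ht⟩ h13 => ?_, fun hn h12 h => ?_, fun h => ?_,
    fun hn h12 hmax => ?_, fun hn h12 h13 k _ hkn hk hkmax => ?_⟩
  · obtain ⟨ρ, hρ, rfl⟩ := hΔ
    obtain ⟨n, rfl⟩ := hshift hn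
    exact hL.isLattice_of_unramified hR hπ he (by omega) (OrdEq.ge hρ) hΔ' ht
      (fun _ => h3 (by omega) (h13 (by omega))) (by simp) (by simp) fun i hi => by
        rw [Function.update_of_ne (by omega), Function.update_of_ne (by omega)]
  · rcases h with ⟨t, _, ht⟩ | ⟨hn3, h13⟩
    · obtain ⟨n, rfl⟩ := hshift hn
      exact hL.not_submodule_of_hyperbolic hR he (by omega) ht
    · obtain ⟨n, rfl⟩ := hshift hn3
      exact hL.not_submodule_of_eq_third hR hπ he (by omega) h13
  · rcases h with rfl | ⟨hn, h12, hmax, h13⟩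
    · exact hL.isLattice_of_unary hR hπ he
    · obtain ⟨n, rfl⟩ := hshift hn
      exact hL.isLattice_of_not_isMaximalPair hR hπ he (by omega)
        (fun _ => h3 (by omega) (h13 (by omega))) hmax
  · obtain ⟨n, rfl⟩ := hshift hn
    exact hL.isLattice_of_isMaximalPair hR hπ he (by omega) (hB' (by omega)) hmax
  · have hpar := (hB' (by omega)).resolve_left fun hB => (hB.1 1 le_rfl hn).ne h13
    have := hL.isLattice_of_oddPlateau hR hπ he (by omega) (hL.oddPlateau hR hkn hk hkmax) hpar
    simp only [alternatingValues_alternatingOrders] at this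
    exact this

open DyadicLattice in
theorem lemma4p14 {O F V : Type*}
    -- `F` is a dyadic local field (of characteristic zero), `O` its ring of integers
    [CommRing O] [IsDomain O] [IsDiscreteValuationRing O]
    [IsAdicComplete (IsLocalRing.maximalIdeal O) O]
    [Finite (IsLocalRing.ResidueField O)] [CharP (IsLocalRing.ResidueField O) 2] [CharZero O]
    [Field F] [Algebra O F] [IsFractionRing O F]
    -- a prime element, the ramification index, and a unit of quadratic defect `4O`
    (π : F) (hπ : ord O π = 1)
    (e : ℤ) (he : ord O (2 : F) = (e : WithTop ℤ))
    (Δ : F) (hΔ : ∃ ρ : F, ord O ρ = 0 ∧ Δ = 1 - 4 * ρ)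
    (hΔ' : quadraticDefect O Δ = Submodule.span O {(4 : F)})
    -- a lattice `L ≅ ≺a₁, …, a_n≻` on the quadratic space `V`, with `ord a_i = R_i`
    [AddCommGroup V] [Module F V] [Module O V] [IsScalarTower O F V]
    (Q : QuadraticForm F V) (L : Submodule O V) [L.IsLattice F]
    (n : ℕ) (a : ℕ → F) (hL : HasGoodBONG Q L n a)
    (R : ℕ → ℤ) (hR : ∀ i, 1 ≤ i → i ≤ n → ord O (a i) = (R i : WithTop ℤ))
    (hB : PropertyB O e n a R ∨ spinorNorms Q L = unitSquares O) :
    -- (i)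
    (2 ≤ n → R 2 - R 1 = -2 * e →
      (∃ t : F, t ≠ 0 ∧ a 1 * a 2 = -Δ * t ^ 2) → (3 ≤ n → R 1 < R 3) →
      IsLatticeWithGoodBONG O Q (nonNormGenerators Q L) n
        (Function.update (Function.update a 1 (π ^ 2 * a 1)) 2 (π ^ 2 * a 2))) ∧
    -- (ii)
    (2 ≤ n → R 2 - R 1 = -2 * e →
      ((∃ t : F, t ≠ 0 ∧ a 1 * a 2 = -t ^ 2) ∨ (3 ≤ n ∧ R 1 = R 3)) →
      ¬ ∃ M : Submodule O V, (M : Set V) = nonNormGenerators Q L) ∧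
    -- (iii)
    ((n = 1 ∨ (2 ≤ n ∧ R 2 - R 1 > -2 * e ∧ ¬ IsMaximalPair (V := V) O Q a ∧
        (3 ≤ n → R 1 < R 3))) →
      IsLatticeWithGoodBONG O Q (nonNormGenerators Q L) n
        (Function.update a 1 (π ^ 2 * a 1))) ∧
    -- (iv)
    (2 ≤ n → R 2 - R 1 > -2 * e → IsMaximalPair (V := V) O Q a →
      (∃ η : F, ord O η = 0 ∧ hilbertSymbol (π * η) (-(a 1 * a 2)) = 1) ∧
      ∀ η : F, ord O η = 0 → hilbertSymbol (π * η) (-(a 1 * a 2)) = 1 →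
        IsLatticeWithGoodBONG O Q (nonNormGenerators Q L) n
          (Function.update (Function.update a 1 (π * η * a 1)) 2 (π * η * a 2))) ∧
    -- (v)
    (3 ≤ n → R 2 - R 1 > -2 * e → R 1 = R 3 →
      ∀ k : ℕ, 1 ≤ k → 2 * k + 1 ≤ n → R 1 = R (2 * k + 1) →
        (∀ j : ℕ, 2 * j + 1 ≤ n → R 1 = R (2 * j + 1) → j ≤ k) →
        (∃ ε : F, ord O ε = 0 ∧ ∃ t : F, t ≠ 0 ∧
          ∏ i ∈ Finset.Icc 1 (2 * k + 1), a i = (-1) ^ k * ε * π ^ R 1 * t ^ 2) ∧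
        ∀ ε : F, ord O ε = 0 →
          (∃ t : F, t ≠ 0 ∧
            ∏ i ∈ Finset.Icc 1 (2 * k + 1), a i = (-1) ^ k * ε * π ^ R 1 * t ^ 2) →
          HasGoodBONG Q L n
            (fun i => if i ≤ 2 * k + 1 then
                (if Odd i then π ^ R i * ε else -(π ^ R i * ε))
              else a i) ∧
          IsLatticeWithGoodBONG O Q (nonNormGenerators Q L) n
            (fun i => if i ≤ 2 * k + 1 then
                (if Odd i then π ^ (R i + 2) * ε else -(π ^ (R i - 2) * ε))
              else a i)) :=
  lemma4p14_general π hπ e he Δ hΔ hΔ' Q L n a hL R hR (hB.imp_right fun h => h.subset)
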